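/- **Problem.** Let $m\le n$ and consider $\min_{x\in\mathbb R^n} f(x)$ subject to $c(x)=0$, with $f:\mathbb R^n\to\mathbb R$ and $c:\mathbb R^n\to\mathbb R^m$ continuously differentiable, $J=\nabla c^T$. Let $\mathcal X\subseteq\mathbb R^n$ be open and convex such that on $\mathcal X$: $f$ is bounded below; $\nabla f$ is $L$-Lipschitz and bounded; $c$ is bounded; each $\nabla c_i$ is $\gamma_i$-Lipschitz and bounded; the singular values of $J$ are bounded away from zero. Put $\Gamma=\sum_i\gamma_i$ and assume $L+\Gamma>0$. Let $\phi(x,\tau)=\tau f(x)+\|c(x)\|_1$, and for $d$ with $c(x)+J(x)d=0$ let $\Delta l(x,\tau,g,d)=-\tau g^Td+\|c(x)\|_1$. **Algorithm SS-SQP.** Given $x_0$, $\bar\tau_{-1}>0$, $\alpha_{\max}\in(0,1]$, $\alpha_0\in(0,\alpha_{\max}]$, $\{\gamma,\theta,\sigma,\epsilon_\tau\}\subset(0,1)$ and $\epsilon_f\ge 0$. At iteration $k$, a symmetric matrix $H_k$ is chosen (before, and independently of, the randomness of the gradient estimate), a gradient estimate $\bar g_k=\bar g(x_k;\Xi^1_k)$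 is generated, and $(\bar d_k,\bar y_k)$ solves $H_k\bar d_k+J(x_k)^T\bar y_k=-\bar g_k$, $J(x_k)\bar d_k=-c(x_k)$. For $\tau>0$ and vectors $g,d$ let $q=g^Td+\max\{d^TH_kd,0\}$ and $\tau^{\rm trial}=\infty$ if $q\le0$, $\tau^{\rm trial}=(1-\sigma)\|c(x_k)\|_1/q$ otherwise, and let $\mathrm{Upd}_k(\tau,g,d)=\tau$ if $\tau\le\tau^{\rm trial}$ and $\min\{(1-\epsilon_\tau)\tau,\tau^{\rm trial}\}$ otherwise. Set $\bar\tau_k=\mathrm{Upd}_k(\bar\tau_{k-1},\bar g_k,\bar d_k)$ and $x_k^+=x_k+\alpha_k\bar d_k$. With function estimates $\bar f(x_k;\Xi^0_k)$, $\bar f(x_k^+;\Xi^+_k)$ and $\bar\phi(x,\tau;\xi)=\tau\bar f(x;\xi)+\|c(x)\|_1$, the iteration is successful if $$\bar\phi(x_k^+,\bar\tau_k;\Xi_k^+)\le\bar\phi(x_k,\bar\tau_k;\Xi_k^0)-\alpha_k\theta\,\Delta l(x_k,\bar\tau_k,\bar g_k,\bar d_k)+2\bar\tau_k\epsilon_f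 .$$ If successful, $x_{k+1}=x_k^+$ and $\alpha_{k+1}=\min\{\alpha_{\max},\gamma^{-1}\alpha_k\}$; otherwise $x_{k+1}=x_k$ and $\alpha_{k+1}=\gamma\alpha_k$. **Oracles.** The oracles are called with fresh randomness: $\Xi^1_k$ and $\Xi_k^0$ are independent of everything known at the beginning of iteration $k$ (including $H_k$), and $\Xi_k^+$ is independent of that and of $\Xi_k^1$. *Zeroth order:* with $E(x)=|\bar f(x;\Xi^0)-f(x)|$ and parameters $\nu,b\ge0$, for every $x\in\mathcal X$ and every $\lambda\in[0,1/b]$ ($1/0=\infty$), $\mathbb E[E(x)]\le\epsilon_f$ and $\mathbb E[e^{\lambda(E(x)-\mathbb E[E(x)])}]\le e^{\lambda^2\nu^2/2}$. *First order:* with $\epsilon_g,\kappa_{\rm FO}\ge0$ and $\delta\in[0,\tfrac12)$, whenever it is called (given the past), $\|\bar g_k-\nabla f(x_k)\|\le\max\{\epsilon_g,\kappa_{\rm FO}\alpha_k\sqrt{\Delta l(x_k,\bar\tau_k,\bar g_k,\bar d_k)}\}$ holds with probability at least $1-\delta$. **Deterministic counterparts.** Let $(d_k,y_k)$ solve the same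 linear system with $\nabla f(x_k)$ in place of $\bar g_k$, and let $\tau_k=\mathrm{Upd}_k(\bar\tau_k,\nabla f(x_k),d_k)$. For $\varepsilon>0$ let $T_\varepsilon=\min\{k:\sqrt{\Delta l(x_k,\tau_k,\nabla f(x_k),d_k)}\le\varepsilon\}$ ($\infty$ if there is no such $k$). **Assumptions on the run.** For every realization and all $k$: $x_k,x_k^+\in\mathcal X$; $\|H_k\|\le\kappa_H$ and $u^TH_ku\ge\zeta\|u\|^2$ for all $u$ with $J(x_k)u=0$, where $\kappa_H,\zeta>0$; and $\bar\tau_k\ge\bar\tau_{\min}$, where $\bar\tau_{\min}>0$. Let $E_k=|\bar f(x_k;\Xi_k^0)-f(x_k)|$ and $E_k^+=|\bar f(x_k^+;\Xi_k^+)-f(x_k^+)|$. Either all $E_k,E_k^+$ are bounded by $\epsilon_f$, and $p:=1-\delta$; or the sums $E_k+E_k^+$, $k\in\mathbb N$, are independent, and $p:=1-\delta-\exp(-\min\{\frac{u^2}{2\nu^2},\frac{u}{2b}\})$ with $u=\inf_{x\in\mathcal X}\{\epsilon_f-\mathbb E[E(x)]\}$. In either case $p>\tfrac12$. **Theorem.**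 There exist constants $\kappa_y,\kappa_l,\tau_{\min}>0$, depending only on the problem, on $\mathcal X,L,\gamma_i$, on $\kappa_H,\zeta,\bar\tau_{\min}$ and on the parameters $x_0,\bar\tau_{-1},\alpha_{\max},\alpha_0,\gamma,\theta,\sigma,\epsilon_\tau$ of the algorithm, such that for every realization and all $k$, $$\|y_k\|\le\kappa_y,\quad \tau_k\ge\tau_{\min},\quad \Delta l(x_k,\bar\tau_k,\bar g_k,\bar d_k)\ge\kappa_l\bar\tau_k(\|\bar d_k\|^2+\|c(x_k)\|),\quad \Delta l(x_k,\tau_k,\nabla f(x_k),d_k)\ge\kappa_l\tau_k(\|d_k\|^2+\|c(x_k)\|),$$ and such that the following holds. Write $\rho=\kappa_H/\zeta$, $\tau=\bar\tau_{-1}$, and $$\begin{aligned} \omega_2&=\tfrac{\max\{\kappa_H,\kappa_y\}+1}{\kappa_l},\qquad \omega_3=\tfrac{(1+\rho)\kappa_{\rm FO}\sqrt{\tau}\alpha_{\max}}{\sqrt{\kappa_l}}+\tfrac{\tau\kappa_{\rm FO}^2\alpha_{\max}^2}{\zeta},\\ \omega_4&=\max\Big\{\epsilon_\tau\Big(\tfrac{\max\{\kappa_H,\kappa_y\}}{\kappa_l}+\tfrac{\sqrt{\tau}(1+\rho)\kappa_{\rm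 FO}\alpha_{\max}}{\sqrt{\kappa_l}}+\omega_3\Big),\ \tfrac{\tau}{(1-\sigma)\tau_{\min}}\Big(\tfrac{(1+3\rho)\kappa_{\rm FO}\sqrt{\tau}\alpha_{\max}}{\sqrt{\kappa_l}}+(1+\rho)\tfrac{\tau\kappa_{\rm FO}^2\alpha_{\max}^2}{\zeta}\Big)\Big\},\\ \omega_5&=(1+\epsilon_\tau)\tau\Big(\tfrac{\eta}{\zeta}+\tfrac{1+\rho}{\sqrt{\kappa_l\tau_{\min}}}\Big)+\tfrac{\epsilon_\tau\tau(1+\rho)^2\eta}{4},\\ \omega_6&=\tfrac{\tau^2}{(1-\sigma)\tau_{\min}}\Big((1+\rho)\tfrac{\eta}{\zeta}+\tfrac{1+3\rho}{\sqrt{\kappa_l\tau_{\min}}}\Big)+\tau\Big(\tfrac{\eta}{\zeta}+\tfrac{1+\rho}{\sqrt{\kappa_l\tau_{\min}}}\Big),\\ \omega_7&=\sqrt{\tfrac{4\tau}{(p-\frac12)\theta}\max\Big\{\tfrac{1+\epsilon_\tau\omega_2}{1-\eta\omega_5},\tfrac1{1-\eta\omega_6},1+\omega_3+\omega_4\Big\}},\qquad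 \omega_8=\tilde\alpha^{-1/2},\\ \tilde\alpha&=\min\Big\{\tfrac{1-\theta}{\sqrt{\tau/\kappa_l}\,\kappa_{\rm FO}+\frac{L}{2\kappa_l}+\frac{\Gamma}{2\bar\tau_{\min}\kappa_l}},\ \tfrac{2\bar\tau_{\min}\kappa_l\big(1-\theta-\eta\sqrt{\tau/\kappa_l}\max\{\sqrt{\frac{1+\epsilon_\tau\omega_2}{1-\eta\omega_5}},\frac1{\sqrt{1-\eta\omega_6}}\}\big)}{\bar\tau_{\min}L+\Gamma}\Big\},\\ h(\alpha)&=\alpha\,\theta\,\varepsilon^2\min\Big\{\tfrac{1-\eta\omega_5}{1+\epsilon_\tau\omega_2},\,1-\eta\omega_6,\,\tfrac1{1+\omega_3+\omega_4}\Big\},\\ \eta_1&=\tfrac{(1-\theta)(1+\epsilon_\tau)\tau(1+\rho)}{\sqrt{\kappa_l\tau_{\min}}},\quad \eta_2=\sqrt{(1-\theta)^2\tau(1+\rho)^2\big(\tfrac{(1+\epsilon_\tau)^2\tau}{\kappa_l\tau_{\min}}+\epsilon_\tau\big)+4\tau\big(\tfrac{1+\epsilon_\tau\omega_2}{\kappa_l}+\tfrac{(1-\theta)^2(1+\epsilon_\tau)}{\zeta}\big)},\\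 \eta_3&=\tfrac{(1-\theta)\tau M}{(1-\sigma)\tau_{\min}\sqrt{\kappa_l\tau_{\min}}},\quad M=\tau(1+3\rho)+(1-\sigma)\tau_{\min}(1+\rho),\\ \eta_4&=\sqrt{\tfrac{(1-\theta)^2\tau^2M^2}{(1-\sigma)^2\tau_{\min}^3\kappa_l}+\tfrac{4\tau}{\kappa_l}+4(1-\theta)^2\big(\tfrac{\tau^2(1+\rho)}{(1-\sigma)\tau_{\min}\zeta}+\tfrac{\tau}{\zeta}\big)} . \end{aligned}$$ Let $0<\eta<2(1-\theta)\min\{\frac1{\eta_1+\eta_2},\frac1{\eta_3+\eta_4}\}$ and $\varepsilon>\max\{\epsilon_g/\eta,\ \sqrt{\epsilon_f}\,\omega_7\omega_8\}$. Let $f_{\inf}$ be a lower bound of $f$ on $\mathcal X$, $\phi_{\min}$ a lower bound of $\phi(\cdot,\bar\tau_{\min})$ on $\mathcal X$, $Z_0=\phi(x_0,\bar\tau_0)-\phi_{\min}-(\bar\tau_0-\bar\tau_{\min})f_{\inf}$ and $R=\frac{Z_0}{h(\tilde\alpha)}+\max\{\frac{\ln\tilde\alpha-\ln\alpha_0}{2\ln\gamma},0\}$.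 Then for every $s\ge0$, every $\hat p\in\big(\frac12+\frac{4\bar\tau_{-1}\epsilon_f+s}{h(\tilde\alpha)},\,p\big)$ and every $t\in\mathbb N$ such that $t\ge R\big/\big(\hat p-\frac12-\frac{4\bar\tau_{-1}\epsilon_f+s}{h(\tilde\alpha)}\big)$ almost surely, $$\mathbb P[T_\varepsilon\le t]\ \ge\ 1-e^{-\frac{(p-\hat p)^2}{2p^2}t}-e^{-\min\left\{\frac{s^2t}{2(2\bar\tau_{-1}\nu)^2},\ \frac{st}{2(2\bar\tau_{-1}b)}\right\}} .$$ (In the exponents, a quotient with denominator $0$ is $\infty$ if its numerator is positive and $0$ otherwise.) -/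

import Mathlib

open MeasureTheory ProbabilityTheory
open scoped ENNReal InnerProductSpace

universe u v w

namespace SSSQP

/-- `ℝⁿ` with the Euclidean norm. -/
abbrev Vec (n : ℕ) : Type := EuclideanSpace ℝ (Fin n)

/-- The `ℓ₁` norm. -/
def l1norm {m : ℕ} (v : Vec m) : ℝ := ∑ i, |v i|

/-! ### The problem: minimize `f` subject to `c = 0` -/

/-- The data of `min f(x)` subject to `c(x) = 0`. -/
structure Problem (n m : ℕ) where
  f : Vec n → ℝ
  c : Vec n → Vec m

/-- The Jacobian `J(x) = ∇c(x)ᵀ`. -/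
noncomputable def Problem.jac {n m : ℕ} (P : Problem n m) (x : Vec n) : Vec n →L[ℝ] Vec m :=
  fderiv ℝ P.c x

/-- The merit function `φ(x, τ) = τ f(x) + ‖c(x)‖₁`. -/
noncomputable def Problem.merit {n m : ℕ} (P : Problem n m) (x : Vec n) (τ : ℝ) : ℝ :=
  τ * P.f x + l1norm (P.c x)

/-- The model `l(x, τ, g, d) = τ (f(x) + gᵀd) + ‖c(x) + ∇c(x)ᵀd‖₁` of the merit function. -/
noncomputable def Problem.model {n m : ℕ} (P : Problem n m) (x : Vec n) (τ : ℝ)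
    (g d : Vec n) : ℝ :=
  τ * (P.f x + ⟪g, d⟫_ℝ) + l1norm (P.c x + P.jac x d)

/-- The model reduction `Δl(x, τ, g, d) = l(x, τ, g, 0) - l(x, τ, g, d)`. -/
noncomputable def Problem.modelReduction {n m : ℕ} (P : Problem n m) (x : Vec n) (τ : ℝ)
    (g d : Vec n) : ℝ :=
  P.model x τ g 0 - P.model x τ g d

/-- If `d` is linearly feasible, then `Δl(x, τ, g, d) = -τ gᵀd + ‖c(x)‖₁`. -/
theorem Problem.modelReduction_eq {n m : ℕ} (P : Problem n m) (x : Vec n) (τ : ℝ)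
    (g d : Vec n) (hd : P.c x + P.jac x d = 0) :
    P.modelReduction x τ g d = -τ * ⟪g, d⟫_ℝ + l1norm (P.c x) := by
  simp only [Problem.modelReduction, Problem.model, hd, inner_zero_right, map_zero, add_zero]
  have h0 : l1norm (0 : Vec m) = 0 := by simp [l1norm]
  rw [h0]
  ring

/-- The standing regularity assumption on the problem over the set `X`: `L` is a Lipschitz constant
of `∇f` and `Lc i` one of `∇cᵢ`; not all of these constants are zero. The last-but-one field says
that the singular values of `J` are bounded away from zero on `X`. -/
structure Problem.Regular {n m : ℕ} (P : Problem n m) (X : Set (Vec n)) (L : ℝ)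
    (Lc : Fin m → ℝ) : Prop where
  isOpen : IsOpen X
  convex : Convex ℝ X
  f_contDiff : ContDiff ℝ 1 P.f
  f_bddBelow : BddBelow (P.f '' X)
  L_nonneg : 0 ≤ L
  f_grad_lipschitz : ∀ x ∈ X, ∀ y ∈ X, ‖gradient P.f x - gradient P.f y‖ ≤ L * ‖x - y‖
  f_grad_bounded : ∃ K : ℝ, ∀ x ∈ X, ‖gradient P.f x‖ ≤ K
  c_contDiff : ContDiff ℝ 1 P.c
  c_bounded : ∃ K : ℝ, ∀ x ∈ X, ‖P.c x‖ ≤ K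
  Lc_nonneg : ∀ i, 0 ≤ Lc i
  c_grad_lipschitz : ∀ i, ∀ x ∈ X, ∀ y ∈ X,
    ‖gradient (fun z => P.c z i) x - gradient (fun z => P.c z i) y‖ ≤ Lc i * ‖x - y‖
  c_grad_bounded : ∀ i, ∃ K : ℝ, ∀ x ∈ X, ‖gradient (fun z => P.c z i) x‖ ≤ K
  jac_singular_values : ∃ κ : ℝ, 0 < κ ∧ ∀ x ∈ X, ∀ y : Vec m,
    κ * ‖y‖ ≤ ‖ContinuousLinearMap.adjoint (P.jac x) y‖
  lipschitz_pos : 0 < L + ∑ i, Lc i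

/-! ### Search direction and merit parameter -/

/-- The block operator `[[H, Jᵀ], [J, 0]]` on `ℝⁿ × ℝᵐ`. -/
noncomputable def kkt {n m : ℕ} (H : Vec n →L[ℝ] Vec n) (J : Vec n →L[ℝ] Vec m) :
    Vec n × Vec m →L[ℝ] Vec n × Vec m :=
  (H.comp (ContinuousLinearMap.fst ℝ (Vec n) (Vec m)) +
    (ContinuousLinearMap.adjoint J).comp (ContinuousLinearMap.snd ℝ (Vec n) (Vec m))).prod
  (J.comp (ContinuousLinearMap.fst ℝ (Vec n) (Vec m)))

/-- The solution `(d, y)` of `[[H, Jᵀ], [J, 0]] (d, y) = -(g, c)`. -/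
noncomputable def sqpSolution {n m : ℕ} (H : Vec n →L[ℝ] Vec n) (J : Vec n →L[ℝ] Vec m)
    (g : Vec n) (c : Vec m) : Vec n × Vec m :=
  (kkt H J).inverse (-g, -c)

/-- If `H` is positive definite on the null space of `J` and `Jᵀ` is injective, then
`sqpSolution H J g c` does solve the linear system. -/
theorem kkt_sqpSolution {n m : ℕ} (H : Vec n →L[ℝ] Vec n) (J : Vec n →L[ℝ] Vec m)
    (hH : ∀ z, J z = 0 → z ≠ 0 → 0 < ⟪z, H z⟫_ℝ)
    (hJ : ∀ y, ContinuousLinearMap.adjoint J y = 0 → y = 0) (g : Vec n) (c : Vec m) :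
    kkt H J (sqpSolution H J g c) = (-g, -c) := by
  have hinj : Function.Injective (kkt H J).toLinearMap := by
    rw [← LinearMap.ker_eq_bot, LinearMap.ker_eq_bot']
    rintro ⟨d, y⟩ h
    have h' : H d + ContinuousLinearMap.adjoint J y = 0 ∧ J d = 0 := by
      simpa [kkt, Prod.ext_iff] using h
    obtain ⟨h1, h2⟩ := h'
    have hd : d = 0 := by
      by_contra hne
      have h3 := hH d h2 hne
      have h4 : ⟪d, H d + ContinuousLinearMap.adjoint J y⟫_ℝ = 0 := by rw [h1, inner_zero_right]
      rw [inner_add_right, ContinuousLinearMap.adjoint_inner_right, h2, inner_zero_left] at h4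
      linarith
    subst hd
    have hy : y = 0 := hJ y (by simpa using h1)
    rw [hy]
    rfl
  let e : (Vec n × Vec m) ≃L[ℝ] (Vec n × Vec m) :=
    (LinearEquiv.ofInjectiveEndo (kkt H J).toLinearMap hinj).toContinuousLinearEquiv
  have he : kkt H J = (e : Vec n × Vec m →L[ℝ] Vec n × Vec m) := by
    ext z <;> rfl
  rw [sqpSolution, he, ContinuousLinearMap.inverse_equiv]
  simp

/-- The merit parameter update. With `q = gᵀd + max{dᵀHd, 0}`, the trial value is `∞` if `q ≤ 0`
and `(1 - σ) ‖c‖₁ / q` otherwise; the parameter `τ` is kept if it is at most the trial value, and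
otherwise becomes the minimum of `(1 - ετ) τ` and the trial value. -/
noncomputable def meritUpdate {n m : ℕ} (σ ετ τ : ℝ) (H : Vec n →L[ℝ] Vec n) (g d : Vec n)
    (c : Vec m) : ℝ :=
  let q : ℝ := ⟪g, d⟫_ℝ + max ⟪d, H d⟫_ℝ 0
  let trial : ℝ := (1 - σ) * l1norm c / q
  if q ≤ 0 ∨ τ ≤ trial then τ else min ((1 - ετ) * τ) trial

/-! ### The algorithm -/

/-- The user-chosen parameters of the algorithm. -/
structure Params (n : ℕ) where
  x0 : Vec n
  /-- the initial merit parameter, which has index `-1` in the merit parameter sequence -/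
  τinit : ℝ
  αmax : ℝ
  α0 : ℝ
  γ : ℝ
  θ : ℝ
  σ : ℝ
  ετ : ℝ
  τinit_pos : 0 < τinit
  αmax_mem : αmax ∈ Set.Ioc (0 : ℝ) 1
  α0_mem : α0 ∈ Set.Ioc (0 : ℝ) αmax
  γ_mem : γ ∈ Set.Ioo (0 : ℝ) 1
  θ_mem : θ ∈ Set.Ioo (0 : ℝ) 1
  σ_mem : σ ∈ Set.Ioo (0 : ℝ) 1
  ετ_mem : ετ ∈ Set.Ioo (0 : ℝ) 1

/-- What is known at the beginning of an iteration: the iterate `x`, the step size `α`, and the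
merit parameter `τ` of the previous iteration. -/
structure State (n : ℕ) where
  x : Vec n
  α : ℝ
  τ : ℝ

/-- The random inputs of a run on the sample space `Ω`. The zeroth-order oracle returns
`fbar x ξ⁰`. The first-order oracle is given the point, the step size, and also the previous merit
parameter and the matrix `H`, since these enter its accuracy requirement; it returns
`gbar x α τ H ξ¹`. At iteration `k`, `H k` is the matrix, `ξ1 k` the randomness of the gradient
estimate, and `ξ0 k`, `ξp k` that of the function estimates at the current and trial points. -/
structure Inputs (n : ℕ) (Ω : Type u) (Ω₀ : Type v) (Ω₁ : Type w) where
  fbar : Vec n → Ω₀ → ℝ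
  gbar : Vec n → ℝ → ℝ → (Vec n →L[ℝ] Vec n) → Ω₁ → Vec n
  H : ℕ → Ω → (Vec n →L[ℝ] Vec n)
  ξ0 : ℕ → Ω → Ω₀
  ξp : ℕ → Ω → Ω₀
  ξ1 : ℕ → Ω → Ω₁

section Iteration

/-- The direction `d` computed in the state `S` from the matrix `H` and the gradient `g`. -/
noncomputable def stepDir {n m : ℕ} (P : Problem n m) (S : State n) (H : Vec n →L[ℝ] Vec n)
    (g : Vec n) : Vec n :=
  (sqpSolution H (P.jac S.x) g (P.c S.x)).1

/-- The merit parameter computed in the state `S` from the matrix `H` and the gradient `g`. -/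
noncomputable def stepTau {n m : ℕ} (P : Problem n m) (prm : Params n) (S : State n)
    (H : Vec n →L[ℝ] Vec n) (g : Vec n) : ℝ :=
  meritUpdate prm.σ prm.ετ S.τ H g (stepDir P S H g) (P.c S.x)

/-- The trial point `x + α d`. -/
noncomputable def stepTrial {n m : ℕ} (P : Problem n m) (S : State n) (H : Vec n →L[ℝ] Vec n)
    (g : Vec n) : Vec n :=
  S.x + S.α • stepDir P S H g

/-- The modified sufficient decrease condition, where `f0` and `fp` are the estimates of the
objective function at the current point and at the trial point. -/
def SufficientDecrease {n m : ℕ} (P : Problem n m) (prm : Params n) (εf : ℝ) (S : State n)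
    (H : Vec n →L[ℝ] Vec n) (g : Vec n) (f0 fp : ℝ) : Prop :=
  stepTau P prm S H g * fp + l1norm (P.c (stepTrial P S H g)) ≤
    stepTau P prm S H g * f0 + l1norm (P.c S.x)
      - S.α * prm.θ * P.modelReduction S.x (stepTau P prm S H g) g (stepDir P S H g)
      + 2 * stepTau P prm S H g * εf

open scoped Classical in
/-- The state at the beginning of the next iteration. -/
noncomputable def nextState {n m : ℕ} (P : Problem n m) (prm : Params n) (εf : ℝ) (S : State n)
    (H : Vec n →L[ℝ] Vec n) (g : Vec n) (f0 fp : ℝ) : State n :=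
  if SufficientDecrease P prm εf S H g f0 fp then
    { x := stepTrial P S H g, α := min prm.αmax (prm.γ⁻¹ * S.α), τ := stepTau P prm S H g }
  else
    { x := S.x, α := prm.γ * S.α, τ := stepTau P prm S H g }

/-- The gradient estimate requested in the state `S`. -/
def Inputs.grad {n : ℕ} {Ω : Type u} {Ω₀ : Type v} {Ω₁ : Type w} (D : Inputs n Ω Ω₀ Ω₁)
    (S : State n) (H : Vec n →L[ℝ] Vec n) (ξ : Ω₁) : Vec n :=
  D.gbar S.x S.α S.τ H ξ

/-- The gradient estimate with randomness `ξ` in the state `S` is sufficiently accurate. -/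
def Accurate {n m : ℕ} {Ω : Type u} {Ω₀ : Type v} {Ω₁ : Type w} (P : Problem n m)
    (prm : Params n) (D : Inputs n Ω Ω₀ Ω₁) (εg κFO : ℝ) (S : State n)
    (H : Vec n →L[ℝ] Vec n) (ξ : Ω₁) : Prop :=
  ‖D.grad S H ξ - gradient P.f S.x‖ ≤
    max εg (κFO * S.α * √(P.modelReduction S.x (stepTau P prm S H (D.grad S H ξ))
      (D.grad S H ξ) (stepDir P S H (D.grad S H ξ))))

end Iteration

/-! ### The stochastic process -/

section RandomRun

/-- The state at the beginning of iteration `k`: the iterate `xₖ`, the step size `αₖ`, and the merit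
parameter with index `k - 1`. -/
noncomputable def run {n m : ℕ} {Ω : Type u} {Ω₀ : Type v} {Ω₁ : Type w} (P : Problem n m)
    (prm : Params n) (εf : ℝ) (D : Inputs n Ω Ω₀ Ω₁) : ℕ → Ω → State n
  | 0, _ => { x := prm.x0, α := prm.α0, τ := prm.τinit }
  | k + 1, ω =>
    let S := run P prm εf D k ω
    let g := D.grad S (D.H k ω) (D.ξ1 k ω)
    nextState P prm εf S (D.H k ω) g (D.fbar S.x (D.ξ0 k ω))
      (D.fbar (stepTrial P S (D.H k ω) g) (D.ξp k ω))

variable {n m : ℕ} {Ω : Type u} {Ω₀ : Type v} {Ω₁ : Type w}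

/-- The gradient estimate `ḡₖ`. -/
noncomputable def gBar (P : Problem n m) (prm : Params n) (εf : ℝ) (D : Inputs n Ω Ω₀ Ω₁)
    (k : ℕ) (ω : Ω) : Vec n :=
  D.grad (run P prm εf D k ω) (D.H k ω) (D.ξ1 k ω)

/-- The search direction `d̄ₖ`. -/
noncomputable def dBar (P : Problem n m) (prm : Params n) (εf : ℝ) (D : Inputs n Ω Ω₀ Ω₁)
    (k : ℕ) (ω : Ω) : Vec n :=
  stepDir P (run P prm εf D k ω) (D.H k ω) (gBar P prm εf D k ω)

/-- The merit parameter `τ̄ₖ`. -/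
noncomputable def tauBar (P : Problem n m) (prm : Params n) (εf : ℝ) (D : Inputs n Ω Ω₀ Ω₁)
    (k : ℕ) (ω : Ω) : ℝ :=
  stepTau P prm (run P prm εf D k ω) (D.H k ω) (gBar P prm εf D k ω)

/-- The trial iterate `xₖ⁺ = xₖ + αₖ d̄ₖ`. -/
noncomputable def xPlus (P : Problem n m) (prm : Params n) (εf : ℝ) (D : Inputs n Ω Ω₀ Ω₁)
    (k : ℕ) (ω : Ω) : Vec n :=
  stepTrial P (run P prm εf D k ω) (D.H k ω) (gBar P prm εf D k ω)

/-- The error `Eₖ` of the function estimate at `xₖ`. -/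
noncomputable def errCur (P : Problem n m) (prm : Params n) (εf : ℝ) (D : Inputs n Ω Ω₀ Ω₁)
    (k : ℕ) (ω : Ω) : ℝ :=
  |D.fbar (run P prm εf D k ω).x (D.ξ0 k ω) - P.f (run P prm εf D k ω).x|

/-- The error `Eₖ⁺` of the function estimate at `xₖ⁺`. -/
noncomputable def errTrial (P : Problem n m) (prm : Params n) (εf : ℝ) (D : Inputs n Ω Ω₀ Ω₁)
    (k : ℕ) (ω : Ω) : ℝ :=
  |D.fbar (xPlus P prm εf D k ω) (D.ξp k ω) - P.f (xPlus P prm εf D k ω)|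

/-- The solution `(dₖ, yₖ)` of the linear system with the true gradient. -/
noncomputable def trueSolution (P : Problem n m) (prm : Params n) (εf : ℝ)
    (D : Inputs n Ω Ω₀ Ω₁) (k : ℕ) (ω : Ω) : Vec n × Vec m :=
  sqpSolution (D.H k ω) (P.jac (run P prm εf D k ω).x) (gradient P.f (run P prm εf D k ω).x)
    (P.c (run P prm εf D k ω).x)

/-- The deterministic counterpart `τₖ` of the merit parameter, obtained by updating `τ̄ₖ` with the
true gradient. -/
noncomputable def trueTau (P : Problem n m) (prm : Params n) (εf : ℝ) (D : Inputs n Ω Ω₀ Ω₁)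
    (k : ℕ) (ω : Ω) : ℝ :=
  meritUpdate prm.σ prm.ετ (tauBar P prm εf D k ω) (D.H k ω)
    (gradient P.f (run P prm εf D k ω).x) (trueSolution P prm εf D k ω).1
    (P.c (run P prm εf D k ω).x)

/-- The model reduction `Δl(xₖ, τ̄ₖ, ḡₖ, d̄ₖ)`. -/
noncomputable def deltaBar (P : Problem n m) (prm : Params n) (εf : ℝ) (D : Inputs n Ω Ω₀ Ω₁)
    (k : ℕ) (ω : Ω) : ℝ :=
  P.modelReduction (run P prm εf D k ω).x (tauBar P prm εf D k ω) (gBar P prm εf D k ω)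
    (dBar P prm εf D k ω)

/-- The model reduction `Δl(xₖ, τₖ, ∇f(xₖ), dₖ)`. -/
noncomputable def deltaTrue (P : Problem n m) (prm : Params n) (εf : ℝ) (D : Inputs n Ω Ω₀ Ω₁)
    (k : ℕ) (ω : Ω) : ℝ :=
  P.modelReduction (run P prm εf D k ω).x (trueTau P prm εf D k ω)
    (gradient P.f (run P prm εf D k ω).x) (trueSolution P prm εf D k ω).1

/-- The stopping time `min {k : √(Δl(xₖ, τₖ, ∇f(xₖ), dₖ)) ≤ ε}`, equal to `⊤` if there is no such
`k`. -/
noncomputable def stoppingTime (P : Problem n m) (prm : Params n) (εf : ℝ)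
    (D : Inputs n Ω Ω₀ Ω₁) (ε : ℝ) (ω : Ω) : ℕ∞ :=
  ⨅ (k : ℕ) (_ : √(deltaTrue P prm εf D k ω) ≤ ε), (k : ℕ∞)

/-- The measure of progress `Zₖ = φ(xₖ, τ̄ₖ) - φmin - (τ̄ₖ finf - τbmin finf)`. -/
noncomputable def progress (P : Problem n m) (prm : Params n) (εf : ℝ) (D : Inputs n Ω Ω₀ Ω₁)
    (φmin finf τbmin : ℝ) (k : ℕ) (ω : Ω) : ℝ :=
  P.merit (run P prm εf D k ω).x (tauBar P prm εf D k ω) - φmin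
    - (tauBar P prm εf D k ω * finf - τbmin * finf)

end RandomRun

/-! ### Assumptions on the run -/

section Assumptions

variable {n m : ℕ} {Ω : Type u} {Ω₀ : Type v} {Ω₁ : Type w}

/-- Every iterate and every trial iterate lies in `X`. -/
def StaysIn (P : Problem n m) (prm : Params n) (εf : ℝ) (D : Inputs n Ω Ω₀ Ω₁)
    (X : Set (Vec n)) : Prop :=
  ∀ k ω, (run P prm εf D k ω).x ∈ X ∧ xPlus P prm εf D k ω ∈ X

/-- The matrices `Hₖ` are symmetric, bounded by `κH`, and satisfy `uᵀHₖu ≥ ζ ‖u‖²` on the null space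
of `Jₖ`. -/
def HessianBounds (P : Problem n m) (prm : Params n) (εf : ℝ) (D : Inputs n Ω Ω₀ Ω₁)
    (κH ζ : ℝ) : Prop :=
  ∀ k ω, (D.H k ω).toLinearMap.IsSymmetric ∧ ‖D.H k ω‖ ≤ κH ∧
    ∀ z : Vec n, P.jac (run P prm εf D k ω).x z = 0 → ζ * ‖z‖ ^ 2 ≤ ⟪z, D.H k ω z⟫_ℝ

/-- The sampling scheme. The σ-algebra `ℱ k` is the information available at the beginning of
iteration `k`: it contains the randomness of all earlier iterations and the choice of `Hₖ`. The
oracles are called with fresh randomness: `ξ1 k` and `ξ0 k` are independent of `ℱ k`, and `ξp k`,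
which is drawn after the trial point is known, is independent of `ℱ k` and `ξ1 k`. -/
structure Sampling [mΩ : MeasurableSpace Ω] [m₀ : MeasurableSpace Ω₀] [m₁ : MeasurableSpace Ω₁]
    (D : Inputs n Ω Ω₀ Ω₁) (μ : Measure Ω) (P₀ : Measure Ω₀) (P₁ : Measure Ω₁)
    (ℱ : Filtration ℕ mΩ) : Prop where
  fbar_measurable : Measurable fun q : Vec n × Ω₀ => D.fbar q.1 q.2
  gbar_measurable : Measurable fun q : Vec n × ℝ × ℝ × (Vec n →L[ℝ] Vec n) × Ω₁ =>
    D.gbar q.1 q.2.1 q.2.2.1 q.2.2.2.1 q.2.2.2.2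
  H_measurable : ∀ k, Measurable[ℱ k] (D.H k)
  ξ0_measurable : ∀ k, Measurable[ℱ (k + 1)] (D.ξ0 k)
  ξp_measurable : ∀ k, Measurable[ℱ (k + 1)] (D.ξp k)
  ξ1_measurable : ∀ k, Measurable[ℱ (k + 1)] (D.ξ1 k)
  ξ0_law : ∀ k, μ.map (D.ξ0 k) = P₀
  ξp_law : ∀ k, μ.map (D.ξp k) = P₀
  ξ1_law : ∀ k, μ.map (D.ξ1 k) = P₁
  ξ1_indep : ∀ k, Indep (MeasurableSpace.comap (D.ξ1 k) m₁) (ℱ k) μ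
  ξ0_indep : ∀ k, Indep (MeasurableSpace.comap (D.ξ0 k) m₀) (ℱ k) μ
  ξp_indep : ∀ k, Indep (MeasurableSpace.comap (D.ξp k) m₀)
    (ℱ k ⊔ MeasurableSpace.comap (D.ξ1 k) m₁) μ

/-- The mean error `E[e(x; Ξ⁰(x))]` of the zeroth-order oracle at `x`. -/
noncomputable def meanErr [MeasurableSpace Ω₀] (P : Problem n m) (D : Inputs n Ω Ω₀ Ω₁)
    (P₀ : Measure Ω₀) (x : Vec n) : ℝ :=
  ∫ ξ, |D.fbar x ξ - P.f x| ∂P₀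

/-- The probabilistic zeroth-order oracle: at every `x ∈ X` the error is one-sided sub-exponential
with parameters `(ν, b)` and has mean at most `εf`. The condition `lam * b ≤ 1` says that
`lam ≤ 1 / b`, where `1 / 0 = ∞`. -/
structure ZerothOracle [MeasurableSpace Ω₀] (P : Problem n m) (D : Inputs n Ω Ω₀ Ω₁)
    (P₀ : Measure Ω₀) (X : Set (Vec n)) (εf ν b : ℝ) : Prop where
  εf_nonneg : 0 ≤ εf
  ν_nonneg : 0 ≤ ν
  b_nonneg : 0 ≤ b
  integrable : ∀ x ∈ X, Integrable (fun ξ => |D.fbar x ξ - P.f x|) P₀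
  mean_le : ∀ x ∈ X, meanErr P D P₀ x ≤ εf
  exp_integrable : ∀ x ∈ X, ∀ lam : ℝ, 0 ≤ lam → lam * b ≤ 1 →
    Integrable (fun ξ => Real.exp (lam * (|D.fbar x ξ - P.f x| - meanErr P D P₀ x))) P₀
  exp_le : ∀ x ∈ X, ∀ lam : ℝ, 0 ≤ lam → lam * b ≤ 1 →
    ∫ ξ, Real.exp (lam * (|D.fbar x ξ - P.f x| - meanErr P D P₀ x)) ∂P₀ ≤
      Real.exp (lam ^ 2 * ν ^ 2 / 2)

/-- The probabilistic first-order oracle: at the states in which it is called, the estimate is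
sufficiently accurate with probability at least `1 - δ` over its own randomness. -/
structure FirstOrderOracle [MeasurableSpace Ω] [MeasurableSpace Ω₁] (P : Problem n m)
    (prm : Params n) (εf : ℝ) (D : Inputs n Ω Ω₀ Ω₁) (μ : Measure Ω) (P₁ : Measure Ω₁)
    (εg κFO δ : ℝ) : Prop where
  εg_nonneg : 0 ≤ εg
  κFO_nonneg : 0 ≤ κFO
  δ_nonneg : 0 ≤ δ
  δ_lt : δ < 1 / 2
  accurate : ∀ k, ∀ᵐ ω ∂μ,
    1 - δ ≤ P₁.real {ξ | Accurate P prm D εg κFO (run P prm εf D k ω) (D.H k ω) ξ}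

/-- Both function estimates of every iteration have errors at most `εf`. -/
def BoundedNoise [MeasurableSpace Ω] (P : Problem n m) (prm : Params n) (εf : ℝ)
    (D : Inputs n Ω Ω₀ Ω₁) (μ : Measure Ω) : Prop :=
  ∀ k, ∀ᵐ ω ∂μ, errCur P prm εf D k ω ≤ εf ∧ errTrial P prm εf D k ω ≤ εf

/-- The total errors `Eₖ + Eₖ⁺` are independent over the iterations. -/
def IndependentNoise [MeasurableSpace Ω] (P : Problem n m) (prm : Params n) (εf : ℝ)
    (D : Inputs n Ω Ω₀ Ω₁) (μ : Measure Ω) : Prop :=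
  iIndepFun (fun k ω => errCur P prm εf D k ω + errTrial P prm εf D k ω) μ

end Assumptions

/-! ### Tail bounds and constants -/

/-- `exp (-x)` for `x ∈ [0, ∞]`. -/
noncomputable def expNeg (x : ℝ≥0∞) : ℝ :=
  if x = ∞ then 0 else Real.exp (-x.toReal)

/-- `exp (-min {r² N / (2 ν²), r N / (2 b)})`, where a quotient with denominator `0` is `∞` if its
numerator is positive and `0` if its numerator is `0`. -/
noncomputable def subexpTail (r N ν b : ℝ) : ℝ :=
  expNeg (min (ENNReal.ofReal (r ^ 2 * N) / ENNReal.ofReal (2 * ν ^ 2))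
    (ENNReal.ofReal (r * N) / ENNReal.ofReal (2 * b)))

/-- `u = inf_{x ∈ X} (εf - E[E(x)])`. -/
noncomputable def noiseGap {n m : ℕ} {Ω : Type u} {Ω₀ : Type v} {Ω₁ : Type w}
    [MeasurableSpace Ω₀] (P : Problem n m) (D : Inputs n Ω Ω₀ Ω₁) (P₀ : Measure Ω₀)
    (X : Set (Vec n)) (εf : ℝ) : ℝ :=
  ⨅ x : X, (εf - meanErr P D P₀ x)

/-- The scalars on which the constants of the complexity bound depend. Here `τi` is the initial
merit parameter, `τbm` the lower bound of the stochastic merit parameters, `τm` that of the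
deterministic ones, and `Γ` the sum of the Lipschitz constants of the constraint gradients. -/
structure Consts where
  κH : ℝ
  ζ : ℝ
  κy : ℝ
  κl : ℝ
  τm : ℝ
  τbm : ℝ
  τi : ℝ
  αmax : ℝ
  θ : ℝ
  σ : ℝ
  ετ : ℝ
  L : ℝ
  Γ : ℝ
  κFO : ℝ

namespace Consts

noncomputable def ω2 (C : Consts) : ℝ := (max C.κH C.κy + 1) / C.κl

noncomputable def ω3 (C : Consts) : ℝ :=
  (1 + C.κH / C.ζ) * C.κFO * √C.τi * C.αmax / √C.κl + C.τi * C.κFO ^ 2 * C.αmax ^ 2 / C.ζ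

noncomputable def ω4 (C : Consts) : ℝ :=
  max
    (C.ετ * (max C.κH C.κy / C.κl + √C.τi * (1 + C.κH / C.ζ) * C.κFO * C.αmax / √C.κl + C.ω3))
    (C.τi / ((1 - C.σ) * C.τm) *
      ((1 + 3 * C.κH / C.ζ) * C.κFO * √C.τi * C.αmax / √C.κl
        + (1 + C.κH / C.ζ) * (C.τi * C.κFO ^ 2 * C.αmax ^ 2 / C.ζ)))

noncomputable def ω5 (C : Consts) (η : ℝ) : ℝ :=
  (1 + C.ετ) * C.τi * (η / C.ζ + (1 + C.κH / C.ζ) / √(C.κl * C.τm))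
    + C.ετ * C.τi * (1 + C.κH / C.ζ) ^ 2 * η / 4

noncomputable def ω6 (C : Consts) (η : ℝ) : ℝ :=
  C.τi ^ 2 * ((1 + C.κH / C.ζ) * (η / C.ζ) + (1 + 3 * C.κH / C.ζ) / √(C.κl * C.τm))
      / ((1 - C.σ) * C.τm)
    + C.τi * (η / C.ζ + (1 + C.κH / C.ζ) / √(C.κl * C.τm))

noncomputable def ω7 (C : Consts) (η p : ℝ) : ℝ :=
  √(4 * C.τi / ((p - 1 / 2) * C.θ) *
    max (max ((1 + C.ετ * C.ω2) / (1 - η * C.ω5 η)) (1 / (1 - η * C.ω6 η))) (1 + C.ω3 + C.ω4))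

noncomputable def ω8 (C : Consts) (η : ℝ) : ℝ :=
  √(max
    ((√(C.τi / C.κl) * C.κFO + C.L / (2 * C.κl) + C.Γ / (2 * C.τbm * C.κl)) / (1 - C.θ))
    ((C.τbm * C.L + C.Γ) /
      (2 * C.τbm * C.κl * (1 - C.θ - η * √(C.τi / C.κl) *
        max √((1 + C.ετ * C.ω2) / (1 - η * C.ω5 η)) (1 / √(1 - η * C.ω6 η))))))

noncomputable def η1 (C : Consts) : ℝ :=
  (1 - C.θ) * (1 + C.ετ) * C.τi * (1 + C.κH / C.ζ) / √(C.κl * C.τm)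

noncomputable def η2 (C : Consts) : ℝ :=
  √((1 - C.θ) ^ 2 * C.τi * (1 + C.κH / C.ζ) ^ 2 *
      ((1 + C.ετ) ^ 2 * C.τi / (C.κl * C.τm) + C.ετ)
    + 4 * C.τi * ((1 + C.ετ * C.ω2) / C.κl + (1 - C.θ) ^ 2 * (1 + C.ετ) / C.ζ))

noncomputable def η3 (C : Consts) : ℝ :=
  (1 - C.θ) * C.τi *
      (C.τi * (1 + 3 * C.κH / C.ζ) + (1 - C.σ) * C.τm * (1 + C.κH / C.ζ))
    / ((1 - C.σ) * C.τm * √(C.κl * C.τm))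

noncomputable def η4 (C : Consts) : ℝ :=
  √((1 - C.θ) ^ 2 * C.τi ^ 2 *
        (C.τi * (1 + 3 * C.κH / C.ζ) + (1 - C.σ) * C.τm * (1 + C.κH / C.ζ)) ^ 2
      / ((1 - C.σ) ^ 2 * C.τm ^ 3 * C.κl)
    + 4 * C.τi / C.κl
    + 4 * (1 - C.θ) ^ 2 *
      (C.τi ^ 2 * (1 + C.κH / C.ζ) / ((1 - C.σ) * C.τm * C.ζ) + C.τi / C.ζ))

/-- The admissible range of `η`. -/
def EtaAdmissible (C : Consts) (η : ℝ) : Prop :=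
  0 < η ∧ η < 2 * (1 - C.θ) * min (1 / (C.η1 + C.η2)) (1 / (C.η3 + C.η4))

/-- The large step threshold `α̃`. -/
noncomputable def αTilde (C : Consts) (η : ℝ) : ℝ :=
  min
    ((1 - C.θ) / (√(C.τi / C.κl) * C.κFO + C.L / (2 * C.κl) + C.Γ / (2 * C.τbm * C.κl)))
    (2 * C.τbm * C.κl * (1 - C.θ - η * √(C.τi / C.κl) *
        max √((1 + C.ετ * C.ω2) / (1 - η * C.ω5 η)) (1 / √(1 - η * C.ω6 η)))
      / (C.τbm * C.L + C.Γ))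

/-- The progress function `h`, where `ε` is the target accuracy. -/
noncomputable def h (C : Consts) (η ε α : ℝ) : ℝ :=
  α * C.θ * ε ^ 2 *
    min (min ((1 - η * C.ω5 η) / (1 + C.ετ * C.ω2)) (1 - η * C.ω6 η)) (1 / (1 + C.ω3 + C.ω4))

/-- `R = Z₀ / h(α̃) + max {(ln α̃ - ln α₀) / (2 ln γ), 0}`. -/
noncomputable def R (C : Consts) (η ε α0 γ Z0 : ℝ) : ℝ :=
  Z0 / C.h η ε (C.αTilde η)
    + max ((Real.log (C.αTilde η) - Real.log α0) / (2 * Real.log γ)) 0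

end Consts

end SSSQP

/-!
The bound follows from a deterministic analysis of single realizations combined with two
exponential tail bounds.

*Deterministic part.* Testing the linear system against vectors in the null space of the Jacobian
shows that the search direction is a Lipschitz function of the gradient, and that the curvature of
`H` along any linearly feasible direction is positive up to a multiple of `‖c‖`
(`LocalBounds.curvature`). The first fact bounds the difference of the deterministic and the
stochastic model reduction by the gradient error; a distinction of the three possible values of the
updated merit parameter then shows that, as long as the accuracy `ε` is not reached, an accurate
gradient estimate makes the stochastic model reduction at least a fixed multiple of `ε²`
(`RunBounds.reduction_of_accurate`). The admissible range of `η` is exactly what keeps the constants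
in this comparison positive; this is a computation with the roots of two quadratic polynomials
(`Consts.quadratic_lt_of_lt_root`). With the quadratic upper bounds of `f` and of the constraints, a
true iteration (accurate gradient, total noise at most `2 εf`) with a small step is therefore
successful, and a successful one with a large step decreases the measure of progress by at least
`h(α̃)` up to noise.

*Counting.* Since the step size moves up after a success and down after a failure, at least half of
the excess of true iterations over the others must be true and successful iterations with steps of
size at least `α̃` (`sum_ind_true_le`). The threshold `α̃` need not be among the values
`γⁱ α₀` of the step size. To make up for this, `κl` is chosen so small that the inequality for the
stochastic model reduction holds with `κl / γ⁴` in place of `κl`, which makes true iterations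
successful even for step sizes up to `α̃ / γ²`, and so small that `α̃ ≤ γ α₀`, which is possible
because `L + Γ > 0`. The total decrease is bounded by `Z₀` plus the accumulated noise, and hence the
accuracy `ε` is reached within `t` iterations if more than `phat t` of them are true and the noise
is small (`RunBounds.stoppingTime_le`).

*Probabilistic part.* Fresh randomness can be integrated out with everything known before kept fixed
(`lintegral_fresh`), so that every iteration is true with conditional probability at least `p`
(`Sampling.lintegral_not_true_le`), and the total error of an iteration is conditionally
sub-exponential with parameters `(2ν, 2b)`, whether or not its two errors are dependent
(`Sampling.lintegral_errSum_le`). The tail bounds are then obtained from exponential moments, by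
`measure_count_lt_le` for the number of true iterations and by `measure_sum_ge_le_subexpTail` for
the accumulated noise.
-/

namespace SSSQP

/-! ### Vectors and the merit parameter update -/

theorem l1norm_nonneg {m : ℕ} (v : Vec m) : 0 ≤ l1norm v :=
  Finset.sum_nonneg fun _ _ => abs_nonneg _

theorem norm_le_l1norm {m : ℕ} (v : Vec m) : ‖v‖ ≤ l1norm v := by
  rw [EuclideanSpace.norm_eq]
  refine Real.sqrt_le_iff.2 ⟨l1norm_nonneg v, ?_⟩
  simp only [Real.norm_eq_abs]
  exact Finset.sum_sq_le_sq_sum_of_nonneg fun i _ => abs_nonneg _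

section MeritUpdate

variable {n m : ℕ} {σ ετ τ : ℝ} {H : Vec n →L[ℝ] Vec n} {g d : Vec n} {c : Vec m}

/-- The quantity `q = gᵀd + max {dᵀHd, 0}` that governs the merit parameter update. -/
noncomputable def curvedSlope {n : ℕ} (H : Vec n →L[ℝ] Vec n) (g d : Vec n) : ℝ :=
  ⟪g, d⟫_ℝ + max ⟪d, H d⟫_ℝ 0

theorem meritUpdate_cases :
    meritUpdate σ ετ τ H g d c = τ ∨ meritUpdate σ ετ τ H g d c = (1 - ετ) * τ ∨
      (0 < curvedSlope H g d ∧ meritUpdate σ ετ τ H g d c < τ ∧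
        meritUpdate σ ετ τ H g d c * curvedSlope H g d = (1 - σ) * l1norm c) := by
  rw [meritUpdate]
  split_ifs with h
  · exact Or.inl rfl
  · change ¬ (curvedSlope H g d ≤ 0 ∨ τ ≤ (1 - σ) * l1norm c / curvedSlope H g d) at h
    push Not at h
    obtain ⟨hq, ht⟩ := h
    right
    rcases le_total ((1 - ετ) * τ) ((1 - σ) * l1norm c / curvedSlope H g d) with h1 | h1
    · left; exact min_eq_left h1
    · right
      refine ⟨hq, ?_, ?_⟩
      · exact (min_le_right _ _).trans_lt ht
      · rw [show min ((1 - ετ) * τ) ((1 - σ) * l1norm c / (⟪g, d⟫_ℝ + max ⟪d, H d⟫_ℝ 0)) =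
          (1 - σ) * l1norm c / curvedSlope H g d from min_eq_right h1]
        exact div_mul_cancel₀ _ hq.ne'

theorem meritUpdate_le (hετ : ετ ∈ Set.Ioo (0 : ℝ) 1) (hτ : 0 < τ) :
    meritUpdate σ ετ τ H g d c ≤ τ := by
  rcases meritUpdate_cases (σ := σ) (ετ := ετ) (τ := τ) (H := H) (g := g) (d := d) (c := c)
    with h | h | h
  · exact h.le
  · rw [h]; nlinarith [hετ.1]
  · exact h.2.1.le

/-- The updated merit parameter satisfies the condition for which the update is designed. -/
theorem meritUpdate_mul_curvedSlope_le (hσ : σ ∈ Set.Ioo (0 : ℝ) 1) (hτ : 0 < τ) :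
    meritUpdate σ ετ τ H g d c * curvedSlope H g d ≤ (1 - σ) * l1norm c := by
  have hc : 0 ≤ (1 - σ) * l1norm c := mul_nonneg (by linarith [hσ.2]) (l1norm_nonneg c)
  rw [meritUpdate]
  split_ifs with h
  · change curvedSlope H g d ≤ 0 ∨ τ ≤ (1 - σ) * l1norm c / curvedSlope H g d at h
    by_cases hq : curvedSlope H g d ≤ 0
    · nlinarith
    · push Not at hq
      rcases h with h | h
      · linarith
      · exact (le_div_iff₀ hq).1 h
  · change ¬ (curvedSlope H g d ≤ 0 ∨ τ ≤ (1 - σ) * l1norm c / curvedSlope H g d) at h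
    push Not at h
    exact (le_div_iff₀ h.1).1 (min_le_right _ _)

theorem le_meritUpdate (hετ : ετ ∈ Set.Ioo (0 : ℝ) 1) (hσ : σ ∈ Set.Ioo (0 : ℝ) 1)
    (hτ : 0 < τ) {K : ℝ} (hK : 0 < K) (hq : curvedSlope H g d ≤ K * l1norm c) :
    min ((1 - ετ) * τ) ((1 - σ) / K) ≤ meritUpdate σ ετ τ H g d c := by
  have hσ' : 0 < 1 - σ := by linarith [hσ.2]
  rcases meritUpdate_cases (σ := σ) (ετ := ετ) (τ := τ) (H := H) (g := g) (d := d) (c := c)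
    with h | h | ⟨h0, h1, h2⟩
  · rw [h]; refine (min_le_left _ _).trans ?_; nlinarith [hετ.1]
  · rw [h]; exact min_le_left _ _
  · refine (min_le_right _ _).trans ?_
    rw [div_le_iff₀ hK]
    have hc : 0 < l1norm c := by
      by_contra hc
      have : l1norm c = 0 := le_antisymm (not_lt.1 hc) (l1norm_nonneg c)
      rw [this] at hq
      linarith
    have hT : 0 < meritUpdate σ ετ τ H g d c := by
      by_contra hT
      have : 0 < (1 - σ) * l1norm c := mul_pos hσ' hc
      nlinarith
    have h3 : (1 - σ) * l1norm c ≤ meritUpdate σ ετ τ H g d c * K * l1norm c := by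
      rw [← h2]; nlinarith
    exact le_of_mul_le_mul_right h3 hc

end MeritUpdate

/-! ### Bounds on the search direction -/

section Linear

variable {n m : ℕ}

/-- If `Jᵀ` is bounded below by `κ`, then every vector splits orthogonally into a part in the null
space of `J` and a part of length at most `‖J d‖ / κ`. -/
theorem exists_tangential_normal_split (J : Vec n →L[ℝ] Vec m) {κ : ℝ} (hκ : 0 < κ)
    (hJ : ∀ y, κ * ‖y‖ ≤ ‖ContinuousLinearMap.adjoint J y‖) (d : Vec n) :
    ∃ u v : Vec n, d = u + v ∧ J u = 0 ∧ ‖d‖ ^ 2 = ‖u‖ ^ 2 + ‖v‖ ^ 2 ∧ κ * ‖v‖ ≤ ‖J d‖ := by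
  set K : Submodule ℝ (Vec n) := J.toLinearMap.ker
  refine ⟨K.starProjection d, Kᗮ.starProjection d, ?_, ?_, ?_, ?_⟩
  · exact (K.starProjection_add_starProjection_orthogonal d).symm
  · exact K.starProjection_apply_mem d
  · exact K.norm_sq_eq_add_norm_sq_starProjection d
  · have hd : J d = J (Kᗮ.starProjection d) := by
      conv_lhs => rw [← K.starProjection_add_starProjection_orthogonal d]
      rw [map_add, show J (K.starProjection d) = 0 from K.starProjection_apply_mem d, zero_add]
    rw [hd]
    have hmem : Kᗮ.starProjection d ∈ Kᗮ := Kᗮ.starProjection_apply_mem d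
    generalize Kᗮ.starProjection d = v at hmem
    rw [LinearMap.orthogonal_ker] at hmem
    obtain ⟨z, hz⟩ := hmem
    have hz' : ContinuousLinearMap.adjoint J z = v := hz
    by_cases hv : ‖v‖ = 0
    · rw [hv, mul_zero]; positivity
    have hv' : 0 < ‖v‖ := lt_of_le_of_ne (norm_nonneg _) (Ne.symm hv)
    have h1 : ‖v‖ ^ 2 = ⟪z, J v⟫_ℝ := by
      rw [← real_inner_self_eq_norm_sq]
      nth_rewrite 1 [← hz']
      rw [ContinuousLinearMap.adjoint_inner_left]
    have h2 : ⟪z, J v⟫_ℝ ≤ ‖z‖ * ‖J v‖ := real_inner_le_norm _ _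
    have h3 : κ * ‖z‖ ≤ ‖v‖ := hz' ▸ hJ z
    have h4 : ‖v‖ * (κ * ‖v‖) ≤ ‖v‖ * ‖J v‖ := by
      calc ‖v‖ * (κ * ‖v‖) = κ * ‖v‖ ^ 2 := by ring
        _ ≤ κ * (‖z‖ * ‖J v‖) := by rw [h1]; gcongr
        _ = κ * ‖z‖ * ‖J v‖ := by ring
        _ ≤ ‖v‖ * ‖J v‖ := by gcongr
    exact le_of_mul_le_mul_left h4 hv'

theorem abs_inner_apply_le (H : Vec n →L[ℝ] Vec n) {κH : ℝ} (hH : ‖H‖ ≤ κH) (a b : Vec n) :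
    |⟪a, H b⟫_ℝ| ≤ κH * (‖a‖ * ‖b‖) := by
  calc |⟪a, H b⟫_ℝ| ≤ ‖a‖ * ‖H b‖ := abs_real_inner_le_norm _ _
    _ ≤ ‖a‖ * (κH * ‖b‖) := by gcongr; exact H.le_of_opNorm_le hH b
    _ = κH * (‖a‖ * ‖b‖) := by ring

/-- The conditions on the matrix `H` and the Jacobian `J` at an iterate. -/
structure LocalBounds (H : Vec n →L[ℝ] Vec n) (J : Vec n →L[ℝ] Vec m) (κH ζ κ : ℝ) : Prop where
  symm : ∀ a b, ⟪H a, b⟫_ℝ = ⟪a, H b⟫_ℝ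
  norm_le : ‖H‖ ≤ κH
  pos : ∀ z, J z = 0 → ζ * ‖z‖ ^ 2 ≤ ⟪z, H z⟫_ℝ
  adj : ∀ y, κ * ‖y‖ ≤ ‖ContinuousLinearMap.adjoint J y‖

variable {H : Vec n →L[ℝ] Vec n} {J : Vec n →L[ℝ] Vec m} {κH ζ κ : ℝ}

/-- The curvature of `H` along `d` is at least `ζ ‖d‖² / 2` up to a multiple of `‖J d‖`, as long as
`‖J d‖` stays bounded by `Kc`. -/
theorem LocalBounds.curvature (h : LocalBounds H J κH ζ κ) (hκH : 0 < κH) (hζ : 0 < ζ)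
    (hκ : 0 < κ) {Kc : ℝ} (d : Vec n) (hd : ‖J d‖ ≤ Kc) :
    ζ / 2 * ‖d‖ ^ 2 - (ζ / 2 + κH + 2 * κH ^ 2 / ζ) * (Kc / κ ^ 2) * ‖J d‖ ≤ ⟪d, H d⟫_ℝ := by
  obtain ⟨u, v, hduv, hu, hn, hv⟩ := exists_tangential_normal_split J hκ h.adj d
  have h1 : ⟪d, H d⟫_ℝ = ⟪u, H u⟫_ℝ + 2 * ⟪u, H v⟫_ℝ + ⟪v, H v⟫_ℝ := by
    rw [hduv, map_add, inner_add_left, inner_add_right, inner_add_right,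
      show ⟪v, H u⟫_ℝ = ⟪u, H v⟫_ℝ by rw [← h.symm, real_inner_comm]]
    ring
  have h2 := h.pos u hu
  have h3 := (abs_le.1 (abs_inner_apply_le H h.norm_le u v)).1
  have h4 := (abs_le.1 (abs_inner_apply_le H h.norm_le v v)).1
  have h5 : 2 * (κH * (‖u‖ * ‖v‖)) ≤ ζ / 2 * ‖u‖ ^ 2 + 2 * κH ^ 2 / ζ * ‖v‖ ^ 2 := by
    have : ζ / 2 * ‖u‖ ^ 2 + 2 * κH ^ 2 / ζ * ‖v‖ ^ 2 - 2 * (κH * (‖u‖ * ‖v‖))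
        = (ζ * ‖u‖ - 2 * κH * ‖v‖) ^ 2 / (2 * ζ) := by field_simp; ring
    have : 0 ≤ (ζ * ‖u‖ - 2 * κH * ‖v‖) ^ 2 / (2 * ζ) := by positivity
    linarith
  have h6 : ‖v‖ ^ 2 ≤ Kc / κ ^ 2 * ‖J d‖ := by
    rw [div_mul_eq_mul_div, le_div_iff₀ (by positivity)]
    calc ‖v‖ ^ 2 * κ ^ 2 = (κ * ‖v‖) ^ 2 := by ring
      _ ≤ ‖J d‖ ^ 2 := by gcongr
      _ ≤ Kc * ‖J d‖ := by rw [sq]; gcongr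
  have h7 : (ζ / 2 + κH + 2 * κH ^ 2 / ζ) * ‖v‖ ^ 2 ≤
      (ζ / 2 + κH + 2 * κH ^ 2 / ζ) * (Kc / κ ^ 2 * ‖J d‖) := by gcongr
  rw [h1, hn]
  nlinarith

end Linear

section Linear

variable {n m : ℕ} {H : Vec n →L[ℝ] Vec n} {J : Vec n →L[ℝ] Vec m} {κH ζ κ : ℝ}
  {g d g' d' : Vec n} {c y y' : Vec m}

/-- `(d, y)` solves the linear system `H d + Jᵀ y = -g`, `J d = -c`. -/
structure IsSQPStep (H : Vec n →L[ℝ] Vec n) (J : Vec n →L[ℝ] Vec m) (g : Vec n) (c : Vec m)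
    (d : Vec n) (y : Vec m) : Prop where
  stat : H d + ContinuousLinearMap.adjoint J y = -g
  feas : J d = -c

theorem LocalBounds.isSQPStep (h : LocalBounds H J κH ζ κ) (hζ : 0 < ζ) (hκ : 0 < κ) (g : Vec n)
    (c : Vec m) :
    IsSQPStep H J g c (sqpSolution H J g c).1 (sqpSolution H J g c).2 := by
  have h1 := kkt_sqpSolution H J
    (fun z hz hne => lt_of_lt_of_le (by positivity) (h.pos z hz))
    (fun y hy => by
      have h2 := h.adj y
      rw [hy, norm_zero] at h2
      by_contra hne
      have : 0 < κ * ‖y‖ := by positivity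
      linarith) g c
  have h2 := Prod.ext_iff.1 h1
  exact ⟨by simpa [kkt] using h2.1, by simpa [kkt] using h2.2⟩

/-- The identity obtained by testing the first block of the linear system against `z`. -/
theorem IsSQPStep.inner_eq (hs : IsSQPStep H J g c d y) (z : Vec n) :
    ⟪g, z⟫_ℝ = -⟪H d, z⟫_ℝ - ⟪y, J z⟫_ℝ := by
  have : g = -(H d + ContinuousLinearMap.adjoint J y) := by rw [hs.stat, neg_neg]
  rw [this, inner_neg_left, inner_add_left, ContinuousLinearMap.adjoint_inner_left]
  ring

theorem IsSQPStep.inner_self_eq (hs : IsSQPStep H J g c d y) :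
    ⟪g, d⟫_ℝ = -⟪H d, d⟫_ℝ + ⟪y, c⟫_ℝ := by
  rw [hs.inner_eq, hs.feas, inner_neg_right]; ring

theorem IsSQPStep.norm_feas (hs : IsSQPStep H J g c d y) : ‖J d‖ = ‖c‖ := by
  rw [hs.feas, norm_neg]

/-- The direction, the multiplier, and the ratio `q / ‖c‖` are bounded when the gradient and the
constraint values are. -/
theorem LocalBounds.exists_bounds (hκH : 0 < κH) (hζ : 0 < ζ)
    (hκ : 0 < κ) {Kc Kg : ℝ} (hKc : 0 ≤ Kc) (hKg : 0 ≤ Kg) :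
    ∃ κy Kq : ℝ, 0 < κy ∧ 0 < Kq ∧
      ∀ (H : Vec n →L[ℝ] Vec n) (J : Vec n →L[ℝ] Vec m) (g d : Vec n) (c y : Vec m),
        LocalBounds H J κH ζ κ → IsSQPStep H J g c d y → ‖g‖ ≤ Kg → ‖c‖ ≤ Kc →
        ‖y‖ ≤ κy ∧ curvedSlope H g d ≤ Kq * l1norm c := by
  set B : ℝ := (ζ / 2 + κH + 2 * κH ^ 2 / ζ) * (Kc / κ ^ 2) with hB
  have hB0 : 0 ≤ B := by positivity
  set a : ℝ := Kg + κH * Kc / κ with ha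
  set b : ℝ := B * Kc + Kg * Kc / κ with hb
  have ha0 : 0 ≤ a := by positivity
  have hb0 : 0 ≤ b := by positivity
  set Kd : ℝ := 1 + 2 * (a + b) / ζ with hKd
  have hKd0 : 0 < Kd := by positivity
  refine ⟨(Kg + κH * Kd) / κ, (Kg + κH * Kd) / κ + B, by positivity, by positivity, ?_⟩
  intro H J g d c y h hs hg hc
  have hcurv := h.curvature hκH hζ hκ (Kc := Kc) d (by rw [hs.norm_feas]; exact hc)
  rw [← hB, hs.norm_feas] at hcurv
  have hHd : ‖H d‖ ≤ κH * ‖d‖ := H.le_of_opNorm_le h.norm_le d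
  have hy : ‖y‖ ≤ (Kg + κH * ‖d‖) / κ := by
    rw [le_div_iff₀ hκ, mul_comm]
    refine (h.adj y).trans ?_
    have : ContinuousLinearMap.adjoint J y = -g - H d := by rw [← hs.stat]; abel
    rw [this]
    refine (norm_sub_le _ _).trans ?_
    rw [norm_neg]
    exact add_le_add hg hHd
  have hyc : ⟪y, c⟫_ℝ ≤ ‖y‖ * ‖c‖ := real_inner_le_norm _ _
  have hgd := hs.inner_self_eq
  rw [real_inner_comm d (H d)] at hgd
  have hd : ‖d‖ ≤ Kd := by
    have h1 : -⟪g, d⟫_ℝ ≤ Kg * ‖d‖ :=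
      (neg_le_abs _).trans ((abs_real_inner_le_norm _ _).trans (by gcongr))
    have h2 : ‖y‖ * ‖c‖ ≤ (Kg + κH * ‖d‖) / κ * Kc := by gcongr
    have h3 : ζ / 2 * ‖d‖ ^ 2 ≤ a * ‖d‖ + b := by
      have e : (Kg + κH * ‖d‖) / κ * Kc = Kg * Kc / κ + κH * Kc / κ * ‖d‖ := by
        field_simp
      have : B * ‖c‖ ≤ B * Kc := by gcongr
      rw [ha, hb]
      nlinarith
    by_contra hlt
    push Not at hlt
    have hd1 : 1 < ‖d‖ := by
      have : 0 ≤ 2 * (a + b) / ζ := by positivity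
      linarith
    have h4 : ζ / 2 * ‖d‖ ^ 2 ≤ (a + b) * ‖d‖ := by nlinarith
    have h5 : ζ / 2 * ‖d‖ ≤ a + b := by
      refine le_of_mul_le_mul_right ?_ (lt_trans one_pos hd1)
      calc ζ / 2 * ‖d‖ * ‖d‖ = ζ / 2 * ‖d‖ ^ 2 := by ring
        _ ≤ _ := h4
    have h6 : ‖d‖ ≤ 2 * (a + b) / ζ := by
      rw [le_div_iff₀ hζ]; linarith
    linarith
  have hy' : ‖y‖ ≤ (Kg + κH * Kd) / κ := hy.trans (by gcongr)
  refine ⟨hy', ?_⟩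
  have h7 : ‖y‖ * ‖c‖ ≤ (Kg + κH * Kd) / κ * l1norm c := by
    gcongr; exact norm_le_l1norm c
  have h8 : B * ‖c‖ ≤ B * l1norm c := by gcongr; exact norm_le_l1norm c
  have h9 : 0 ≤ ζ / 2 * ‖d‖ ^ 2 := by positivity
  have h10 : 0 ≤ B * l1norm c := mul_nonneg hB0 (l1norm_nonneg c)
  rw [curvedSlope, add_mul]
  rcases max_cases ⟪d, H d⟫_ℝ 0 with ⟨h, _⟩ | ⟨h, _⟩ <;> rw [h] <;> linarith

/-- If the merit parameter `T` satisfies the condition enforced by the update, then the model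
reduction dominates `T (‖d‖² + ‖c‖)`. -/
theorem LocalBounds.exists_reduction_bound (hκH : 0 < κH) (hζ : 0 < ζ) (hκ : 0 < κ) {Kc τi σ : ℝ}
    (hKc : 0 ≤ Kc) (hτi : 0 < τi) (hσ : σ ∈ Set.Ioo (0 : ℝ) 1) :
    ∃ κs : ℝ, 0 < κs ∧
      ∀ (H : Vec n →L[ℝ] Vec n) (J : Vec n →L[ℝ] Vec m) (g d : Vec n) (c : Vec m) (T : ℝ),
        LocalBounds H J κH ζ κ → J d = -c → ‖c‖ ≤ Kc → 0 < T → T ≤ τi →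
        T * curvedSlope H g d ≤ (1 - σ) * l1norm c →
        κs * T * (‖d‖ ^ 2 + ‖c‖) ≤ -T * ⟪g, d⟫_ℝ + l1norm c := by
  set B : ℝ := (ζ / 2 + κH + 2 * κH ^ 2 / ζ) * (Kc / κ ^ 2) with hB
  have hB0 : 0 ≤ B := by positivity
  have hσ0 := hσ.1
  -- the part of `max {dᵀHd, 0}` that is kept, so that `‖c‖₁` absorbs the loss of curvature
  set r : ℝ := min 1 (σ / (2 * τi * (B + 1))) with hr
  have hr0 : 0 < r := lt_min one_pos (by positivity)
  have hr1 : r ≤ 1 := min_le_left _ _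
  have hrB : τi * (r * B) ≤ σ / 2 := by
    have h1 : r ≤ σ / (2 * τi * (B + 1)) := min_le_right _ _
    calc τi * (r * B) ≤ τi * (σ / (2 * τi * (B + 1)) * (B + 1)) := by
          gcongr; linarith
      _ = σ / 2 := by field_simp
  refine ⟨min (r * (ζ / 2)) (σ / (2 * τi)), lt_min (by positivity) (by positivity), ?_⟩
  intro H J g d c T h hd hc hT hTi hq
  have hJd : ‖J d‖ = ‖c‖ := by rw [hd, norm_neg]
  have hcurv := h.curvature hκH hζ hκ (Kc := Kc) d (by rw [hJd]; exact hc)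
  rw [← hB, hJd] at hcurv
  have h1 : r * (ζ / 2 * ‖d‖ ^ 2 - B * ‖c‖) ≤ max ⟪d, H d⟫_ℝ 0 := by
    calc r * (ζ / 2 * ‖d‖ ^ 2 - B * ‖c‖) ≤ r * max ⟪d, H d⟫_ℝ 0 := by
          gcongr; exact hcurv.trans (le_max_left _ _)
      _ ≤ 1 * max ⟪d, H d⟫_ℝ 0 := by gcongr
      _ = _ := one_mul _
  have h2 : T * (r * (ζ / 2 * ‖d‖ ^ 2 - B * ‖c‖)) ≤ T * max ⟪d, H d⟫_ℝ 0 := by gcongr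
  have h3 : T * (r * B) * ‖c‖ ≤ σ / 2 * ‖c‖ := by
    gcongr
    exact (by gcongr : T * (r * B) ≤ τi * (r * B)).trans hrB
  have h4 : σ * ‖c‖ ≤ σ * l1norm c := by gcongr; exact norm_le_l1norm c
  rw [curvedSlope] at hq
  have h5 : T * (r * (ζ / 2)) * ‖d‖ ^ 2 + σ / 2 * ‖c‖ ≤ -T * ⟪g, d⟫_ℝ + l1norm c := by nlinarith
  have h6 : min (r * (ζ / 2)) (σ / (2 * τi)) * T * ‖d‖ ^ 2 ≤ T * (r * (ζ / 2)) * ‖d‖ ^ 2 := by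
    rw [mul_comm T]
    gcongr
    exact min_le_left _ _
  have h7 : min (r * (ζ / 2)) (σ / (2 * τi)) * T * ‖c‖ ≤ σ / 2 * ‖c‖ := by
    gcongr
    calc min (r * (ζ / 2)) (σ / (2 * τi)) * T ≤ σ / (2 * τi) * τi := by
          gcongr; exact min_le_right _ _
      _ = σ / 2 := by field_simp
  linarith

/-! ### Perturbation of the search direction -/

/-- The search direction depends Lipschitz continuously on the gradient. -/
theorem LocalBounds.norm_sub_le (h : LocalBounds H J κH ζ κ) (hζ : 0 < ζ)
    (hs : IsSQPStep H J g c d y) (hs' : IsSQPStep H J g' c d' y') :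
    ‖d' - d‖ ≤ ‖g' - g‖ / ζ := by
  rw [le_div_iff₀ hζ]
  have hker : J (d' - d) = 0 := by rw [map_sub, hs.feas, hs'.feas, sub_self]
  have h1 : ζ * ‖d' - d‖ ^ 2 ≤ ‖g' - g‖ * ‖d' - d‖ := by
    refine (h.pos _ hker).trans ?_
    have h2 : ⟪g' - g, d' - d⟫_ℝ = -⟪d' - d, H (d' - d)⟫_ℝ := by
      rw [inner_sub_left, hs'.inner_eq, hs.inner_eq, hker, inner_zero_right, inner_zero_right,
        ← h.symm, map_sub, inner_sub_left (H d')]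
      ring
    have h3 := (abs_le.1 (abs_real_inner_le_norm (g' - g) (d' - d))).1
    linarith
  by_cases h0 : ‖d' - d‖ = 0
  · rw [h0, zero_mul]; positivity
  · have h0' : 0 < ‖d' - d‖ := lt_of_le_of_ne (norm_nonneg _) (Ne.symm h0)
    refine le_of_mul_le_mul_right ?_ h0'
    calc ‖d' - d‖ * ζ * ‖d' - d‖ = ζ * ‖d' - d‖ ^ 2 := by ring
      _ ≤ _ := h1

theorem LocalBounds.abs_inner_sub_le (h : LocalBounds H J κH ζ κ) (hκH : 0 < κH) (hζ : 0 < ζ)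
    (hs : IsSQPStep H J g c d y) (hs' : IsSQPStep H J g' c d' y') :
    |⟪g', d'⟫_ℝ - ⟪g, d⟫_ℝ| ≤ (1 + κH / ζ) * (‖g' - g‖ * ‖d‖) + ‖g' - g‖ ^ 2 / ζ := by
  have hker : J (d' - d) = 0 := by rw [map_sub, hs.feas, hs'.feas, sub_self]
  have hdd := h.norm_sub_le hζ hs hs'
  have e : ⟪g', d'⟫_ℝ - ⟪g, d⟫_ℝ = ⟪g' - g, d⟫_ℝ + ⟪g' - g, d' - d⟫_ℝ - ⟪d, H (d' - d)⟫_ℝ := by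
    have h1 := hs.inner_eq (d' - d)
    rw [hker, inner_zero_right, h.symm] at h1
    simp only [inner_sub_left, inner_sub_right, map_sub] at h1 ⊢
    linarith
  rw [e]
  have h2 := abs_real_inner_le_norm (g' - g) d
  have h3 := abs_real_inner_le_norm (g' - g) (d' - d)
  have h4 := abs_inner_apply_le H h.norm_le d (d' - d)
  have h5 : ‖g' - g‖ * ‖d' - d‖ ≤ ‖g' - g‖ * (‖g' - g‖ / ζ) := by gcongr
  have h6 : κH * (‖d‖ * ‖d' - d‖) ≤ κH * (‖d‖ * (‖g' - g‖ / ζ)) := by gcongr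
  have h7 : |⟪g' - g, d⟫_ℝ + ⟪g' - g, d' - d⟫_ℝ - ⟪d, H (d' - d)⟫_ℝ| ≤
      |⟪g' - g, d⟫_ℝ| + |⟪g' - g, d' - d⟫_ℝ| + |⟪d, H (d' - d)⟫_ℝ| :=
    (abs_sub _ _).trans (by gcongr; exact abs_add_le _ _)
  have h8 : (1 + κH / ζ) * (‖g' - g‖ * ‖d‖) + ‖g' - g‖ ^ 2 / ζ =
      ‖g' - g‖ * ‖d‖ + ‖g' - g‖ * (‖g' - g‖ / ζ) + κH * (‖d‖ * (‖g' - g‖ / ζ)) := by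
    field_simp; ring
  linarith

theorem LocalBounds.abs_curvature_sub_le (h : LocalBounds H J κH ζ κ) (hκH : 0 < κH) (hζ : 0 < ζ)
    (hs : IsSQPStep H J g c d y) (hs' : IsSQPStep H J g' c d' y') :
    |⟪d', H d'⟫_ℝ - ⟪d, H d⟫_ℝ| ≤
      2 * κH / ζ * (‖g' - g‖ * ‖d‖) + κH / ζ * (‖g' - g‖ ^ 2 / ζ) := by
  have hdd := h.norm_sub_le hζ hs hs'
  have e : ⟪d', H d'⟫_ℝ - ⟪d, H d⟫_ℝ = 2 * ⟪d, H (d' - d)⟫_ℝ + ⟪d' - d, H (d' - d)⟫_ℝ := by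
    have h1 : ⟪d', H d⟫_ℝ = ⟪d, H d'⟫_ℝ := by rw [← h.symm, real_inner_comm]
    simp only [inner_sub_left, inner_sub_right, map_sub]
    linarith
  rw [e]
  have h3 := abs_inner_apply_le H h.norm_le (d' - d) (d' - d)
  have h4 := abs_inner_apply_le H h.norm_le d (d' - d)
  have h5 : κH * (‖d' - d‖ * ‖d' - d‖) ≤ κH * ((‖g' - g‖ / ζ) * (‖g' - g‖ / ζ)) := by gcongr
  have h6 : κH * (‖d‖ * ‖d' - d‖) ≤ κH * (‖d‖ * (‖g' - g‖ / ζ)) := by gcongr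
  have h7 := abs_add_le (2 * ⟪d, H (d' - d)⟫_ℝ) ⟪d' - d, H (d' - d)⟫_ℝ
  rw [abs_mul, abs_two] at h7
  have h8 : 2 * κH / ζ * (‖g' - g‖ * ‖d‖) + κH / ζ * (‖g' - g‖ ^ 2 / ζ) =
      2 * (κH * (‖d‖ * (‖g' - g‖ / ζ))) + κH * ((‖g' - g‖ / ζ) * (‖g' - g‖ / ζ)) := by
    field_simp
  linarith

theorem LocalBounds.abs_curvedSlope_sub_le (h : LocalBounds H J κH ζ κ) (hκH : 0 < κH)
    (hζ : 0 < ζ) (hs : IsSQPStep H J g c d y) (hs' : IsSQPStep H J g' c d' y') :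
    |curvedSlope H g' d' - curvedSlope H g d| ≤
      (1 + 3 * κH / ζ) * (‖g' - g‖ * ‖d‖) + (1 + κH / ζ) * (‖g' - g‖ ^ 2 / ζ) := by
  have h1 := h.abs_inner_sub_le hκH hζ hs hs'
  have h2 := h.abs_curvature_sub_le hκH hζ hs hs'
  have h3 : |max ⟪d', H d'⟫_ℝ 0 - max ⟪d, H d⟫_ℝ 0| ≤ |⟪d', H d'⟫_ℝ - ⟪d, H d⟫_ℝ| := by
    simpa using abs_max_sub_max_le_max ⟪d', H d'⟫_ℝ 0 ⟪d, H d⟫_ℝ 0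
  have h4 : |curvedSlope H g' d' - curvedSlope H g d| ≤ |⟪g', d'⟫_ℝ - ⟪g, d⟫_ℝ| +
      |max ⟪d', H d'⟫_ℝ 0 - max ⟪d, H d⟫_ℝ 0| := by
    rw [curvedSlope, curvedSlope, add_sub_add_comm]
    exact abs_add_le _ _
  have h5 : (1 + 3 * κH / ζ) * (‖g' - g‖ * ‖d‖) + (1 + κH / ζ) * (‖g' - g‖ ^ 2 / ζ) =
      ((1 + κH / ζ) * (‖g' - g‖ * ‖d‖) + ‖g' - g‖ ^ 2 / ζ) +
      (2 * κH / ζ * (‖g' - g‖ * ‖d‖) + κH / ζ * (‖g' - g‖ ^ 2 / ζ)) := by ring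
  linarith

/-- An upper bound of the directional derivative along a step that uses the multiplier `y` of
another step, for which a bound is available. -/
theorem LocalBounds.inner_le (h : LocalBounds H J κH ζ κ) (hκH : 0 < κH) (hζ : 0 < ζ)
    (hs : IsSQPStep H J g c d y) (hs' : IsSQPStep H J g' c d' y') {κy : ℝ} (hy : ‖y‖ ≤ κy) :
    ⟪g', d'⟫_ℝ ≤ max κH κy * (‖d'‖ ^ 2 + ‖c‖) + (1 + κH / ζ) * (‖g' - g‖ * ‖d'‖) := by
  have hdd := h.norm_sub_le hζ hs hs'
  have e : ⟪g', d'⟫_ℝ = -⟪d', H d'⟫_ℝ + ⟪d', H (d' - d)⟫_ℝ + ⟪y, c⟫_ℝ + ⟪g' - g, d'⟫_ℝ := by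
    have h1 := hs.inner_eq d'
    rw [hs'.feas, inner_neg_right, h.symm] at h1
    have h2 : ⟪d', H d⟫_ℝ = ⟪d, H d'⟫_ℝ := by rw [← h.symm, real_inner_comm]
    simp only [inner_sub_left, inner_sub_right, map_sub]
    linarith
  have h1 := (abs_le.1 (abs_inner_apply_le H h.norm_le d' d')).1
  have h2 := (abs_le.1 (abs_inner_apply_le H h.norm_le d' (d' - d))).2
  have h3 : ⟪y, c⟫_ℝ ≤ κy * ‖c‖ := (real_inner_le_norm _ _).trans (by gcongr)
  have h4 := real_inner_le_norm (g' - g) d'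
  have h5 : κH * (‖d'‖ * ‖d' - d‖) ≤ κH * (‖d'‖ * (‖g' - g‖ / ζ)) := by gcongr
  have h6 : κH * ‖d'‖ ^ 2 ≤ max κH κy * ‖d'‖ ^ 2 := by gcongr; exact le_max_left _ _
  have h7 : κy * ‖c‖ ≤ max κH κy * ‖c‖ := by gcongr; exact le_max_right _ _
  have h8 : (1 + κH / ζ) * (‖g' - g‖ * ‖d'‖) =
      ‖g' - g‖ * ‖d'‖ + κH * (‖d'‖ * (‖g' - g‖ / ζ)) := by field_simp
  rw [e]
  nlinarith

end Linear

/-! ### Comparison of the deterministic and the stochastic model reduction -/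

/-- How the model reduction changes when the gradient `g'` and the merit parameter `T'` are replaced
by `g` and the update of `T'`. The three alternatives correspond to the three possible values of the
update: `T'`, `(1 - ετ) T'`, and the trial value. -/
theorem reduction_le_of_bounds {n m : ℕ} {H : Vec n →L[ℝ] Vec n} {g d g' d' : Vec n} {c : Vec m}
    {σ ετ T' N Q Y : ℝ} (hετ : ετ ∈ Set.Ioo (0 : ℝ) 1) (hT' : 0 < T')
    (hq' : T' * curvedSlope H g' d' ≤ (1 - σ) * l1norm c)
    (hN : |⟪g', d'⟫_ℝ - ⟪g, d⟫_ℝ| ≤ N) (hQ0 : 0 ≤ Q)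
    (hQ : |curvedSlope H g' d' - curvedSlope H g d| ≤ Q) (hY : ⟪g', d'⟫_ℝ ≤ Y) :
    (-meritUpdate σ ετ T' H g d c * ⟪g, d⟫_ℝ + l1norm c ≤
      (-T' * ⟪g', d'⟫_ℝ + l1norm c) + T' * N) ∨
    (-meritUpdate σ ετ T' H g d c * ⟪g, d⟫_ℝ + l1norm c ≤
      (-T' * ⟪g', d'⟫_ℝ + l1norm c) + (1 + ετ) * (T' * N) + ετ * (T' * Y)) ∨
    (-meritUpdate σ ετ T' H g d c * ⟪g, d⟫_ℝ + l1norm c ≤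
      (-T' * ⟪g', d'⟫_ℝ + l1norm c) + T' * N + T' * Q) := by
  have hετ0 := hετ.1
  obtain ⟨hN1, hN2⟩ := abs_le.1 hN
  obtain ⟨hQ1, hQ2⟩ := abs_le.1 hQ
  have h0 : T' * (⟪g', d'⟫_ℝ - ⟪g, d⟫_ℝ) ≤ T' * N := by gcongr
  rcases meritUpdate_cases (σ := σ) (ετ := ετ) (τ := T') (H := H) (g := g) (d := d) (c := c)
    with h | h | ⟨hq, hlt, h⟩
  · left
    rw [h]; linarith
  · right; left
    rw [h]
    have h1 : ετ * T' * ⟪g, d⟫_ℝ ≤ ετ * T' * (N + Y) := by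
      gcongr; linarith
    linarith
  · right; right
    generalize meritUpdate σ ετ T' H g d c = T at *
    -- `T' q' ≤ (1 - σ) ‖c‖₁ = T q` turns the decrease of the merit parameter into one of `q`
    have h1 : (T' - T) * ⟪g, d⟫_ℝ ≤ T' * Q := by
      by_cases hg : ⟪g, d⟫_ℝ ≤ 0
      · have : 0 ≤ T' * Q := by positivity
        nlinarith
      · have h2 : ⟪g, d⟫_ℝ ≤ curvedSlope H g d := by
          rw [curvedSlope]; linarith [le_max_right ⟪d, H d⟫_ℝ 0]
        have h3 : (T' - T) * ⟪g, d⟫_ℝ ≤ (T' - T) * curvedSlope H g d := by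
          gcongr
        have h4 : T' * (curvedSlope H g d - curvedSlope H g' d') ≤ T' * Q := by
          gcongr; linarith
        linarith
    linarith

namespace Consts

/-- The sign and order conditions satisfied by the scalars of the complexity bound. -/
structure Valid (C : Consts) : Prop where
  κH : 0 < C.κH
  ζ : 0 < C.ζ
  κy : 0 < C.κy
  κl : 0 < C.κl
  τm : 0 < C.τm
  τbm : 0 < C.τbm
  τi : 0 < C.τi
  τm_le : C.τm ≤ C.τi
  αmax : 0 < C.αmax
  θ : C.θ ∈ Set.Ioo (0 : ℝ) 1
  σ : C.σ ∈ Set.Ioo (0 : ℝ) 1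
  ετ : C.ετ ∈ Set.Ioo (0 : ℝ) 1
  L : 0 ≤ C.L
  Γ : 0 ≤ C.Γ
  LΓ : 0 < C.L + C.Γ
  κFO : 0 ≤ C.κFO

variable {C : Consts}

theorem Valid.one_le_factor (hC : C.Valid) : 1 ≤ C.τi / ((1 - C.σ) * C.τm) := by
  have h1 : 0 < 1 - C.σ := by linarith [hC.σ.2]
  have h2 := hC.τm
  have h3 := hC.τm_le
  rw [one_le_div (by positivity)]
  nlinarith [hC.σ.1]

theorem Valid.ω2_pos (hC : C.Valid) : 0 < C.ω2 := by
  have := hC.κH; have := hC.κl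
  have : 0 < max C.κH C.κy := lt_max_of_lt_left hC.κH
  rw [ω2]; positivity

theorem Valid.ω3_nonneg (hC : C.Valid) : 0 ≤ C.ω3 := by
  have := hC.κH; have := hC.κl; have := hC.ζ; have := hC.τi; have := hC.αmax; have := hC.κFO
  rw [ω3]; positivity

theorem Valid.ω4_nonneg (hC : C.Valid) : 0 ≤ C.ω4 := by
  have := hC.κH; have := hC.κl; have := hC.ζ; have := hC.τi; have := hC.αmax; have := hC.κFO
  have := hC.ετ.1; have := hC.ω3_nonneg
  have : 0 < max C.κH C.κy := lt_max_of_lt_left hC.κH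
  rw [ω4]
  exact le_max_of_le_left (by positivity)

set_option maxHeartbeats 800000 in
/-- If the gradient error is at most `η √Δ`, where `Δ` is the deterministic model reduction, then
`Δ` is at most a constant multiple of the stochastic model reduction `Δ'`. The variables `w`, `D`,
`D'`, `c` stand for the norms of the gradient error, of the two search directions and of the
constraint values. -/
theorem Valid.reduction_le_of_abs_error (hC : C.Valid) {η w D D' c Δ Δ' T' N Q Y : ℝ} (hη : 0 < η)
    (hw0 : 0 ≤ w) (hΔ : 0 ≤ Δ) (hD0 : 0 ≤ D) (hc0 : 0 ≤ c) (hT'0 : 0 < T') (hT' : T' ≤ C.τi)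
    (hw : w ≤ η * √Δ) (hD : C.κl * C.τm * D ^ 2 ≤ Δ) (hD' : C.κl * T' * (D' ^ 2 + c) ≤ Δ')
    (hN : N = (1 + C.κH / C.ζ) * (w * D) + w ^ 2 / C.ζ)
    (hQ : Q = (1 + 3 * C.κH / C.ζ) * (w * D) + (1 + C.κH / C.ζ) * (w ^ 2 / C.ζ))
    (hY : Y = max C.κH C.κy * (D' ^ 2 + c) + (1 + C.κH / C.ζ) * (w * D'))
    (h : Δ ≤ Δ' + T' * N ∨ Δ ≤ Δ' + (1 + C.ετ) * (T' * N) + C.ετ * (T' * Y) ∨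
      Δ ≤ Δ' + T' * N + T' * Q) :
    (1 - η * C.ω5 η) * Δ ≤ (1 + C.ετ * C.ω2) * Δ' ∨ (1 - η * C.ω6 η) * Δ ≤ Δ' := by
  obtain ⟨hκH, hζ, hκy, hκl, hτm, -, hτi, hτmi, -, -, hσ, ⟨hετ, -⟩, -, -, -, -⟩ := id hC
  have hσ' : 0 < 1 - C.σ := by linarith [hσ.2]
  have hfac := hC.one_le_factor
  have hmax : 0 < max C.κH C.κy := lt_max_of_lt_left hκH
  set r := √(C.κl * C.τm) with hr
  have hr0 : 0 < r := Real.sqrt_pos.2 (by positivity)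
  have hr2 : r ^ 2 = C.κl * C.τm := Real.sq_sqrt (by positivity)
  set s := √Δ with hs
  have hs0 : 0 ≤ s := Real.sqrt_nonneg _
  have hs2 : s ^ 2 = Δ := Real.sq_sqrt hΔ
  have hDs : D ≤ s / r := by
    rw [le_div_iff₀ hr0]
    refine le_of_sq_le_sq ?_ hs0
    rw [mul_pow, hr2, hs2]; linarith
  have hwD : w * D ≤ η * Δ / r := by
    calc w * D ≤ η * s * (s / r) := by gcongr
      _ = η * Δ / r := by rw [← hs2]; ring
  have hw2 : w ^ 2 ≤ η ^ 2 * Δ := by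
    calc w ^ 2 ≤ (η * s) ^ 2 := by gcongr
      _ = _ := by rw [mul_pow, hs2]
  have hN0 : 0 ≤ N := by rw [hN]; positivity
  have hNle : N ≤ η * (η / C.ζ + (1 + C.κH / C.ζ) / r) * Δ := by
    calc N ≤ (1 + C.κH / C.ζ) * (η * Δ / r) + η ^ 2 * Δ / C.ζ := by rw [hN]; gcongr
      _ = _ := by ring
  have hTN : T' * N ≤ C.τi * (η * (η / C.ζ + (1 + C.κH / C.ζ) / r) * Δ) := by gcongr
  have hQ0 : 0 ≤ Q := by rw [hQ]; positivity
  have hQle : Q ≤ η * ((1 + C.κH / C.ζ) * (η / C.ζ) + (1 + 3 * C.κH / C.ζ) / r) * Δ := by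
    calc Q ≤ (1 + 3 * C.κH / C.ζ) * (η * Δ / r) + (1 + C.κH / C.ζ) * (η ^ 2 * Δ / C.ζ) := by
          rw [hQ]; gcongr
      _ = _ := by ring
  have hTQ : T' * Q ≤ C.τi / ((1 - C.σ) * C.τm) *
      (C.τi * (η * ((1 + C.κH / C.ζ) * (η / C.ζ) + (1 + 3 * C.κH / C.ζ) / r) * Δ)) := by
    have h1 : T' * Q ≤
      C.τi * (η * ((1 + C.κH / C.ζ) * (η / C.ζ) + (1 + 3 * C.κH / C.ζ) / r) * Δ) := by gcongr
    refine h1.trans (le_mul_of_one_le_left ?_ hfac)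
    positivity
  have hω6 : η * C.ω6 η * Δ = C.τi / ((1 - C.σ) * C.τm) *
      (C.τi * (η * ((1 + C.κH / C.ζ) * (η / C.ζ) + (1 + 3 * C.κH / C.ζ) / r) * Δ)) +
      C.τi * (η * (η / C.ζ + (1 + C.κH / C.ζ) / r) * Δ) := by
    rw [ω6, ← hr]; ring
  rcases h with h | h | h
  · right
    have : 0 ≤ T' * Q := by positivity
    linarith
  · left
    have hw' : (1 + C.κH / C.ζ) * (w * D') ≤ D' ^ 2 + (1 + C.κH / C.ζ) ^ 2 * (η ^ 2 * Δ) / 4 := by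
      have h1 : (1 + C.κH / C.ζ) * (w * D') ≤ D' ^ 2 + (1 + C.κH / C.ζ) ^ 2 * w ^ 2 / 4 := by
        nlinarith [sq_nonneg (D' - (1 + C.κH / C.ζ) * w / 2)]
      refine h1.trans ?_
      gcongr
    have hY' : T' * Y ≤ C.ω2 * Δ' + C.τi * ((1 + C.κH / C.ζ) ^ 2 * (η ^ 2 * Δ) / 4) := by
      have h1 : Y ≤ (max C.κH C.κy + 1) * (D' ^ 2 + c) +
          (1 + C.κH / C.ζ) ^ 2 * (η ^ 2 * Δ) / 4 := by rw [hY]; linarith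
      calc T' * Y ≤ T' * ((max C.κH C.κy + 1) * (D' ^ 2 + c) +
            (1 + C.κH / C.ζ) ^ 2 * (η ^ 2 * Δ) / 4) := by gcongr
        _ = C.ω2 * (C.κl * T' * (D' ^ 2 + c)) + T' * ((1 + C.κH / C.ζ) ^ 2 * (η ^ 2 * Δ) / 4) := by
            rw [ω2]; field_simp
        _ ≤ _ := by
            have := hC.ω2_pos
            gcongr
    have hω5 : η * C.ω5 η * Δ =
        (1 + C.ετ) * (C.τi * (η * (η / C.ζ + (1 + C.κH / C.ζ) / r) * Δ)) +
        C.ετ * (C.τi * ((1 + C.κH / C.ζ) ^ 2 * (η ^ 2 * Δ) / 4)) := by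
      rw [ω5, ← hr]; ring
    have h2 : (1 + C.ετ) * (T' * N) ≤
      (1 + C.ετ) * (C.τi * (η * (η / C.ζ + (1 + C.κH / C.ζ) / r) * Δ)) := by gcongr
    have h3 : C.ετ * (T' * Y) ≤
      C.ετ * (C.ω2 * Δ' + C.τi * ((1 + C.κH / C.ζ) ^ 2 * (η ^ 2 * Δ) / 4)) := by gcongr
    linarith
  · right
    linarith

/-- If the gradient error is at most `κFO α √Δ'`, then the deterministic model reduction `Δ` is at
most a constant multiple of the stochastic model reduction `Δ'`. -/
theorem Valid.reduction_le_of_rel_error (hC : C.Valid) {α w D' c Δ Δ' T' N Q Y : ℝ}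
    (hα : α ≤ C.αmax) (hw0 : 0 ≤ w) (hΔ' : 0 ≤ Δ') (hD0 : 0 ≤ D') (hc0 : 0 ≤ c) (hT'0 : 0 < T')
    (hT' : T' ≤ C.τi) (hw : w ≤ C.κFO * α * √Δ') (hD' : C.κl * T' * (D' ^ 2 + c) ≤ Δ')
    (hN : N = (1 + C.κH / C.ζ) * (w * D') + w ^ 2 / C.ζ)
    (hQ : Q = (1 + 3 * C.κH / C.ζ) * (w * D') + (1 + C.κH / C.ζ) * (w ^ 2 / C.ζ))
    (hY : Y = max C.κH C.κy * (D' ^ 2 + c) + (1 + C.κH / C.ζ) * (w * D'))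
    (h : Δ ≤ Δ' + T' * N ∨ Δ ≤ Δ' + (1 + C.ετ) * (T' * N) + C.ετ * (T' * Y) ∨
      Δ ≤ Δ' + T' * N + T' * Q) :
    Δ ≤ (1 + C.ω3 + C.ω4) * Δ' := by
  obtain ⟨hκH, hζ, hκy, hκl, hτm, -, hτi, hτmi, hαm, -, hσ, ⟨hετ, -⟩, -, -, -, hκFO⟩ := id hC
  have hσ' : 0 < 1 - C.σ := by linarith [hσ.2]
  have hfac := hC.one_le_factor
  have hmax : 0 < max C.κH C.κy := lt_max_of_lt_left hκH
  have hω3 := hC.ω3_nonneg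
  set s := √Δ' with hs
  have hs0 : 0 ≤ s := Real.sqrt_nonneg _
  have hs2 : s ^ 2 = Δ' := Real.sq_sqrt hΔ'
  have hw' : w ≤ C.κFO * C.αmax * s := hw.trans (by gcongr)
  have hl0 : 0 < √C.κl := Real.sqrt_pos.2 hκl
  have ht0 : 0 < √T' := Real.sqrt_pos.2 hT'0
  have ht2 : √T' ^ 2 = T' := Real.sq_sqrt hT'0.le
  have hti : √T' ≤ √C.τi := Real.sqrt_le_sqrt hT'
  have hDs : √T' * D' ≤ s / √C.κl := by
    rw [le_div_iff₀ hl0]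
    refine le_of_sq_le_sq ?_ hs0
    rw [mul_pow, mul_pow, Real.sq_sqrt hκl.le, Real.sq_sqrt hT'0.le, hs2]
    have : 0 ≤ C.κl * T' * c := by positivity
    linarith
  have hTwD : T' * (w * D') ≤ C.κFO * √C.τi * C.αmax / √C.κl * Δ' := by
    calc T' * (w * D') = √T' * w * (√T' * D') := by rw [← ht2]; simp; ring
      _ ≤ √C.τi * (C.κFO * C.αmax * s) * (s / √C.κl) := by gcongr
      _ = _ := by rw [← hs2]; ring
  have hTw2 : T' * (w ^ 2 / C.ζ) ≤ C.τi * C.κFO ^ 2 * C.αmax ^ 2 / C.ζ * Δ' := by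
    calc T' * (w ^ 2 / C.ζ) ≤ C.τi * ((C.κFO * C.αmax * s) ^ 2 / C.ζ) := by gcongr
      _ = _ := by rw [← hs2]; ring
  have hTN : T' * N ≤ C.ω3 * Δ' := by
    calc T' * N = (1 + C.κH / C.ζ) * (T' * (w * D')) + T' * (w ^ 2 / C.ζ) := by rw [hN]; ring
      _ ≤ (1 + C.κH / C.ζ) * (C.κFO * √C.τi * C.αmax / √C.κl * Δ') +
          C.τi * C.κFO ^ 2 * C.αmax ^ 2 / C.ζ * Δ' := by gcongr
      _ = _ := by rw [ω3]; ring
  rcases h with h | h | h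
  · have : 0 ≤ C.ω4 * Δ' := mul_nonneg hC.ω4_nonneg hΔ'
    linarith
  · have hTY : T' * Y ≤ (max C.κH C.κy / C.κl +
        √C.τi * (1 + C.κH / C.ζ) * C.κFO * C.αmax / √C.κl) * Δ' := by
      calc T' * Y = max C.κH C.κy / C.κl * (C.κl * T' * (D' ^ 2 + c)) +
            (1 + C.κH / C.ζ) * (T' * (w * D')) := by rw [hY]; field_simp
        _ ≤ max C.κH C.κy / C.κl * Δ' +
            (1 + C.κH / C.ζ) * (C.κFO * √C.τi * C.αmax / √C.κl * Δ') := by gcongr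
        _ = _ := by ring
    have h1 : C.ετ * (T' * N) ≤ C.ετ * (C.ω3 * Δ') := by gcongr
    have h2 : C.ετ * (T' * Y) ≤ C.ετ * ((max C.κH C.κy / C.κl +
        √C.τi * (1 + C.κH / C.ζ) * C.κFO * C.αmax / √C.κl) * Δ') := by gcongr
    have h3 : (C.ετ * (max C.κH C.κy / C.κl +
        √C.τi * (1 + C.κH / C.ζ) * C.κFO * C.αmax / √C.κl + C.ω3)) * Δ' ≤ C.ω4 * Δ' := by
      gcongr; exact le_max_left _ _
    linarith
  · have hTQ : T' * Q ≤ ((1 + 3 * C.κH / C.ζ) * C.κFO * √C.τi * C.αmax / √C.κl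
        + (1 + C.κH / C.ζ) * (C.τi * C.κFO ^ 2 * C.αmax ^ 2 / C.ζ)) * Δ' := by
      calc T' * Q = (1 + 3 * C.κH / C.ζ) * (T' * (w * D')) +
            (1 + C.κH / C.ζ) * (T' * (w ^ 2 / C.ζ)) := by rw [hQ]; ring
        _ ≤ (1 + 3 * C.κH / C.ζ) * (C.κFO * √C.τi * C.αmax / √C.κl * Δ') +
            (1 + C.κH / C.ζ) * (C.τi * C.κFO ^ 2 * C.αmax ^ 2 / C.ζ * Δ') := by gcongr
        _ = _ := by ring
    have h3 : ((1 + 3 * C.κH / C.ζ) * C.κFO * √C.τi * C.αmax / √C.κl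
        + (1 + C.κH / C.ζ) * (C.τi * C.κFO ^ 2 * C.αmax ^ 2 / C.ζ)) * Δ' ≤ C.ω4 * Δ' := by
      gcongr
      refine (le_mul_of_one_le_left ?_ hfac).trans (le_max_right _ _)
      positivity
    linarith

/-! ### Consequences of the admissibility of `η` -/

/-- A positive number below the positive root of `A η² + (1 - θ)² b η = (1 - θ)²`, where the root is
written with rationalized numerator. -/
theorem quadratic_lt_of_lt_root {A b e q η : ℝ} (hb : 0 ≤ b) (he : 0 < e) (hA : 0 < A)
    (hq : q = √(e ^ 2 * b ^ 2 + 4 * A)) (hη : 0 < η) (h : η < 2 * e * (1 / (e * b + q))) :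
    A * η ^ 2 + e ^ 2 * b * η < e ^ 2 := by
  have hq2 : q ^ 2 = e ^ 2 * b ^ 2 + 4 * A := by rw [hq]; exact Real.sq_sqrt (by positivity)
  have hq0 : 0 < q := by rw [hq]; exact Real.sqrt_pos.2 (by positivity)
  rw [mul_one_div, lt_div_iff₀ (by positivity)] at h
  -- `η q < 2 e - η e b`, and squaring gives the claim
  have h1 : η * q < 2 * e - η * (e * b) := by linarith
  have h2 : (η * q) ^ 2 < (2 * e - η * (e * b)) ^ 2 := by
    apply pow_lt_pow_left₀ h1 (by positivity) two_ne_zero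
  rw [mul_pow, hq2] at h2
  nlinarith

theorem Valid.etaAdmissible_left (hC : C.Valid) {η : ℝ} (h : C.EtaAdmissible η) :
    η ^ 2 * (C.τi / C.κl) * (1 + C.ετ * C.ω2) < (1 - C.θ) ^ 2 * (1 - η * C.ω5 η) := by
  obtain ⟨hκH, hζ, hκy, hκl, hτm, -, hτi, hτmi, hαm, hθ, hσ, ⟨hετ, -⟩, -, -, -, hκFO⟩ := id hC
  have hθ' : 0 < 1 - C.θ := by linarith [hθ.2]
  have hω2 := hC.ω2_pos
  have hr2 : √(C.κl * C.τm) ^ 2 = C.κl * C.τm := Real.sq_sqrt (by positivity)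
  have hr0 : 0 < √(C.κl * C.τm) := Real.sqrt_pos.2 (by positivity)
  have h1 := quadratic_lt_of_lt_root (e := 1 - C.θ)
    (b := (1 + C.ετ) * C.τi * (1 + C.κH / C.ζ) / √(C.κl * C.τm))
    (A := C.τi / C.κl * (1 + C.ετ * C.ω2) + (1 - C.θ) ^ 2 *
      ((1 + C.ετ) * C.τi / C.ζ + C.ετ * C.τi * (1 + C.κH / C.ζ) ^ 2 / 4)) (q := C.η2) (η := η)
    (by positivity) hθ' (by positivity) ?_ h.1 ?_
  · have e : (1 - C.θ) ^ 2 * (1 - η * C.ω5 η) - η ^ 2 * (C.τi / C.κl) * (1 + C.ετ * C.ω2) =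
      (1 - C.θ) ^ 2 - ((C.τi / C.κl * (1 + C.ετ * C.ω2) + (1 - C.θ) ^ 2 *
      ((1 + C.ετ) * C.τi / C.ζ + C.ετ * C.τi * (1 + C.κH / C.ζ) ^ 2 / 4)) * η ^ 2 +
      (1 - C.θ) ^ 2 * ((1 + C.ετ) * C.τi * (1 + C.κH / C.ζ) / √(C.κl * C.τm)) * η) := by
      rw [ω5]; ring
    linarith
  · rw [η2]
    congr 1
    rw [div_pow, hr2]
    field_simp
    ring
  · refine lt_of_lt_of_le h.2 ?_
    have e : (1 - C.θ) * ((1 + C.ετ) * C.τi * (1 + C.κH / C.ζ) / √(C.κl * C.τm)) = C.η1 := by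
      rw [η1]; ring
    rw [e]
    gcongr
    exact min_le_left _ _

theorem Valid.etaAdmissible_right (hC : C.Valid) {η : ℝ} (h : C.EtaAdmissible η) :
    η ^ 2 * (C.τi / C.κl) < (1 - C.θ) ^ 2 * (1 - η * C.ω6 η) := by
  obtain ⟨hκH, hζ, hκy, hκl, hτm, -, hτi, hτmi, hαm, hθ, hσ, ⟨hετ, -⟩, -, -, -, hκFO⟩ := id hC
  have hθ' : 0 < 1 - C.θ := by linarith [hθ.2]
  have hσ' : 0 < 1 - C.σ := by linarith [hσ.2]
  have hr2 : √(C.κl * C.τm) ^ 2 = C.κl * C.τm := Real.sq_sqrt (by positivity)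
  have hr0 : 0 < √(C.κl * C.τm) := Real.sqrt_pos.2 (by positivity)
  have h1 := quadratic_lt_of_lt_root (e := 1 - C.θ)
    (b := C.τi * (C.τi * (1 + 3 * C.κH / C.ζ) + (1 - C.σ) * C.τm * (1 + C.κH / C.ζ))
      / ((1 - C.σ) * C.τm * √(C.κl * C.τm)))
    (A := C.τi / C.κl + (1 - C.θ) ^ 2 *
      (C.τi ^ 2 * (1 + C.κH / C.ζ) / ((1 - C.σ) * C.τm * C.ζ) + C.τi / C.ζ)) (q := C.η4) (η := η)
    (by positivity) hθ' (by positivity) ?_ h.1 ?_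
  · have e : (1 - C.θ) ^ 2 * (1 - η * C.ω6 η) - η ^ 2 * (C.τi / C.κl) =
      (1 - C.θ) ^ 2 - ((C.τi / C.κl + (1 - C.θ) ^ 2 *
      (C.τi ^ 2 * (1 + C.κH / C.ζ) / ((1 - C.σ) * C.τm * C.ζ) + C.τi / C.ζ)) * η ^ 2 +
      (1 - C.θ) ^ 2 * (C.τi * (C.τi * (1 + 3 * C.κH / C.ζ) +
        (1 - C.σ) * C.τm * (1 + C.κH / C.ζ)) / ((1 - C.σ) * C.τm * √(C.κl * C.τm))) * η) := by
      rw [ω6]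
      field_simp
      ring
    linarith
  · rw [η4]
    congr 1
    rw [div_pow, mul_pow, mul_pow, mul_pow, hr2]
    field_simp
    ring
  · refine lt_of_lt_of_le h.2 ?_
    have e : (1 - C.θ) * (C.τi * (C.τi * (1 + 3 * C.κH / C.ζ) +
        (1 - C.σ) * C.τm * (1 + C.κH / C.ζ)) / ((1 - C.σ) * C.τm * √(C.κl * C.τm))) = C.η3 := by
      rw [η3]; ring
    rw [e]
    gcongr
    exact min_le_right _ _

theorem Valid.one_sub_ω5_pos (hC : C.Valid) {η : ℝ} (h : C.EtaAdmissible η) :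
    0 < 1 - η * C.ω5 η := by
  have h1 := hC.etaAdmissible_left h
  have := hC.τi; have := hC.κl; have := hC.ετ.1; have := hC.ω2_pos; have := h.1
  exact pos_of_mul_pos_right (lt_of_le_of_lt (by positivity) h1) (sq_nonneg _)

theorem Valid.one_sub_ω6_pos (hC : C.Valid) {η : ℝ} (h : C.EtaAdmissible η) :
    0 < 1 - η * C.ω6 η := by
  have h1 := hC.etaAdmissible_right h
  have := hC.τi; have := hC.κl
  exact pos_of_mul_pos_right (lt_of_le_of_lt (by positivity) h1) (sq_nonneg _)

/-- The factor by which the deterministic model reduction may exceed the stochastic one when the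
gradient error is small relative to the former. -/
noncomputable def absRatio (C : Consts) (η : ℝ) : ℝ :=
  max √((1 + C.ετ * C.ω2) / (1 - η * C.ω5 η)) (1 / √(1 - η * C.ω6 η))

theorem Valid.eta_mul_absRatio_lt (hC : C.Valid) {η : ℝ} (h : C.EtaAdmissible η) :
    η * √(C.τi / C.κl) * C.absRatio η < 1 - C.θ := by
  have h5 := hC.one_sub_ω5_pos h
  have h6 := hC.one_sub_ω6_pos h
  have hθ' : 0 < 1 - C.θ := by linarith [hC.θ.2]
  have := hC.τi; have := hC.κl; have := hC.ετ.1; have := hC.ω2_pos; have := h.1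
  rw [absRatio, mul_max_of_nonneg _ _ (by positivity)]
  refine max_lt ?_ ?_
  · refine lt_of_pow_lt_pow_left₀ 2 hθ'.le ?_
    rw [mul_pow, mul_pow, Real.sq_sqrt (by positivity), Real.sq_sqrt (by positivity),
      mul_div_assoc', div_lt_iff₀ h5]
    exact hC.etaAdmissible_left h
  · refine lt_of_pow_lt_pow_left₀ 2 hθ'.le ?_
    rw [mul_pow, mul_pow, Real.sq_sqrt (by positivity), div_pow, Real.sq_sqrt h6.le,
      mul_div_assoc', div_lt_iff₀ h6, one_pow, mul_one]
    exact hC.etaAdmissible_right h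

theorem Valid.denom_pos (hC : C.Valid) :
    0 < √(C.τi / C.κl) * C.κFO + C.L / (2 * C.κl) + C.Γ / (2 * C.τbm * C.κl) := by
  have := hC.τi; have := hC.κl; have := hC.κFO; have := hC.τbm; have hL := hC.L; have hΓ := hC.Γ
  have h1 : 0 ≤ √(C.τi / C.κl) * C.κFO := by positivity
  have h2 : 0 < C.L / (2 * C.κl) + C.Γ / (2 * C.τbm * C.κl) := by
    rcases hL.lt_or_eq with h | h
    · positivity
    · have : 0 < C.Γ := by linarith [hC.LΓ]
      positivity
  linarith

theorem Valid.lipschitz_pos (hC : C.Valid) : 0 < C.τbm * C.L + C.Γ := by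
  have := hC.τbm; have hL := hC.L; have hΓ := hC.Γ
  rcases hL.lt_or_eq with h | h
  · positivity
  · have : 0 < C.Γ := by linarith [hC.LΓ]
    positivity

theorem Valid.αTilde_pos (hC : C.Valid) {η : ℝ} (h : C.EtaAdmissible η) : 0 < C.αTilde η := by
  have h1 := hC.eta_mul_absRatio_lt h
  have h2 := hC.lipschitz_pos
  have h3 := hC.denom_pos
  have := hC.κl; have := hC.τbm
  have h4 : 0 < 1 - C.θ := by linarith [hC.θ.2]
  refine lt_min (by positivity) (div_pos (mul_pos (by positivity) ?_) h2)
  rw [absRatio] at h1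
  linarith

/-- The fraction of the squared target accuracy that is guaranteed for the stochastic model
reduction. -/
noncomputable def minRatio (C : Consts) (η : ℝ) : ℝ :=
  min (min ((1 - η * C.ω5 η) / (1 + C.ετ * C.ω2)) (1 - η * C.ω6 η)) (1 / (1 + C.ω3 + C.ω4))

theorem Valid.minRatio_pos (hC : C.Valid) {η : ℝ} (h : C.EtaAdmissible η) : 0 < C.minRatio η := by
  have h5 := hC.one_sub_ω5_pos h
  have := hC.ετ.1; have := hC.ω2_pos; have := hC.ω3_nonneg; have := hC.ω4_nonneg
  exact lt_min (lt_min (by positivity) (hC.one_sub_ω6_pos h)) (by positivity)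

theorem h_eq (C : Consts) (η ε α : ℝ) : C.h η ε α = α * C.θ * ε ^ 2 * C.minRatio η := rfl

end Consts

/-! ### Decrease of the merit function along a step -/

/-- The quadratic upper bound of a function whose gradient is Lipschitz continuous on a convex
set. -/
theorem le_add_inner_add_sq {n : ℕ} {X : Set (Vec n)} (hX : Convex ℝ X) {φ : Vec n → ℝ}
    {G : Vec n → Vec n} (hG : ∀ z, HasGradientAt φ (G z) z) {L : ℝ}
    (hL : ∀ x ∈ X, ∀ y ∈ X, ‖G x - G y‖ ≤ L * ‖x - y‖) {x d : Vec n} (hx : x ∈ X)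
    (hxd : x + d ∈ X) : φ (x + d) ≤ φ x + ⟪G x, d⟫_ℝ + L / 2 * ‖d‖ ^ 2 := by
  set F : ℝ → ℝ := fun t => φ (x + t • d) - (t * ⟪G x, d⟫_ℝ + L / 2 * ‖d‖ ^ 2 * t ^ 2) with hF
  have hder : ∀ t : ℝ, HasDerivAt F
      (⟪G (x + t • d), d⟫_ℝ - (⟪G x, d⟫_ℝ + L / 2 * ‖d‖ ^ 2 * (2 * t))) t := by
    intro t
    have h1 : HasDerivAt (fun t : ℝ => x + t • d) d t := by
      simpa using ((hasDerivAt_id t).smul_const d).const_add x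
    have h2 : HasDerivAt (fun t : ℝ => φ (x + t • d)) ⟪G (x + t • d), d⟫_ℝ t := by
      have h := (hG (x + t • d)).hasFDerivAt.comp_hasDerivAt t h1
      rwa [InnerProductSpace.toDual_apply_apply] at h
    have h3 : HasDerivAt (fun t : ℝ => t * ⟪G x, d⟫_ℝ) ⟪G x, d⟫_ℝ t := by
      simpa using (hasDerivAt_id t).mul_const ⟪G x, d⟫_ℝ
    have h4 : HasDerivAt (fun t : ℝ => L / 2 * ‖d‖ ^ 2 * t ^ 2) (L / 2 * ‖d‖ ^ 2 * (2 * t)) t := by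
      simpa using (hasDerivAt_pow 2 t).const_mul (L / 2 * ‖d‖ ^ 2)
    exact h2.sub (h3.add h4)
  have hanti : AntitoneOn F (Set.Icc 0 1) := by
    refine antitoneOn_of_deriv_nonpos (convex_Icc 0 1)
      (fun t _ => (hder t).continuousAt.continuousWithinAt)
      (fun t _ => (hder t).differentiableAt.differentiableWithinAt) ?_
    intro t ht
    rw [interior_Icc] at ht
    rw [(hder t).deriv]
    have hmem : x + t • d ∈ X := by
      have h5 := hX.add_smul_sub_mem hx hxd (t := t) ⟨ht.1.le, ht.2.le⟩
      simpa using h5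
    have h6 : ⟪G (x + t • d) - G x, d⟫_ℝ ≤ L * (t * ‖d‖) * ‖d‖ := by
      refine (real_inner_le_norm _ _).trans ?_
      gcongr
      refine (hL _ hmem _ hx).trans_eq ?_
      rw [add_sub_cancel_left, norm_smul, Real.norm_of_nonneg ht.1.le]
    rw [inner_sub_left] at h6
    linarith
  have h := hanti (Set.left_mem_Icc.2 zero_le_one) (Set.right_mem_Icc.2 zero_le_one) zero_le_one
  simp only [hF, one_smul, zero_smul, add_zero] at h
  linarith

theorem abs_sub_sub_inner_le {n : ℕ} {X : Set (Vec n)} (hX : Convex ℝ X) {φ : Vec n → ℝ}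
    {G : Vec n → Vec n} (hG : ∀ z, HasGradientAt φ (G z) z) {L : ℝ}
    (hL : ∀ x ∈ X, ∀ y ∈ X, ‖G x - G y‖ ≤ L * ‖x - y‖) {x d : Vec n} (hx : x ∈ X)
    (hxd : x + d ∈ X) : |φ (x + d) - φ x - ⟪G x, d⟫_ℝ| ≤ L / 2 * ‖d‖ ^ 2 := by
  have h1 := le_add_inner_add_sq hX hG hL hx hxd
  have h2 := le_add_inner_add_sq hX (φ := fun z => -φ z) (G := fun z => -G z) (L := L)
    (fun z => by
      rw [hasGradientAt_iff_hasFDerivAt, map_neg]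
      exact (hG z).hasFDerivAt.neg)
    (fun x hx y hy => by
      rw [neg_sub_neg, norm_sub_rev]
      exact hL x hx y hy) hx hxd
  rw [inner_neg_left] at h2
  rw [abs_le]
  constructor <;> linarith

section Regular

variable {n m : ℕ} {P : Problem n m} {X : Set (Vec n)} {L : ℝ} {Lc : Fin m → ℝ}

theorem Problem.Regular.hasGradientAt_f (hP : P.Regular X L Lc) (z : Vec n) :
    HasGradientAt P.f (gradient P.f z) z :=
  (hP.f_contDiff.differentiable one_ne_zero z).hasGradientAt

theorem Problem.Regular.hasFDerivAt_c (hP : P.Regular X L Lc) (z : Vec n) :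
    HasFDerivAt P.c (P.jac z) z :=
  (hP.c_contDiff.differentiable one_ne_zero z).hasFDerivAt

theorem Problem.Regular.hasFDerivAt_c_apply (hP : P.Regular X L Lc) (i : Fin m) (z : Vec n) :
    HasFDerivAt (fun y => P.c y i) ((EuclideanSpace.proj i).comp (P.jac z)) z :=
  (EuclideanSpace.proj (𝕜 := ℝ) i).hasFDerivAt.comp z (hP.hasFDerivAt_c z)

theorem Problem.Regular.hasGradientAt_c (hP : P.Regular X L Lc) (i : Fin m) (z : Vec n) :
    HasGradientAt (fun y => P.c y i) (gradient (fun y => P.c y i) z) z :=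
  (hP.hasFDerivAt_c_apply i z).differentiableAt.hasGradientAt

theorem Problem.Regular.inner_gradient_c (hP : P.Regular X L Lc) (i : Fin m) (z d : Vec n) :
    ⟪gradient (fun y => P.c y i) z, d⟫_ℝ = P.jac z d i := by
  have h := (hP.hasGradientAt_c i z).hasFDerivAt.unique (hP.hasFDerivAt_c_apply i z)
  simpa using congrArg (fun A : Vec n →L[ℝ] ℝ => A d) h

/-- Along a linearly feasible direction `d`, the step `α d` reduces the linear model of the
constraint violation by the factor `1 - α`. -/
theorem Problem.Regular.l1norm_step_le (hP : P.Regular X L Lc) {x d : Vec n} {α : ℝ}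
    (hα1 : α ≤ 1) (hx : x ∈ X) (hxd : x + α • d ∈ X) (hd : P.jac x d = -P.c x) :
    l1norm (P.c (x + α • d)) ≤
      (1 - α) * l1norm (P.c x) + (∑ i, Lc i) / 2 * (α ^ 2 * ‖d‖ ^ 2) := by
  have h : ∀ i, |P.c (x + α • d) i| ≤ (1 - α) * |P.c x i| + Lc i / 2 * (α ^ 2 * ‖d‖ ^ 2) := by
    intro i
    have h1 := abs_sub_sub_inner_le hP.convex (hP.hasGradientAt_c i) (hP.c_grad_lipschitz i) hx hxd
    rw [hP.inner_gradient_c, map_smul, hd, norm_smul, mul_pow, Real.norm_eq_abs, sq_abs] at h1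
    have h2 : P.c (x + α • d) i = (P.c (x + α • d) i - P.c x i - (α • -P.c x) i) +
        (1 - α) * P.c x i := by
      simp only [PiLp.smul_apply, PiLp.neg_apply, smul_eq_mul]; ring
    rw [h2]
    refine (abs_add_le _ _).trans ?_
    rw [abs_mul, abs_of_nonneg (by linarith : 0 ≤ 1 - α)]
    linarith
  calc l1norm (P.c (x + α • d)) ≤
        ∑ i, ((1 - α) * |P.c x i| + Lc i / 2 * (α ^ 2 * ‖d‖ ^ 2)) := Finset.sum_le_sum fun i _ => h i
    _ = _ := by
        rw [Finset.sum_add_distrib, ← Finset.mul_sum, ← Finset.sum_mul, ← Finset.sum_div, l1norm]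

/-- The change of the merit function along the step `α d` computed with the gradient estimate `g`,
in terms of the model reduction and of the gradient error. -/
theorem Problem.Regular.merit_step_le (hP : P.Regular X L Lc) {x g d : Vec n} {α τ : ℝ}
    (hα0 : 0 ≤ α) (hα1 : α ≤ 1) (hτ : 0 ≤ τ) (hx : x ∈ X) (hxd : x + α • d ∈ X)
    (hd : P.jac x d = -P.c x) :
    P.merit (x + α • d) τ ≤ P.merit x τ - α * (-τ * ⟪g, d⟫_ℝ + l1norm (P.c x))
      + α * (τ * (‖g - gradient P.f x‖ * ‖d‖))
      + (τ * L + ∑ i, Lc i) / 2 * (α ^ 2 * ‖d‖ ^ 2) := by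
  have h1 := le_add_inner_add_sq hP.convex hP.hasGradientAt_f hP.f_grad_lipschitz hx hxd
  rw [inner_smul_right, norm_smul, mul_pow, Real.norm_eq_abs, sq_abs] at h1
  have h2 := hP.l1norm_step_le hα1 hx hxd hd
  have h3 : ⟪gradient P.f x, d⟫_ℝ ≤ ⟪g, d⟫_ℝ + ‖g - gradient P.f x‖ * ‖d‖ := by
    have h4 := (abs_le.1 (abs_real_inner_le_norm (g - gradient P.f x) d)).1
    rw [inner_sub_left] at h4
    linarith
  have h5 : τ * P.f (x + α • d) ≤ τ * (P.f x + α * (⟪g, d⟫_ℝ + ‖g - gradient P.f x‖ * ‖d‖) +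
      L / 2 * (α ^ 2 * ‖d‖ ^ 2)) := by
    gcongr
    refine h1.trans ?_
    gcongr
  rw [Problem.merit, Problem.merit]
  linarith

end Regular

namespace Consts

variable {C : Consts}

/-- If the step size is at most `α̃ / ϱ`, then the model reduction dominates the error terms in the
change of the merit function. The scalar `ϱ ∈ (0, 1]` measures by how much the bound `hD` of the
length `D` of the search direction is better than the one with the constant `κl`. -/
theorem Valid.error_le_reduction (hC : C.Valid) {η ϱ α w D Δ' T' : ℝ} (hη : C.EtaAdmissible η)
    (hϱ0 : 0 < ϱ) (hϱ1 : ϱ ≤ 1) (hα0 : 0 ≤ α) (hα : ϱ * α ≤ C.αTilde η) (hΔ' : 0 ≤ Δ')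
    (hw0 : 0 ≤ w) (hT'0 : C.τbm ≤ T') (hT' : T' ≤ C.τi)
    (hD : C.κl * T' * D ^ 2 ≤ ϱ ^ 2 * Δ')
    (hw : w ≤ η * (C.absRatio η * √Δ') ∨ w ≤ C.κFO * α * √Δ') :
    α * (T' * (w * D)) + (T' * C.L + C.Γ) / 2 * (α ^ 2 * D ^ 2) ≤ α * ((1 - C.θ) * Δ') := by
  have hκl := hC.κl; have hτbm := hC.τbm; have hL := hC.L; have hΓ := hC.Γ
  have hτi := hC.τi; have hη0 := hη.1
  have hκFO := hC.κFO
  have hT0 : 0 < T' := lt_of_lt_of_le hτbm hT'0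
  set s := √Δ' with hs
  have hs0 : 0 ≤ s := Real.sqrt_nonneg _
  have hs2 : s ^ 2 = Δ' := Real.sq_sqrt hΔ'
  have ht0 : 0 < √(C.τi / C.κl) := Real.sqrt_pos.2 (by positivity)
  -- `T' D ≤ ϱ √(T' / κl) √Δ'`
  have hTD : T' * D ≤ ϱ * √(C.τi / C.κl) * s := by
    refine le_of_sq_le_sq ?_ (by positivity)
    rw [mul_pow, mul_pow, mul_pow, Real.sq_sqrt (by positivity), hs2]
    have h1 : T' * (C.κl * T' * D ^ 2) ≤ C.τi * (ϱ ^ 2 * Δ') := by gcongr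
    rw [mul_div_assoc', div_mul_eq_mul_div, le_div_iff₀ hκl]
    linarith
  have hquad : (T' * C.L + C.Γ) / 2 * D ^ 2 ≤
      ϱ ^ 2 * ((C.L / (2 * C.κl) + C.Γ / (2 * C.τbm * C.κl)) * Δ') := by
    have h1 : D ^ 2 ≤ ϱ ^ 2 * Δ' / (C.κl * T') := by
      rw [le_div_iff₀ (by positivity)]; linarith
    calc (T' * C.L + C.Γ) / 2 * D ^ 2 ≤ (T' * C.L + C.Γ) / 2 * (ϱ ^ 2 * Δ' / (C.κl * T')) := by
          gcongr
      _ = ϱ ^ 2 * ((C.L / (2 * C.κl) + C.Γ / (2 * T' * C.κl)) * Δ') := by field_simp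
      _ ≤ _ := by gcongr
  have hϱ2 : ϱ ^ 2 ≤ ϱ := by nlinarith
  have hquad0 : 0 ≤ C.L / (2 * C.κl) + C.Γ / (2 * C.τbm * C.κl) := by positivity
  suffices h : T' * (w * D) + α * ((T' * C.L + C.Γ) / 2 * D ^ 2) ≤ (1 - C.θ) * Δ' by
    calc α * (T' * (w * D)) + (T' * C.L + C.Γ) / 2 * (α ^ 2 * D ^ 2) =
          α * (T' * (w * D) + α * ((T' * C.L + C.Γ) / 2 * D ^ 2)) := by ring
      _ ≤ _ := by gcongr
  have h2 : α * ((T' * C.L + C.Γ) / 2 * D ^ 2) ≤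
      ϱ * (ϱ * α * ((C.L / (2 * C.κl) + C.Γ / (2 * C.τbm * C.κl)) * Δ')) := by
    calc α * ((T' * C.L + C.Γ) / 2 * D ^ 2) ≤
        α * (ϱ ^ 2 * ((C.L / (2 * C.κl) + C.Γ / (2 * C.τbm * C.κl)) * Δ')) := by gcongr
      _ = _ := by ring
  have h3 : T' * (w * D) ≤ w * (ϱ * √(C.τi / C.κl) * s) := by
    calc T' * (w * D) = w * (T' * D) := by ring
      _ ≤ _ := by gcongr
  rcases hw with hw | hw
  · have hlt := hC.eta_mul_absRatio_lt hη
    have hα2 : ϱ * α * (C.L / (2 * C.κl) + C.Γ / (2 * C.τbm * C.κl)) ≤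
        1 - C.θ - η * √(C.τi / C.κl) * C.absRatio η := by
      have h4 := hα.trans (min_le_right _ _)
      rw [le_div_iff₀ hC.lipschitz_pos] at h4
      have e : C.L / (2 * C.κl) + C.Γ / (2 * C.τbm * C.κl) =
          (C.τbm * C.L + C.Γ) / (2 * C.τbm * C.κl) := by field_simp
      rw [e, mul_div_assoc', div_le_iff₀ (by positivity)]
      refine h4.trans_eq ?_
      rw [absRatio]; ring
    have h5 : w * (ϱ * √(C.τi / C.κl) * s) ≤
        ϱ * (η * √(C.τi / C.κl) * C.absRatio η * Δ') := by
      calc w * (ϱ * √(C.τi / C.κl) * s) ≤ η * (C.absRatio η * s) * (ϱ * √(C.τi / C.κl) * s) := by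
            gcongr
        _ = _ := by rw [← hs2]; ring
    have h6 : ϱ * α * ((C.L / (2 * C.κl) + C.Γ / (2 * C.τbm * C.κl)) * Δ') ≤
        (1 - C.θ - η * √(C.τi / C.κl) * C.absRatio η) * Δ' := by
      rw [← mul_assoc]; gcongr
    have h7 : ϱ * ((1 - C.θ) * Δ') ≤ 1 * ((1 - C.θ) * Δ') := by
      have : 0 ≤ 1 - C.θ := by linarith [hC.θ.2]
      gcongr
    have h8 : ϱ * (ϱ * α * ((C.L / (2 * C.κl) + C.Γ / (2 * C.τbm * C.κl)) * Δ')) ≤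
        ϱ * ((1 - C.θ - η * √(C.τi / C.κl) * C.absRatio η) * Δ') := by gcongr
    linarith
  · have hα1 : ϱ * α * (√(C.τi / C.κl) * C.κFO + C.L / (2 * C.κl) + C.Γ / (2 * C.τbm * C.κl)) ≤
        1 - C.θ := by
      have h4 := hα.trans (min_le_left _ _)
      rwa [le_div_iff₀ hC.denom_pos] at h4
    have h5 : w * (ϱ * √(C.τi / C.κl) * s) ≤ ϱ * α * (√(C.τi / C.κl) * C.κFO) * Δ' := by
      calc w * (ϱ * √(C.τi / C.κl) * s) ≤ C.κFO * α * s * (ϱ * √(C.τi / C.κl) * s) := by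
            gcongr
        _ = _ := by rw [← hs2]; ring
    have h6 : ϱ * (ϱ * α * ((C.L / (2 * C.κl) + C.Γ / (2 * C.τbm * C.κl)) * Δ')) ≤
        1 * (ϱ * α * ((C.L / (2 * C.κl) + C.Γ / (2 * C.τbm * C.κl)) * Δ')) := by gcongr
    have h7 : ϱ * α * (√(C.τi / C.κl) * C.κFO + C.L / (2 * C.κl) + C.Γ / (2 * C.τbm * C.κl)) * Δ' ≤
        (1 - C.θ) * Δ' := by gcongr
    linarith

end Consts

/-! ### Counting iterations with large steps -/

open scoped Classical in
/-- The real number `1` if the proposition holds and `0` otherwise. -/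
noncomputable def ind (p : Prop) : ℝ := if p then 1 else 0

theorem ind_of_true {p : Prop} (h : p) : ind p = 1 := if_pos h

theorem ind_of_false {p : Prop} (h : ¬ p) : ind p = 0 := if_neg h

theorem ind_nonneg (p : Prop) : 0 ≤ ind p := by
  by_cases h : p
  · rw [ind_of_true h]; exact zero_le_one
  · rw [ind_of_false h]

/-- The one-step estimate behind `sum_ind_true_le`, in terms of the logarithmic distance `x` of the
step size to the threshold; `z` is its value after the step and `g` the logarithm of the step size
factor. -/
theorem potential_step {x z g : ℝ} {tr succ : Prop} (hg : 0 < g) (hs : succ → x ≤ z ∧ z ≤ x + g)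
    (hs' : succ → x < 0 → z = x + g) (hf : ¬ succ → z = x - g)
    (htr : tr → x ≤ 2 * g → succ) :
    |z - g| + 2 * g * ind tr ≤ |x - g| + 2 * g * ind (tr ∧ succ ∧ 0 ≤ x) + g := by
  have hstep : |z - g| ≤ |x - g| + g := by
    have h1 : |z - x| ≤ g := by
      by_cases h : succ
      · rw [abs_le]; constructor <;> linarith [(hs h).1, (hs h).2]
      · rw [hf h, abs_le]; constructor <;> linarith
    calc |z - g| = |(x - g) + (z - x)| := by congr 1; ring
      _ ≤ |x - g| + |z - x| := abs_add_le _ _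
      _ ≤ _ := by gcongr
  by_cases ht : tr
  · rw [ind_of_true ht]
    by_cases h : succ
    · by_cases hx : 0 ≤ x
      · rw [ind_of_true ⟨ht, h, hx⟩]; linarith
      · push Not at hx
        rw [ind_of_false (fun h' => absurd h'.2.2 (not_le.2 hx)), hs' h hx,
          abs_of_neg (by linarith : x - g < 0), abs_of_neg (by linarith : x + g - g < 0)]
        linarith
    · have hx : 2 * g < x := by
        by_contra hx
        exact h (htr ht (not_lt.1 hx))
      rw [ind_of_false (fun h' => h h'.2.1), hf h, abs_of_pos (by linarith : 0 < x - g - g),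
        abs_of_pos (by linarith : 0 < x - g)]
      linarith
  · rw [ind_of_false ht]
    have := ind_nonneg (tr ∧ succ ∧ 0 ≤ x)
    have : 0 ≤ 2 * g * ind (tr ∧ succ ∧ 0 ≤ x) := by positivity
    linarith

/-- Suppose that a step size is increased by the factor `γ⁻¹` (up to a cap) in successful iterations
and decreased by the factor `γ` in the others, and that true iterations with a step size of at most
`a / γ²` are successful. Then at least half of the excess of true iterations over the others consists
of true and successful iterations with a step size of at least `a`, up to the number of iterations
needed to come down to `a` from the initial step size.

The potential is the distance of the logarithm of the step size to `log (a / γ)`. Because of the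
factor `γ²` it decreases both in a true unsuccessful iteration and in a true successful one with a
step size below `a`, even if `a` is not one of the values that the step size takes. -/
theorem sum_ind_true_le {α : ℕ → ℝ} {succ tr : ℕ → Prop} {γ a αm : ℝ} (hγ : γ ∈ Set.Ioo (0 : ℝ) 1)
    (ha : 0 < a) (ha0 : a ≤ γ * α 0) (hα : ∀ k, 0 < α k) (hαm : ∀ k, α k ≤ αm)
    (hs : ∀ k, succ k → α (k + 1) = min αm (γ⁻¹ * α k))
    (hf : ∀ k, ¬ succ k → α (k + 1) = γ * α k) {t : ℕ}
    (htr : ∀ k < t, tr k → γ ^ 2 * α k ≤ a → succ k) :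
    ∑ k ∈ Finset.range t, ind (tr k) ≤
      ∑ k ∈ Finset.range t, ind (tr k ∧ succ k ∧ a ≤ α k) + t / 2
        + max ((Real.log a - Real.log (α 0)) / (2 * Real.log γ)) 0 - 1 / 2 := by
  obtain ⟨hγ0, hγ1⟩ := hγ
  set g : ℝ := -Real.log γ with hgdef
  have hg : 0 < g := by rw [hgdef]; linarith [Real.log_neg hγ0 hγ1]
  set x : ℕ → ℝ := fun k => Real.log (α k) - Real.log a with hx
  have hlog : ∀ k, Real.log (γ * α k) = Real.log (α k) - g := fun k => by
    rw [Real.log_mul hγ0.ne' (hα k).ne', hgdef]; ring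
  have hlog' : ∀ k, Real.log (γ⁻¹ * α k) = Real.log (α k) + g := fun k => by
    rw [Real.log_mul (inv_ne_zero hγ0.ne') (hα k).ne', Real.log_inv, hgdef]; ring
  have hxa : ∀ k, 0 ≤ x k ↔ a ≤ α k := fun k => by
    rw [hx]
    exact sub_nonneg.trans (Real.log_le_log_iff ha (hα k))
  have hstep : ∀ k < t, |x (k + 1) - g| + 2 * g * ind (tr k) ≤
      |x k - g| + 2 * g * ind (tr k ∧ succ k ∧ a ≤ α k) + g := by
    intro k hk
    rw [← hxa k]
    refine potential_step hg ?_ ?_ ?_ ?_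
    · intro h
      have h1 : α k ≤ α (k + 1) := by
        rw [hs k h]
        refine le_min (hαm k) (le_mul_of_one_le_left (hα k).le ?_)
        exact (one_le_inv₀ hγ0).2 hγ1.le
      have h2 : α (k + 1) ≤ γ⁻¹ * α k := by rw [hs k h]; exact min_le_right _ _
      have h3 := Real.log_le_log (hα k) h1
      have h4 := Real.log_le_log (hα (k + 1)) h2
      rw [hlog'] at h4
      constructor <;> simp only [hx] <;> linarith
    · intro h hlt
      have h1 : ¬ a ≤ α k := fun h' => absurd ((hxa k).2 h') (not_le.2 hlt)
      push Not at h1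
      have h2 : γ⁻¹ * α k ≤ αm := by
        rw [inv_mul_le_iff₀ hγ0]
        calc α k ≤ γ * α 0 := h1.le.trans ha0
          _ ≤ γ * αm := by gcongr; exact hαm 0
      simp only [hx]
      rw [hs k h, min_eq_right h2, hlog']
      ring
    · intro h
      simp only [hx]
      rw [hf k h, hlog]
      ring
    · intro ht hle
      refine htr k hk ht ?_
      rw [← Real.log_le_log_iff (mul_pos (pow_pos hγ0 2) (hα k)) ha,
        Real.log_mul (pow_pos hγ0 2).ne' (hα k).ne', Real.log_pow]
      simp only [hx] at hle
      push_cast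
      linarith
  have hsum : ∀ j ≤ t, |x j - g| + 2 * g * ∑ k ∈ Finset.range j, ind (tr k) ≤
      |x 0 - g| + 2 * g * ∑ k ∈ Finset.range j, ind (tr k ∧ succ k ∧ a ≤ α k) + g * j := by
    intro j
    induction j with
    | zero => intro _; simp
    | succ j ih =>
      intro hj
      have h1 := ih (by omega)
      have h2 := hstep j (by omega)
      rw [Finset.sum_range_succ, Finset.sum_range_succ]
      push_cast
      linarith
  have h0 : g ≤ x 0 := by
    have h1 := Real.log_le_log ha ha0
    rw [hlog] at h1
    simp only [hx]
    linarith
  have h1 := hsum t le_rfl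
  rw [abs_of_nonneg (by linarith : 0 ≤ x 0 - g)] at h1
  have h2 : (Real.log a - Real.log (α 0)) / (2 * Real.log γ) = x 0 / (2 * g) := by
    simp only [hx, hgdef]
    rw [show 2 * -Real.log γ = -(2 * Real.log γ) by ring, div_neg, ← neg_div, neg_sub]
  have h3 : x 0 / (2 * g) ≤ max ((Real.log a - Real.log (α 0)) / (2 * Real.log γ)) 0 :=
    h2 ▸ le_max_left _ _
  have h4 := abs_nonneg (x t - g)
  have h5 : ∑ k ∈ Finset.range t, ind (tr k) ≤
      ∑ k ∈ Finset.range t, ind (tr k ∧ succ k ∧ a ≤ α k) + t / 2 + x 0 / (2 * g) - 1 / 2 := by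
    refine le_of_mul_le_mul_left ?_ (by positivity : 0 < 2 * g)
    have e : 2 * g * (∑ k ∈ Finset.range t, ind (tr k ∧ succ k ∧ a ≤ α k) + t / 2 +
        x 0 / (2 * g) - 1 / 2) =
        2 * g * ∑ k ∈ Finset.range t, ind (tr k ∧ succ k ∧ a ≤ α k) + g * t + x 0 - g := by
      field_simp
    rw [e]
    linarith
  linarith

/-! ### Fresh randomness and exponential tail bounds -/

section Fresh

variable {Ω : Type u} {A : Type v} {B : Type w} {m' : MeasurableSpace Ω} [mΩ : MeasurableSpace Ω]
  [MeasurableSpace A]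
  [mB : MeasurableSpace B] {μ : Measure Ω} [IsProbabilityMeasure μ] {ρ : Measure B}

/-- A random element `ξ` that is independent of a σ-algebra can be integrated out while everything
that is measurable with respect to the σ-algebra is kept fixed. -/
theorem lintegral_fresh (hm : m' ≤ mΩ) {U : Ω → A} (hU : Measurable[m'] U)
    {ξ : Ω → B} (hξ : Measurable ξ) (hind : Indep (MeasurableSpace.comap ξ mB) m' μ)
    (hlaw : μ.map ξ = ρ) {Φ : A × B → ℝ≥0∞} (hΦ : Measurable Φ) :
    ∫⁻ ω, Φ (U ω, ξ ω) ∂μ = ∫⁻ ω, ∫⁻ b, Φ (U ω, b) ∂ρ ∂μ := by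
  have hU' : Measurable U := hU.mono hm le_rfl
  have h1 : IndepFun U ξ μ := by
    rw [IndepFun_iff_Indep]
    exact indep_of_indep_of_le_left hind.symm hU.comap_le
  have h2 := (indepFun_iff_map_prod_eq_prod_map_map hU'.aemeasurable hξ.aemeasurable).1 h1
  have : IsProbabilityMeasure (μ.map ξ) := Measure.isProbabilityMeasure_map hξ.aemeasurable
  rw [← lintegral_map hΦ (hU'.prodMk hξ), h2, lintegral_prod _ hΦ.aemeasurable, hlaw,
    lintegral_map _ hU']
  subst hlaw
  exact hΦ.lintegral_prod_right'

/-- A bound of the integral over fresh randomness gives a bound of the conditional expectation,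
here expressed by means of nonnegative weights `V` from the σ-algebra. -/
theorem lintegral_mul_fresh_le (hm : m' ≤ mΩ) {U : Ω → A}
    (hU : Measurable[m'] U) {ξ : Ω → B} (hξ : Measurable ξ)
    (hind : Indep (MeasurableSpace.comap ξ mB) m' μ) (hlaw : μ.map ξ = ρ) {Ψ : A × B → ℝ≥0∞}
    (hΨ : Measurable Ψ) {V : Ω → ℝ≥0∞} (hV : Measurable[m'] V) {K : ℝ≥0∞}
    (hK : ∀ᵐ ω ∂μ, ∫⁻ b, Ψ (U ω, b) ∂ρ ≤ K) :
    ∫⁻ ω, V ω * Ψ (U ω, ξ ω) ∂μ ≤ K * ∫⁻ ω, V ω ∂μ := by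
  have h1 := lintegral_fresh (μ := μ) (ρ := ρ) hm (U := fun ω => (V ω, U ω)) (hV.prodMk hU) hξ hind
    hlaw (Φ := fun q => q.1.1 * Ψ (q.1.2, q.2))
    (measurable_fst.fst.mul (hΨ.comp (measurable_fst.snd.prodMk measurable_snd)))
  simp only at h1
  rw [h1, ← lintegral_const_mul _ (hV.mono hm le_rfl)]
  refine lintegral_mono_ae ?_
  filter_upwards [hK] with ω hω
  rw [lintegral_const_mul (V ω) (f := fun b => Ψ (U ω, b)) (hΨ.comp measurable_prodMk_left),
    mul_comm]
  gcongr

end Fresh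

/-- The moment generating function bound for a Bernoulli variable behind the Azuma-Hoeffding
inequality with increments in `[-p, p]`: convexity reduces it to `cosh y ≤ exp (y² / 2)`. -/
theorem bernoulli_mgf_le {p lam : ℝ} (hp : 1 / 2 ≤ p) :
    Real.exp (-lam) + (1 - Real.exp (-lam)) * (1 - p) ≤
      Real.exp (-(lam * p) + lam ^ 2 * p ^ 2 / 2) := by
  have hp0 : 0 < p := by linarith
  have h1 := convexOn_exp.2 (Set.mem_univ (lam * p)) (Set.mem_univ (-(lam * p)))
    (div_nonneg (by linarith) (by linarith) : 0 ≤ (2 * p - 1) / (2 * p))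
    (by positivity : 0 ≤ 1 / (2 * p)) (by field_simp; ring)
  have e1 : ((2 * p - 1) / (2 * p)) • (lam * p) + (1 / (2 * p)) • (-(lam * p)) =
      lam * p + -lam := by
    simp only [smul_eq_mul]; field_simp; ring
  rw [e1] at h1
  simp only [smul_eq_mul] at h1
  have h2 : p * Real.exp (lam * p + -lam) + (1 - p) * Real.exp (lam * p) ≤ Real.cosh (lam * p) := by
    have h3 : p * Real.exp (lam * p + -lam) ≤ p * ((2 * p - 1) / (2 * p) * Real.exp (lam * p) +
      1 / (2 * p) * Real.exp (-(lam * p))) := by gcongr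
    have h4 : p * ((2 * p - 1) / (2 * p) * Real.exp (lam * p) +
      1 / (2 * p) * Real.exp (-(lam * p))) =
      (2 * p - 1) / 2 * Real.exp (lam * p) + 1 / 2 * Real.exp (-(lam * p)) := by
      field_simp
    rw [Real.cosh_eq]
    linarith
  have h5 := h2.trans (Real.cosh_le_exp_half_sq (lam * p))
  rw [Real.exp_add] at h5
  have e2 : Real.exp (-(lam * p) + lam ^ 2 * p ^ 2 / 2) =
      Real.exp (-(lam * p)) * Real.exp ((lam * p) ^ 2 / 2) := by
    rw [← Real.exp_add]; congr 1; ring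
  have e3 : Real.exp (-(lam * p)) * Real.exp (lam * p) = 1 := by
    rw [← Real.exp_add]; simp
  rw [e2]
  calc Real.exp (-lam) + (1 - Real.exp (-lam)) * (1 - p) =
        Real.exp (-(lam * p)) * Real.exp (lam * p) *
          (p * Real.exp (-lam) + (1 - p)) := by rw [e3]; ring
    _ = Real.exp (-(lam * p)) * (p * (Real.exp (lam * p) * Real.exp (-lam)) +
          (1 - p) * Real.exp (lam * p)) := by ring
    _ ≤ _ := by gcongr

theorem measurable_ind {Ω : Type u} {m' : MeasurableSpace Ω} {S : Set Ω} (hS : MeasurableSet[m'] S) :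
    Measurable[m'] fun ω => ind (ω ∈ S) := by
  classical
  have : (fun ω => ind (ω ∈ S)) = S.indicator fun _ => (1 : ℝ) := by
    ext ω
    by_cases h : ω ∈ S
    · rw [ind_of_true h, Set.indicator_of_mem h]
    · rw [ind_of_false h, Set.indicator_of_notMem h]
  rw [this]
  exact measurable_const.indicator hS

/-- The exponential Markov inequality. -/
theorem measure_le_of_lintegral_exp_le {Ω : Type u} [MeasurableSpace Ω] {μ : Measure Ω}
    {f : Ω → ℝ} (hf : Measurable f) {a x : ℝ}
    (h : ∫⁻ ω, ENNReal.ofReal (Real.exp (f ω)) ∂μ ≤ ENNReal.ofReal (Real.exp x)) :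
    μ {ω | a ≤ f ω} ≤ ENNReal.ofReal (Real.exp (x - a)) := by
  have h1 := mul_meas_ge_le_lintegral (μ := μ)
    (f := fun ω => ENNReal.ofReal (Real.exp (f ω))) (by fun_prop) (ENNReal.ofReal (Real.exp a))
  have h2 : {ω | a ≤ f ω} ⊆ {ω | ENNReal.ofReal (Real.exp a) ≤ ENNReal.ofReal (Real.exp (f ω))} :=
    fun ω hω => ENNReal.ofReal_le_ofReal (Real.exp_le_exp.2 hω)
  have h3 : ENNReal.ofReal (Real.exp a) * μ {ω | a ≤ f ω} ≤ ENNReal.ofReal (Real.exp x) :=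
    (by gcongr : _ ≤ _).trans (h1.trans h)
  calc μ {ω | a ≤ f ω} =
        ENNReal.ofReal (Real.exp (-a)) * (ENNReal.ofReal (Real.exp a) * μ {ω | a ≤ f ω}) := by
        rw [← mul_assoc, ← ENNReal.ofReal_mul (Real.exp_pos _).le, ← Real.exp_add]; simp
    _ ≤ ENNReal.ofReal (Real.exp (-a)) * ENNReal.ofReal (Real.exp x) := by gcongr
    _ = _ := by
        rw [← ENNReal.ofReal_mul (Real.exp_pos _).le, ← Real.exp_add]
        congr 2; ring

section Tail

variable {Ω : Type u} [mΩ : MeasurableSpace Ω] {μ : Measure Ω} [IsProbabilityMeasure μ]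
  {ℱ : Filtration ℕ mΩ}

/-- The exponential moments of an adapted sum grow at most by the factor of the one-step bound. -/
theorem lintegral_exp_sum_le {W : ℕ → Ω → ℝ} {K : ℝ≥0∞}
    (h : ∀ j, ∫⁻ ω, ENNReal.ofReal (Real.exp (∑ k ∈ Finset.range j, W k ω)) *
      ENNReal.ofReal (Real.exp (W j ω)) ∂μ ≤
      K * ∫⁻ ω, ENNReal.ofReal (Real.exp (∑ k ∈ Finset.range j, W k ω)) ∂μ) (t : ℕ) :
    ∫⁻ ω, ENNReal.ofReal (Real.exp (∑ k ∈ Finset.range t, W k ω)) ∂μ ≤ K ^ t := by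
  induction t with
  | zero => simp
  | succ t ih =>
    calc ∫⁻ ω, ENNReal.ofReal (Real.exp (∑ k ∈ Finset.range (t + 1), W k ω)) ∂μ =
          ∫⁻ ω, ENNReal.ofReal (Real.exp (∑ k ∈ Finset.range t, W k ω)) *
            ENNReal.ofReal (Real.exp (W t ω)) ∂μ := by
          refine lintegral_congr fun ω => ?_
          rw [← ENNReal.ofReal_mul (Real.exp_pos _).le, ← Real.exp_add, Finset.sum_range_succ]
      _ ≤ K * K ^ t := (h t).trans (by gcongr)
      _ = _ := by rw [pow_succ, mul_comm]

theorem measurable_exp_sum {W : ℕ → Ω → ℝ} (hW : ∀ k, Measurable[ℱ (k + 1)] (W k)) (t : ℕ) :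
    Measurable[ℱ t] fun ω => ENNReal.ofReal (Real.exp (∑ k ∈ Finset.range t, W k ω)) := by
  refine ENNReal.measurable_ofReal.comp (Real.measurable_exp.comp ?_)
  refine Finset.measurable_fun_sum _ fun k hk => ?_
  exact (hW k).mono (ℱ.mono (by have := Finset.mem_range.1 hk; omega)) le_rfl

/-- If each of the events `G k` has conditional probability at least `p`, then it is exponentially
unlikely that fewer than `phat t` of the first `t` events occur. -/
theorem measure_count_lt_le {G : ℕ → Set Ω} {p phat : ℝ}
    (hG : ∀ k, MeasurableSet[ℱ (k + 1)] (G k)) (hp : 1 / 2 ≤ p) (hp1 : p ≤ 1) (hphat : phat ≤ p)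
    (h : ∀ k (V : Ω → ℝ≥0∞), Measurable[ℱ k] V → (∀ ω, V ω ≤ 1) →
      ∫⁻ ω, V ω * ENNReal.ofReal (1 - ind (ω ∈ G k)) ∂μ ≤
        ENNReal.ofReal (1 - p) * ∫⁻ ω, V ω ∂μ) (t : ℕ) :
    μ {ω | ∑ k ∈ Finset.range t, ind (ω ∈ G k) ≤ phat * t} ≤
      ENNReal.ofReal (Real.exp (-((p - phat) ^ 2 / (2 * p ^ 2) * t))) := by
  have hp0 : 0 < p := by linarith
  set lam : ℝ := (p - phat) / p ^ 2 with hlam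
  have hlam0 : 0 ≤ lam := div_nonneg (by linarith) (by positivity)
  set W : ℕ → Ω → ℝ := fun k ω => -(lam * ind (ω ∈ G k)) with hWdef
  have hW : ∀ k, Measurable[ℱ (k + 1)] (W k) := fun k =>
    ((measurable_ind (hG k)).const_mul lam).neg
  set x : ℝ := -(lam * p) + lam ^ 2 * p ^ 2 / 2 with hx
  have hexp : Real.exp (-lam) ≤ 1 := by rw [Real.exp_le_one_iff]; linarith
  have h1 := lintegral_exp_sum_le (μ := μ) (W := W) (K := ENNReal.ofReal (Real.exp x)) (fun j => by
    set V : Ω → ℝ≥0∞ := fun ω => ENNReal.ofReal (Real.exp (∑ k ∈ Finset.range j, W k ω)) with hV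
    have hVm : Measurable[ℱ j] V := measurable_exp_sum hW j
    have hV1 : ∀ ω, V ω ≤ 1 := by
      intro ω
      rw [hV]
      refine ENNReal.ofReal_le_one.2 (Real.exp_le_one_iff.2 (Finset.sum_nonpos fun k _ => ?_))
      have := mul_nonneg hlam0 (ind_nonneg (ω ∈ G k))
      simp only [hWdef]; linarith
    have hVm' : Measurable V := hVm.mono (ℱ.le j) le_rfl
    have hGm : Measurable fun ω => ind (ω ∈ G j) :=
      (measurable_ind (hG j)).mono (ℱ.le _) le_rfl
    have e : ∀ ω, V ω * ENNReal.ofReal (Real.exp (W j ω)) =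
        ENNReal.ofReal (Real.exp (-lam)) * V ω + ENNReal.ofReal (1 - Real.exp (-lam)) *
          (V ω * ENNReal.ofReal (1 - ind (ω ∈ G j))) := by
      intro ω
      simp only [hWdef]
      by_cases hω : ω ∈ G j
      · rw [ind_of_true hω]; simp [mul_comm]
      · rw [ind_of_false hω]
        simp only [mul_zero, neg_zero, Real.exp_zero, sub_zero, ENNReal.ofReal_one, mul_one]
        rw [← add_mul, ← ENNReal.ofReal_add (Real.exp_pos _).le (by linarith)]
        simp
    calc ∫⁻ ω, V ω * ENNReal.ofReal (Real.exp (W j ω)) ∂μ =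
          ENNReal.ofReal (Real.exp (-lam)) * ∫⁻ ω, V ω ∂μ + ENNReal.ofReal (1 - Real.exp (-lam)) *
            ∫⁻ ω, V ω * ENNReal.ofReal (1 - ind (ω ∈ G j)) ∂μ := by
          rw [lintegral_congr e, lintegral_add_left (hVm'.const_mul _),
            lintegral_const_mul _ hVm', lintegral_const_mul _ (by fun_prop)]
      _ ≤ ENNReal.ofReal (Real.exp (-lam)) * ∫⁻ ω, V ω ∂μ + ENNReal.ofReal (1 - Real.exp (-lam)) *
            (ENNReal.ofReal (1 - p) * ∫⁻ ω, V ω ∂μ) := by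
          gcongr
          exact h j V hVm hV1
      _ = ENNReal.ofReal (Real.exp (-lam) + (1 - Real.exp (-lam)) * (1 - p)) * ∫⁻ ω, V ω ∂μ := by
          rw [ENNReal.ofReal_add (Real.exp_pos _).le (mul_nonneg (by linarith) (by linarith)),
            ENNReal.ofReal_mul (by linarith)]
          ring
      _ ≤ _ := by
          gcongr
          exact bernoulli_mgf_le hp) t
  rw [← ENNReal.ofReal_pow (Real.exp_pos _).le, ← Real.exp_nat_mul] at h1
  have h2 := measure_le_of_lintegral_exp_le (a := -(lam * (phat * t)))
    (Finset.measurable_fun_sum _ fun k _ => (hW k).mono (ℱ.le _) le_rfl) h1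
  have e : t * x - -(lam * (phat * t)) = -((p - phat) ^ 2 / (2 * p ^ 2) * t) := by
    rw [hx, hlam]; field_simp; ring
  rw [e] at h2
  refine (measure_mono fun ω hω => ?_).trans h2
  simp only [Set.mem_ofPred_eq, hWdef, Finset.sum_neg_distrib, ← Finset.mul_sum] at hω ⊢
  have := mul_le_mul_of_nonneg_left hω hlam0
  linarith

theorem exp_neg_le_expNeg {x : ℝ≥0∞} {y : ℝ} (hy : 0 ≤ y) (h : x ≤ ENNReal.ofReal y) :
    Real.exp (-y) ≤ expNeg x := by
  have hx : x ≠ ∞ := ne_top_of_le_ne_top ENNReal.ofReal_ne_top h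
  rw [expNeg, if_neg hx]
  exact Real.exp_le_exp.2 (neg_le_neg (ENNReal.toReal_le_of_le_ofReal hy h))

theorem subexpTail_nonneg (r N ν b : ℝ) : 0 ≤ subexpTail r N ν b := by
  rw [subexpTail, expNeg]
  split_ifs
  · exact le_rfl
  · exact (Real.exp_pos _).le

/-- Optimization of the exponential Markov inequality for sub-exponential variables: the best
admissible `lam` is `r / ν²` if this is at most `1 / b`, and `1 / b` otherwise. -/
theorem le_subexpTail_mul {a c : ℝ≥0∞} {r N ν b : ℝ} (hr : 0 ≤ r) (hN : 0 ≤ N) (hν : 0 ≤ ν)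
    (hb : 0 ≤ b) (hc : c ≠ ∞)
    (h : ∀ lam : ℝ, 0 ≤ lam → lam * b ≤ 1 →
      a ≤ ENNReal.ofReal (Real.exp (-(lam * (r * N)) + lam ^ 2 * ν ^ 2 * N / 2)) * c) :
    a ≤ ENNReal.ofReal (subexpTail r N ν b) * c := by
  have key : ∀ (lam y : ℝ), 0 ≤ lam → lam * b ≤ 1 → 0 ≤ y →
      -(lam * (r * N)) + lam ^ 2 * ν ^ 2 * N / 2 ≤ -y →
      min (ENNReal.ofReal (r ^ 2 * N) / ENNReal.ofReal (2 * ν ^ 2))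
        (ENNReal.ofReal (r * N) / ENNReal.ofReal (2 * b)) ≤ ENNReal.ofReal y →
      a ≤ ENNReal.ofReal (subexpTail r N ν b) * c := by
    intro lam y h0 h1 hy h2 h3
    refine (h lam h0 h1).trans ?_
    gcongr
    exact (Real.exp_le_exp.2 h2).trans (exp_neg_le_expNeg hy h3)
  rcases (mul_nonneg hr hN).eq_or_lt with hrN | hrN
  · refine key 0 0 le_rfl (by simp) le_rfl (by simp) ?_
    refine (min_le_right _ _).trans ?_
    rw [← hrN]; simp
  · have hr' : 0 < r := lt_of_le_of_ne hr fun h => by rw [← h] at hrN; simp at hrN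
    have hN' : 0 < N := lt_of_le_of_ne hN fun h => by rw [← h] at hrN; simp at hrN
    rcases le_or_gt (r * b) (ν ^ 2) with hbν | hbν
    · rcases hν.eq_or_lt with hν0 | hν0
      · -- here `ν = b = 0`, all `lam` are admissible, and the tail vanishes
        have hb0 : b = 0 := by
          rw [← hν0] at hbν
          have : r * b = 0 := le_antisymm (by simpa using hbν) (by positivity)
          exact (mul_eq_zero.1 this).resolve_left hr'.ne'
        have hlim : Filter.Tendsto (fun lam : ℝ => ENNReal.ofReal (Real.exp (-(lam * (r * N)))) * c)
            Filter.atTop (nhds (ENNReal.ofReal 0 * c)) := by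
          refine ENNReal.Tendsto.mul_const ?_ (Or.inr hc)
          refine ENNReal.tendsto_ofReal (Real.tendsto_exp_neg_atTop_nhds_zero.comp ?_)
          exact Filter.tendsto_id.atTop_mul_const hrN
        refine (ge_of_tendsto hlim ?_).trans (by simp)
        filter_upwards [Filter.eventually_ge_atTop 0] with lam hlam
        simpa [← hν0] using h lam hlam (by simp [hb0])
      · refine key (r / ν ^ 2) (r ^ 2 * N / (2 * ν ^ 2)) (by positivity) ?_ (by positivity) ?_ ?_
        · rw [div_mul_eq_mul_div]; exact div_le_one_of_le₀ hbν (by positivity)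
        · apply le_of_eq; field_simp; ring
        · refine (min_le_left _ _).trans_eq ?_
          rw [ENNReal.ofReal_div_of_pos (by positivity)]
    · have hb0 : 0 < b := by
        refine lt_of_le_of_ne hb fun h => ?_
        rw [← h] at hbν
        nlinarith
      refine key (1 / b) (r * N / (2 * b)) (by positivity) ?_ (by positivity) ?_ ?_
      · field_simp; exact le_rfl
      · have h1 : (1 / b) ^ 2 * ν ^ 2 * N / 2 ≤ (1 / b) ^ 2 * (r * b) * N / 2 := by gcongr
        have h2 : (1 / b) ^ 2 * (r * b) * N / 2 = 1 / b * (r * N) - r * N / (2 * b) := by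
          field_simp; ring
        linarith
      · refine (min_le_right _ _).trans_eq ?_
        rw [ENNReal.ofReal_div_of_pos (by positivity)]

/-- The tail bound for sums of conditionally sub-exponential variables. -/
theorem measure_sum_ge_le_subexpTail {W : ℕ → Ω → ℝ} {ν b s : ℝ}
    (hW : ∀ k, Measurable[ℱ (k + 1)] (W k)) (hν : 0 ≤ ν) (hb : 0 ≤ b) (hs : 0 ≤ s)
    (h : ∀ k (V : Ω → ℝ≥0∞), Measurable[ℱ k] V → ∀ lam : ℝ, 0 ≤ lam → lam * b ≤ 1 →
      ∫⁻ ω, V ω * ENNReal.ofReal (Real.exp (lam * W k ω)) ∂μ ≤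
        ENNReal.ofReal (Real.exp (lam ^ 2 * ν ^ 2 / 2)) * ∫⁻ ω, V ω ∂μ) (t : ℕ) :
    μ {ω | s * t ≤ ∑ k ∈ Finset.range t, W k ω} ≤ ENNReal.ofReal (subexpTail s t ν b) := by
  rw [← mul_one (ENNReal.ofReal (subexpTail s t ν b))]
  refine le_subexpTail_mul hs t.cast_nonneg hν hb ENNReal.one_ne_top fun lam hlam hlamb => ?_
  rw [mul_one]
  have hW' : ∀ k, Measurable[ℱ (k + 1)] (fun ω => lam * W k ω) := fun k => (hW k).const_mul lam
  have h1 := lintegral_exp_sum_le (μ := μ) (W := fun k ω => lam * W k ω)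
    (K := ENNReal.ofReal (Real.exp (lam ^ 2 * ν ^ 2 / 2)))
    (fun j => h j _ (measurable_exp_sum hW' j) lam hlam hlamb) t
  rw [← ENNReal.ofReal_pow (Real.exp_pos _).le, ← Real.exp_nat_mul] at h1
  have h2 := measure_le_of_lintegral_exp_le (a := lam * (s * t))
    (Finset.measurable_fun_sum _ fun k _ => (hW' k).mono (ℱ.le _) le_rfl) h1
  have e : t * (lam ^ 2 * ν ^ 2 / 2) - lam * (s * t) =
      -(lam * (s * t)) + lam ^ 2 * ν ^ 2 * t / 2 := by ring
  rw [e] at h2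
  refine (measure_mono fun ω hω => ?_).trans h2
  simp only [Set.mem_ofPred_eq, ← Finset.mul_sum] at hω ⊢
  exact mul_le_mul_of_nonneg_left hω hlam

end Tail

/-! ### Measurability of the process -/

section Measurability

theorem measurable_ringInverse {R : Type*} [NormedRing R] [CompleteSpace R] [MeasurableSpace R]
    [BorelSpace R] : Measurable (Ring.inverse : R → R) := by
  classical
  have hopen : IsOpen {x : R | IsUnit x} := Units.isOpen
  have h1 : ContinuousOn (Ring.inverse : R → R) {x : R | IsUnit x} := by
    rintro x ⟨y, rfl⟩
    exact (NormedRing.inverse_continuousAt y).continuousWithinAt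
  have h2 : ContinuousOn (fun _ : R => (0 : R)) {x : R | IsUnit x}ᶜ := continuousOn_const
  have h3 := h1.measurable_piecewise h2 hopen.measurableSet
  convert h3 using 1
  ext x
  by_cases hx : IsUnit x
  · rw [Set.piecewise_eq_of_mem _ _ _ (show x ∈ {x : R | IsUnit x} from hx)]
  · rw [Set.piecewise_eq_of_notMem _ _ _ (show x ∉ {x : R | IsUnit x} from hx),
      Ring.inverse_non_unit _ hx]

theorem measurable_inverse_apply {E : Type*} [NormedAddCommGroup E] [NormedSpace ℝ E]
    [FiniteDimensional ℝ E] [MeasurableSpace E] [BorelSpace E] {β : Type*} {mβ : MeasurableSpace β}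
    {A : β → E →L[ℝ] E} {v : β → E} (hA : Measurable A) (hv : Measurable v) :
    Measurable fun b => (A b).inverse (v b) := by
  have : CompleteSpace E := FiniteDimensional.complete ℝ E
  have : SecondCountableTopologyEither (E →L[ℝ] E) E := by
    have := FiniteDimensional.proper ℝ E
    infer_instance
  have h1 := measurable_ringInverse.comp hA
  rw [ContinuousLinearMap.ringInverse_eq_inverse] at h1
  exact (ContinuousLinearMap.measurable_apply₂ (𝕜 := ℝ) (E := E) (F := E)).comp (h1.prodMk hv)

theorem continuous_kkt {n m : ℕ} :
    Continuous fun q : (Vec n →L[ℝ] Vec n) × (Vec n →L[ℝ] Vec m) => kkt q.1 q.2 := by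
  have e : (fun q : (Vec n →L[ℝ] Vec n) × (Vec n →L[ℝ] Vec m) => kkt q.1 q.2) = fun q =>
      (ContinuousLinearMap.inl ℝ (Vec n) (Vec m)).comp
        (q.1.comp (ContinuousLinearMap.fst ℝ (Vec n) (Vec m)) +
          (ContinuousLinearMap.adjoint q.2).comp (ContinuousLinearMap.snd ℝ (Vec n) (Vec m))) +
      (ContinuousLinearMap.inr ℝ (Vec n) (Vec m)).comp
        (q.2.comp (ContinuousLinearMap.fst ℝ (Vec n) (Vec m))) := by
    ext q z <;> simp [kkt]
  rw [e]
  have h1 : Continuous fun q : (Vec n →L[ℝ] Vec n) × (Vec n →L[ℝ] Vec m) =>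
      ContinuousLinearMap.adjoint q.2 :=
    (ContinuousLinearMap.adjoint : (Vec n →L[ℝ] Vec m) ≃ₗᵢ⋆[ℝ] (Vec m →L[ℝ] Vec n)).continuous.comp
      continuous_snd
  exact (continuous_const.clm_comp ((continuous_fst.clm_comp continuous_const).add
    (h1.clm_comp continuous_const))).add
    (continuous_const.clm_comp (continuous_snd.clm_comp continuous_const))

variable {β : Type*} {mβ : MeasurableSpace β} {n m : ℕ}

theorem measurable_sqpSolution {H : β → Vec n →L[ℝ] Vec n} {J : β → Vec n →L[ℝ] Vec m}
    {g : β → Vec n} {c : β → Vec m} (hH : Measurable H) (hJ : Measurable J) (hg : Measurable g)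
    (hc : Measurable c) : Measurable fun b => sqpSolution (H b) (J b) (g b) (c b) := by
  have h1 : Measurable fun b => kkt (H b) (J b) :=
    Measurable.comp (g := fun q : (Vec n →L[ℝ] Vec n) × (Vec n →L[ℝ] Vec m) => kkt q.1 q.2)
      (f := fun b => (H b, J b)) continuous_kkt.measurable (hH.prodMk hJ)
  exact measurable_inverse_apply h1 (hg.neg.prodMk hc.neg)

/-- A random state is measurable if its components are. -/
structure MeasurableState {β : Type*} {n : ℕ} (mβ : MeasurableSpace β) (S : β → State n) :
    Prop where
  x : Measurable fun b => (S b).x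
  α : Measurable fun b => (S b).α
  τ : Measurable fun b => (S b).τ

variable {P : Problem n m} {X : Set (Vec n)} {L : ℝ} {Lc : Fin m → ℝ} {prm : Params n}
  {S : β → State n} {H : β → Vec n →L[ℝ] Vec n} {g : β → Vec n} {τ f0 fp : β → ℝ} {d : β → Vec n}
  {x : β → Vec n}

theorem Problem.Regular.continuous_jac (hP : P.Regular X L Lc) : Continuous P.jac :=
  hP.c_contDiff.continuous_fderiv one_ne_zero

theorem Problem.Regular.continuous_gradient (hP : P.Regular X L Lc) :
    Continuous (gradient P.f) :=
  (InnerProductSpace.toDual ℝ (Vec n)).symm.continuous.comp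
    (hP.f_contDiff.continuous_fderiv one_ne_zero)

theorem measurable_l1norm {c : β → Vec m} (hc : Measurable c) :
    Measurable fun b => l1norm (c b) := by
  have : Continuous fun v : Vec m => l1norm v := by
    unfold l1norm
    fun_prop
  exact this.measurable.comp hc

theorem Problem.Regular.measurable_stepDir (hP : P.Regular X L Lc) (hS : MeasurableState mβ S)
    (hH : Measurable H) (hg : Measurable g) : Measurable fun b => stepDir P (S b) (H b) (g b) :=
  (measurable_sqpSolution hH (hP.continuous_jac.measurable.comp hS.x) hg
    (hP.c_contDiff.continuous.measurable.comp hS.x)).fst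

theorem measurable_meritUpdate {σ ετ : ℝ} {c : β → Vec m} (hτ : Measurable τ) (hH : Measurable H)
    (hg : Measurable g) (hd : Measurable d) (hc : Measurable c) :
    Measurable fun b => meritUpdate σ ετ (τ b) (H b) (g b) (d b) (c b) := by
  have hHd : Measurable fun b => H b (d b) :=
    (isBoundedBilinearMap_apply (𝕜 := ℝ) (E := Vec n) (F := Vec n)).continuous.measurable.comp
      (hH.prodMk hd)
  have hq : Measurable fun b => ⟪g b, d b⟫_ℝ + max ⟪d b, H b (d b)⟫_ℝ 0 :=
    (hg.inner hd).add ((hd.inner hHd).max measurable_const)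
  have ht : Measurable fun b =>
      (1 - σ) * l1norm (c b) / (⟪g b, d b⟫_ℝ + max ⟪d b, H b (d b)⟫_ℝ 0) :=
    ((measurable_l1norm hc).const_mul _).div hq
  unfold meritUpdate
  exact Measurable.ite ((measurableSet_le hq measurable_const).union (measurableSet_le hτ ht)) hτ
    ((hτ.const_mul _).min ht)

theorem Problem.Regular.measurable_stepTau (hP : P.Regular X L Lc) (hS : MeasurableState mβ S)
    (hH : Measurable H) (hg : Measurable g) : Measurable fun b => stepTau P prm (S b) (H b) (g b) :=
  measurable_meritUpdate hS.τ hH hg (hP.measurable_stepDir hS hH hg)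
    (hP.c_contDiff.continuous.measurable.comp hS.x)

theorem Problem.Regular.measurable_stepTrial (hP : P.Regular X L Lc) (hS : MeasurableState mβ S)
    (hH : Measurable H) (hg : Measurable g) : Measurable fun b => stepTrial P (S b) (H b) (g b) :=
  hS.x.add (hS.α.smul (hP.measurable_stepDir hS hH hg))

theorem Problem.Regular.measurable_modelReduction (hP : P.Regular X L Lc) (hx : Measurable x)
    (hτ : Measurable τ) (hg : Measurable g) (hd : Measurable d) :
    Measurable fun b => P.modelReduction (x b) (τ b) (g b) (d b) := by
  have hc : Measurable fun b => P.c (x b) := hP.c_contDiff.continuous.measurable.comp hx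
  have hf : Measurable fun b => P.f (x b) := hP.f_contDiff.continuous.measurable.comp hx
  have hJd : ∀ {d : β → Vec n}, Measurable d → Measurable fun b => P.jac (x b) (d b) := fun hd =>
    (isBoundedBilinearMap_apply (𝕜 := ℝ) (E := Vec n) (F := Vec m)).continuous.measurable.comp
      ((hP.continuous_jac.measurable.comp hx).prodMk hd)
  have hmodel : ∀ {d : β → Vec n}, Measurable d →
      Measurable fun b => P.model (x b) (τ b) (g b) (d b) := fun hd =>
    (hτ.mul (hf.add (hg.inner hd))).add (measurable_l1norm (hc.add (hJd hd)))
  exact (hmodel measurable_const).sub (hmodel hd)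

theorem Problem.Regular.measurableSet_sufficientDecrease (hP : P.Regular X L Lc) {εf : ℝ}
    (hS : MeasurableState mβ S) (hH : Measurable H) (hg : Measurable g) (hf0 : Measurable f0)
    (hfp : Measurable fp) :
    MeasurableSet {b | SufficientDecrease P prm εf (S b) (H b) (g b) (f0 b) (fp b)} := by
  have hτ := hP.measurable_stepTau (prm := prm) hS hH hg
  have hc := hP.c_contDiff.continuous.measurable
  refine measurableSet_le ((hτ.mul hfp).add (measurable_l1norm
    (hc.comp (hP.measurable_stepTrial hS hH hg)))) ?_
  exact (((hτ.mul hf0).add (measurable_l1norm (hc.comp hS.x))).sub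
    ((hS.α.mul_const _).mul (hP.measurable_modelReduction hS.x hτ hg
      (hP.measurable_stepDir hS hH hg)))).add ((hτ.const_mul 2).mul_const _)

theorem Problem.Regular.measurable_nextState (hP : P.Regular X L Lc) {εf : ℝ}
    (hS : MeasurableState mβ S) (hH : Measurable H) (hg : Measurable g) (hf0 : Measurable f0)
    (hfp : Measurable fp) :
    MeasurableState mβ fun b => nextState P prm εf (S b) (H b) (g b) (f0 b) (fp b) := by
  have hset := hP.measurableSet_sufficientDecrease (prm := prm) (εf := εf) hS hH hg hf0 hfp
  refine ⟨?_, ?_, ?_⟩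
  · simp only [nextState, apply_ite State.x]
    exact Measurable.ite hset (hP.measurable_stepTrial hS hH hg) hS.x
  · simp only [nextState, apply_ite State.α]
    exact Measurable.ite hset (measurable_const.min (hS.α.const_mul _)) (hS.α.const_mul _)
  · simp only [nextState, apply_ite State.τ, ite_self]
    exact hP.measurable_stepTau hS hH hg

variable {Ω₁ : Type w} [MeasurableSpace Ω₁]

theorem Problem.Regular.measurableSet_accurate (hP : P.Regular X L Lc) {Ω : Type u} {Ω₀ : Type v}
    {D : Inputs n Ω Ω₀ Ω₁}
    (hD : Measurable fun q : Vec n × ℝ × ℝ × (Vec n →L[ℝ] Vec n) × Ω₁ =>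
      D.gbar q.1 q.2.1 q.2.2.1 q.2.2.2.1 q.2.2.2.2) {εg κFO : ℝ} {ξ : β → Ω₁}
    (hS : MeasurableState mβ S) (hH : Measurable H) (hξ : Measurable ξ) :
    MeasurableSet {b | Accurate P prm D εg κFO (S b) (H b) (ξ b)} := by
  have hg : Measurable fun b => D.grad (S b) (H b) (ξ b) :=
    hD.comp (hS.x.prodMk (hS.α.prodMk (hS.τ.prodMk (hH.prodMk hξ))))
  refine measurableSet_le (hg.sub (hP.continuous_gradient.measurable.comp hS.x)).norm ?_
  exact measurable_const.max ((hS.α.const_mul _).mul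
    (hP.measurable_modelReduction hS.x (hP.measurable_stepTau hS hH hg) hg
      (hP.measurable_stepDir hS hH hg)).sqrt)

end Measurability

theorem MeasurableState.mono {n : ℕ} {β : Type*} {S : β → State n} {m₁ m₂ : MeasurableSpace β} (h : m₁ ≤ m₂)
    (hS : MeasurableState m₁ S) : MeasurableState m₂ S :=
  ⟨hS.x.mono h le_rfl, hS.α.mono h le_rfl, hS.τ.mono h le_rfl⟩

section Adapted

variable {n m : ℕ} {Ω : Type u} {Ω₀ : Type v} {Ω₁ : Type w} [mΩ : MeasurableSpace Ω]
  [m₀ : MeasurableSpace Ω₀] [m₁ : MeasurableSpace Ω₁] {P : Problem n m} {X : Set (Vec n)} {L : ℝ}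
  {Lc : Fin m → ℝ} {prm : Params n} {D : Inputs n Ω Ω₀ Ω₁} {μ : Measure Ω} {P₀ : Measure Ω₀}
  {P₁ : Measure Ω₁} {ℱ : Filtration ℕ mΩ} {εf : ℝ}

theorem Sampling.measurable_grad {β : Type*} {mβ : MeasurableSpace β} (hD : Sampling D μ P₀ P₁ ℱ)
    {S : β → State n} {H : β → Vec n →L[ℝ] Vec n} {ξ : β → Ω₁} (hS : MeasurableState mβ S)
    (hH : Measurable H) (hξ : Measurable ξ) : Measurable fun b => D.grad (S b) (H b) (ξ b) :=
  hD.gbar_measurable.comp (hS.x.prodMk (hS.α.prodMk (hS.τ.prodMk (hH.prodMk hξ))))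

/-- The state at the beginning of iteration `k` is known from the σ-algebra of that iteration. -/
theorem Sampling.measurableState_run (hP : P.Regular X L Lc) (hD : Sampling D μ P₀ P₁ ℱ) (k : ℕ) :
    MeasurableState (ℱ k) (run P prm εf D k) := by
  induction k with
  | zero =>
    exact ⟨measurable_const, measurable_const, measurable_const⟩
  | succ k ih =>
    have hS := ih.mono (ℱ.mono k.le_succ)
    have hH := (hD.H_measurable k).mono (ℱ.mono k.le_succ) le_rfl
    have hg := hD.measurable_grad hS hH (hD.ξ1_measurable k)
    have hf0 := hD.fbar_measurable.comp (hS.x.prodMk (hD.ξ0_measurable k))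
    have hxp := hP.measurable_stepTrial hS hH hg
    have hfp := hD.fbar_measurable.comp (hxp.prodMk (hD.ξp_measurable k))
    exact hP.measurable_nextState hS hH hg hf0 hfp

/-- The trial point of iteration `k` is known from the σ-algebra of that iteration and the
randomness of the gradient estimate. -/
theorem Sampling.measurable_xPlus (hP : P.Regular X L Lc) (hD : Sampling D μ P₀ P₁ ℱ) (k : ℕ) :
    Measurable[ℱ k ⊔ MeasurableSpace.comap (D.ξ1 k) m₁] (xPlus P prm εf D k) := by
  have hS := (hD.measurableState_run (prm := prm) (εf := εf) hP k).mono
    (le_sup_left : ℱ k ≤ ℱ k ⊔ MeasurableSpace.comap (D.ξ1 k) m₁)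
  have hH := (hD.H_measurable k).mono
    (le_sup_left : ℱ k ≤ ℱ k ⊔ MeasurableSpace.comap (D.ξ1 k) m₁) le_rfl
  have hξ : Measurable[ℱ k ⊔ MeasurableSpace.comap (D.ξ1 k) m₁] (D.ξ1 k) :=
    (comap_measurable (D.ξ1 k)).mono le_sup_right le_rfl
  have hg := hD.measurable_grad hS hH hξ
  exact hP.measurable_stepTrial hS hH hg

theorem Sampling.sup_le (hD : Sampling D μ P₀ P₁ ℱ) (k : ℕ) :
    ℱ k ⊔ MeasurableSpace.comap (D.ξ1 k) m₁ ≤ ℱ (k + 1) :=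
  _root_.sup_le (ℱ.mono k.le_succ) (hD.ξ1_measurable k).comap_le

theorem Sampling.measurable_errCur (hP : P.Regular X L Lc) (hD : Sampling D μ P₀ P₁ ℱ) (k : ℕ) :
    Measurable[ℱ (k + 1)] (errCur P prm εf D k) := by
  have hS := (hD.measurableState_run (prm := prm) (εf := εf) hP k).mono (ℱ.mono k.le_succ)
  exact continuous_abs.measurable.comp ((hD.fbar_measurable.comp (hS.x.prodMk
    (hD.ξ0_measurable k))).sub (hP.f_contDiff.continuous.measurable.comp hS.x))

theorem Sampling.measurable_errTrial (hP : P.Regular X L Lc) (hD : Sampling D μ P₀ P₁ ℱ) (k : ℕ) :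
    Measurable[ℱ (k + 1)] (errTrial P prm εf D k) := by
  have hx := (hD.measurable_xPlus (prm := prm) (εf := εf) hP k).mono (hD.sup_le k) le_rfl
  exact continuous_abs.measurable.comp ((hD.fbar_measurable.comp (hx.prodMk
    (hD.ξp_measurable k))).sub (hP.f_contDiff.continuous.measurable.comp hx))

theorem Sampling.measurableSet_accurate (hP : P.Regular X L Lc) (hD : Sampling D μ P₀ P₁ ℱ)
    {εg κFO : ℝ} (k : ℕ) :
    MeasurableSet[ℱ (k + 1)]
      {ω | Accurate P prm D εg κFO (run P prm εf D k ω) (D.H k ω) (D.ξ1 k ω)} :=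
  hP.measurableSet_accurate hD.gbar_measurable ((hD.measurableState_run hP k).mono (ℱ.mono k.le_succ))
    ((hD.H_measurable k).mono (ℱ.mono k.le_succ) le_rfl) (hD.ξ1_measurable k)

end Adapted

/-! ### Conditional bounds for the oracles -/

theorem ofReal_one_sub_ind {Ω : Type*} (S : Set Ω) (ω : Ω) :
    ENNReal.ofReal (1 - ind (ω ∈ S)) = Sᶜ.indicator 1 ω := by
  by_cases h : ω ∈ S
  · rw [ind_of_true h, Set.indicator_of_notMem (by simpa using h)]; simp
  · rw [ind_of_false h, Set.indicator_of_mem (by simpa using h)]; simp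

theorem ZerothOracle.lintegral_exp_le {n m : ℕ} {Ω : Type u} {Ω₀ : Type v} {Ω₁ : Type w}
    [MeasurableSpace Ω₀] {P : Problem n m} {X : Set (Vec n)} {D : Inputs n Ω Ω₀ Ω₁}
    {P₀ : Measure Ω₀} {εf ν b e0 lam : ℝ} (hO : ZerothOracle P D P₀ X εf ν b) {x : Vec n} (hx : x ∈ X)
    (he : meanErr P D P₀ x ≤ e0) (hlam : 0 ≤ lam) (hlamb : lam * b ≤ 1) :
    ∫⁻ ξ, ENNReal.ofReal (Real.exp (lam * (|D.fbar x ξ - P.f x| - e0))) ∂P₀ ≤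
      ENNReal.ofReal (Real.exp (lam ^ 2 * ν ^ 2 / 2)) := by
  calc ∫⁻ ξ, ENNReal.ofReal (Real.exp (lam * (|D.fbar x ξ - P.f x| - e0))) ∂P₀ ≤
        ∫⁻ ξ, ENNReal.ofReal (Real.exp (lam * (|D.fbar x ξ - P.f x| - meanErr P D P₀ x))) ∂P₀ := by
        refine lintegral_mono fun ξ => ENNReal.ofReal_le_ofReal (Real.exp_le_exp.2 ?_)
        gcongr
    _ = ENNReal.ofReal (∫ ξ, Real.exp (lam * (|D.fbar x ξ - P.f x| - meanErr P D P₀ x)) ∂P₀) :=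
        (ofReal_integral_eq_lintegral_ofReal (hO.exp_integrable x hx lam hlam hlamb)
          (Filter.Eventually.of_forall fun _ => (Real.exp_pos _).le)).symm
    _ ≤ _ := ENNReal.ofReal_le_ofReal (hO.exp_le x hx lam hlam hlamb)

section Oracle

variable {n m : ℕ} {Ω : Type u} {Ω₀ : Type v} {Ω₁ : Type w} [mΩ : MeasurableSpace Ω]
  [m₀ : MeasurableSpace Ω₀] [m₁ : MeasurableSpace Ω₁] {P : Problem n m} {X : Set (Vec n)} {L : ℝ}
  {Lc : Fin m → ℝ} {prm : Params n} {D : Inputs n Ω Ω₀ Ω₁} {μ : Measure Ω} {P₀ : Measure Ω₀}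
  {P₁ : Measure Ω₁} {ℱ : Filtration ℕ mΩ} {εf ν b εg κFO δ e0 lam : ℝ}

theorem Sampling.measurable_exp_err (hP : P.Regular X L Lc) (hD : Sampling D μ P₀ P₁ ℱ)
    (e0 lam : ℝ) : Measurable fun q : Vec n × Ω₀ =>
      ENNReal.ofReal (Real.exp (lam * (|D.fbar q.1 q.2 - P.f q.1| - e0))) := by
  have h1 : Measurable fun q : Vec n × Ω₀ => D.fbar q.1 q.2 - P.f q.1 :=
    hD.fbar_measurable.sub (hP.f_contDiff.continuous.measurable.comp measurable_fst)
  have h2 : Measurable fun q : Vec n × Ω₀ => |D.fbar q.1 q.2 - P.f q.1| :=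
    continuous_abs.measurable.comp h1
  exact ENNReal.measurable_ofReal.comp (Real.measurable_exp.comp ((h2.sub_const _).const_mul _))

/-- An iteration is true if the gradient estimate is accurate and the total error of the function
estimates is at most `2 εf`. -/
def trueSet (P : Problem n m) (prm : Params n) (εf : ℝ) (D : Inputs n Ω Ω₀ Ω₁) (εg κFO : ℝ)
    (k : ℕ) : Set Ω :=
  {ω | Accurate P prm D εg κFO (run P prm εf D k ω) (D.H k ω) (D.ξ1 k ω) ∧
    errCur P prm εf D k ω + errTrial P prm εf D k ω ≤ 2 * εf}

theorem Sampling.measurableSet_trueSet (hP : P.Regular X L Lc) (hD : Sampling D μ P₀ P₁ ℱ)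
    (k : ℕ) : MeasurableSet[ℱ (k + 1)] (trueSet P prm εf D εg κFO k) :=
  (hD.measurableSet_accurate hP k).inter (measurableSet_le
    ((hD.measurable_errCur hP k).add (hD.measurable_errTrial hP k)) measurable_const)

variable [IsProbabilityMeasure μ] {V : Ω → ℝ≥0∞} {k : ℕ}

theorem Sampling.lintegral_errCur_le (hP : P.Regular X L Lc) (hD : Sampling D μ P₀ P₁ ℱ)
    (hX : StaysIn P prm εf D X) (hO : ZerothOracle P D P₀ X εf ν b)
    (he : ∀ x ∈ X, meanErr P D P₀ x ≤ e0) (hlam : 0 ≤ lam) (hlamb : lam * b ≤ 1)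
    (hV : Measurable[ℱ k] V) :
    ∫⁻ ω, V ω * ENNReal.ofReal (Real.exp (lam * (errCur P prm εf D k ω - e0))) ∂μ ≤
      ENNReal.ofReal (Real.exp (lam ^ 2 * ν ^ 2 / 2)) * ∫⁻ ω, V ω ∂μ :=
  lintegral_mul_fresh_le (ℱ.le k) (hD.measurableState_run hP k).x
    ((hD.ξ0_measurable k).mono (ℱ.le _) le_rfl) (hD.ξ0_indep k) (hD.ξ0_law k)
    (hD.measurable_exp_err hP e0 lam) hV
    (Filter.Eventually.of_forall fun ω =>
      hO.lintegral_exp_le (hX k ω).1 (he _ (hX k ω).1) hlam hlamb)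

theorem Sampling.lintegral_errTrial_le (hP : P.Regular X L Lc) (hD : Sampling D μ P₀ P₁ ℱ)
    (hX : StaysIn P prm εf D X) (hO : ZerothOracle P D P₀ X εf ν b)
    (he : ∀ x ∈ X, meanErr P D P₀ x ≤ e0) (hlam : 0 ≤ lam) (hlamb : lam * b ≤ 1)
    (hV : Measurable[ℱ k] V) :
    ∫⁻ ω, V ω * ENNReal.ofReal (Real.exp (lam * (errTrial P prm εf D k ω - e0))) ∂μ ≤
      ENNReal.ofReal (Real.exp (lam ^ 2 * ν ^ 2 / 2)) * ∫⁻ ω, V ω ∂μ :=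
  lintegral_mul_fresh_le ((hD.sup_le k).trans (ℱ.le _)) (hD.measurable_xPlus hP k)
    ((hD.ξp_measurable k).mono (ℱ.le _) le_rfl) (hD.ξp_indep k) (hD.ξp_law k)
    (hD.measurable_exp_err hP e0 lam) (hV.mono le_sup_left le_rfl)
    (Filter.Eventually.of_forall fun ω =>
      hO.lintegral_exp_le (hX k ω).2 (he _ (hX k ω).2) hlam hlamb)

/-- The sum of the two errors of an iteration is conditionally sub-exponential with doubled
parameters. The two errors may be dependent; this is handled by the inequality
`2 exp (x + y) ≤ exp (2 x) + exp (2 y)`. -/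
theorem Sampling.lintegral_errSum_le (hP : P.Regular X L Lc) (hD : Sampling D μ P₀ P₁ ℱ)
    (hX : StaysIn P prm εf D X) (hO : ZerothOracle P D P₀ X εf ν b)
    (he : ∀ x ∈ X, meanErr P D P₀ x ≤ e0) (hlam : 0 ≤ lam) (hlamb : lam * (2 * b) ≤ 1)
    (hV : Measurable[ℱ k] V) :
    ∫⁻ ω, V ω * ENNReal.ofReal (Real.exp
        (lam * (errCur P prm εf D k ω + errTrial P prm εf D k ω - 2 * e0))) ∂μ ≤
      ENNReal.ofReal (Real.exp (lam ^ 2 * (2 * ν) ^ 2 / 2)) * ∫⁻ ω, V ω ∂μ := by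
  have h1 := hD.lintegral_errCur_le hP hX hO he (lam := 2 * lam) (by linarith) (by linarith) hV
  have h2 := hD.lintegral_errTrial_le hP hX hO he (lam := 2 * lam) (by linarith) (by linarith) hV
  have hV' : Measurable V := hV.mono (ℱ.le k) le_rfl
  have hm : Measurable (errCur P prm εf D k) :=
    (hD.measurable_errCur hP k).mono (ℱ.le _) le_rfl
  have e : (2 * lam) ^ 2 * ν ^ 2 / 2 = lam ^ 2 * (2 * ν) ^ 2 / 2 := by ring
  rw [e] at h1 h2
  have hpt : ∀ ω, V ω * ENNReal.ofReal (Real.exp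
      (lam * (errCur P prm εf D k ω + errTrial P prm εf D k ω - 2 * e0))) ≤ ENNReal.ofReal (1 / 2) *
      (V ω * ENNReal.ofReal (Real.exp (2 * lam * (errCur P prm εf D k ω - e0))) +
        V ω * ENNReal.ofReal (Real.exp (2 * lam * (errTrial P prm εf D k ω - e0)))) := by
    intro ω
    rw [← mul_add, ← mul_assoc, mul_comm (ENNReal.ofReal (1 / 2)), mul_assoc,
      ← ENNReal.ofReal_add (Real.exp_pos _).le (Real.exp_pos _).le,
      ← ENNReal.ofReal_mul (by norm_num)]
    gcongr
    set x := lam * (errCur P prm εf D k ω - e0) with hx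
    set y := lam * (errTrial P prm εf D k ω - e0) with hy
    rw [show lam * (errCur P prm εf D k ω + errTrial P prm εf D k ω - 2 * e0) = x + y by
        rw [hx, hy]; ring,
      show 2 * lam * (errCur P prm εf D k ω - e0) = x + x by rw [hx]; ring,
      show 2 * lam * (errTrial P prm εf D k ω - e0) = y + y by rw [hy]; ring,
      Real.exp_add, Real.exp_add, Real.exp_add]
    nlinarith [sq_nonneg (Real.exp x - Real.exp y)]
  refine (lintegral_mono hpt).trans ?_
  have hm' : Measurable fun ω => V ω *
      ENNReal.ofReal (Real.exp (2 * lam * (errCur P prm εf D k ω - e0))) :=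
    hV'.mul (ENNReal.measurable_ofReal.comp
      (Real.measurable_exp.comp ((hm.sub_const _).const_mul _)))
  rw [lintegral_const_mul' _ _ ENNReal.ofReal_ne_top, lintegral_add_left hm']
  calc ENNReal.ofReal (1 / 2) * _ ≤ ENNReal.ofReal (1 / 2) *
        (ENNReal.ofReal (Real.exp (lam ^ 2 * (2 * ν) ^ 2 / 2)) * ∫⁻ ω, V ω ∂μ +
          ENNReal.ofReal (Real.exp (lam ^ 2 * (2 * ν) ^ 2 / 2)) * ∫⁻ ω, V ω ∂μ) := by gcongr
    _ = ENNReal.ofReal (1 / 2) * 2 *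
        (ENNReal.ofReal (Real.exp (lam ^ 2 * (2 * ν) ^ 2 / 2)) * ∫⁻ ω, V ω ∂μ) := by ring
    _ = _ := by
        rw [show (2 : ℝ≥0∞) = ENNReal.ofReal 2 by simp, ← ENNReal.ofReal_mul (by norm_num)]
        norm_num

theorem Sampling.lintegral_noise_le (hP : P.Regular X L Lc) (hD : Sampling D μ P₀ P₁ ℱ)
    (hX : StaysIn P prm εf D X) (hO : ZerothOracle P D P₀ X εf ν b)
    (hV : Measurable[ℱ k] V) (hV1 : ∀ ω, V ω ≤ 1) :
    ∫⁻ ω, V ω * ENNReal.ofReal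
        (1 - ind (errCur P prm εf D k ω + errTrial P prm εf D k ω ≤ 2 * εf)) ∂μ ≤
      ENNReal.ofReal (subexpTail (noiseGap P D P₀ X εf) 1 ν b) * ∫⁻ ω, V ω ∂μ := by
  set r := noiseGap P D P₀ X εf with hr
  have hbdd : BddBelow (Set.range fun x : X => εf - meanErr P D P₀ x) :=
    ⟨0, by rintro _ ⟨x, rfl⟩; exact sub_nonneg.2 (hO.mean_le x x.2)⟩
  have he : ∀ x ∈ X, meanErr P D P₀ x ≤ εf - r := by
    intro x hx
    have : r ≤ εf - meanErr P D P₀ x := ciInf_le hbdd (⟨x, hx⟩ : X)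
    linarith
  have hr0 : 0 ≤ r := Real.iInf_nonneg fun x => sub_nonneg.2 (hO.mean_le x x.2)
  refine le_subexpTail_mul hr0 zero_le_one hO.ν_nonneg hO.b_nonneg ?_ fun lam hlam hlamb => ?_
  · refine ne_top_of_le_ne_top ENNReal.one_ne_top ((lintegral_mono hV1).trans ?_)
    simp
  -- exponential Markov inequality with the parameter `lam / 2` for the sum of the two errors
  have h1 := hD.lintegral_errSum_le (prm := prm) hP hX hO he (lam := lam / 2) (by linarith)
    (by linarith) hV
  have hpt : ∀ ω, V ω * ENNReal.ofReal
      (1 - ind (errCur P prm εf D k ω + errTrial P prm εf D k ω ≤ 2 * εf)) ≤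
      ENNReal.ofReal (Real.exp (-(lam * r))) * (V ω * ENNReal.ofReal (Real.exp (lam / 2 *
        (errCur P prm εf D k ω + errTrial P prm εf D k ω - 2 * (εf - r))))) := by
    intro ω
    rw [← mul_assoc, mul_comm (ENNReal.ofReal (Real.exp (-(lam * r)))), mul_assoc,
      ← ENNReal.ofReal_mul (Real.exp_pos _).le, ← Real.exp_add]
    gcongr
    by_cases h : errCur P prm εf D k ω + errTrial P prm εf D k ω ≤ 2 * εf
    · rw [ind_of_true h, sub_self]; exact (Real.exp_pos _).le
    · rw [ind_of_false h, sub_zero, Real.one_le_exp_iff]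
      push Not at h
      have h2 : 0 ≤ lam / 2 * (errCur P prm εf D k ω + errTrial P prm εf D k ω - 2 * εf) :=
        mul_nonneg (by linarith) (by linarith)
      linarith
  refine (lintegral_mono hpt).trans ?_
  rw [lintegral_const_mul' _ _ ENNReal.ofReal_ne_top]
  refine (mul_le_mul_right h1 _).trans_eq ?_
  rw [← mul_assoc, ← ENNReal.ofReal_mul (Real.exp_pos _).le, ← Real.exp_add]
  congr 3
  ring

theorem FirstOrderOracle.lintegral_inaccurate_le [IsProbabilityMeasure P₁] (hP : P.Regular X L Lc)
    (hD : Sampling D μ P₀ P₁ ℱ) (hF : FirstOrderOracle P prm εf D μ P₁ εg κFO δ)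
    (hV : Measurable[ℱ k] V) :
    ∫⁻ ω, V ω * ENNReal.ofReal
        (1 - ind (Accurate P prm D εg κFO (run P prm εf D k ω) (D.H k ω) (D.ξ1 k ω))) ∂μ ≤
      ENNReal.ofReal δ * ∫⁻ ω, V ω ∂μ := by
  have hS := hD.measurableState_run (prm := prm) (εf := εf) hP k
  have hset : MeasurableSet {q : (Vec n × ℝ × ℝ × (Vec n →L[ℝ] Vec n)) × Ω₁ |
      Accurate P prm D εg κFO ⟨q.1.1, q.1.2.1, q.1.2.2.1⟩ q.1.2.2.2 q.2} :=
    hP.measurableSet_accurate hD.gbar_measurable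
      ⟨measurable_fst.fst, measurable_fst.snd.fst, measurable_fst.snd.snd.fst⟩
      measurable_fst.snd.snd.snd measurable_snd
  refine lintegral_mul_fresh_le (ℱ.le k)
    (U := fun ω => ((run P prm εf D k ω).x, (run P prm εf D k ω).α, (run P prm εf D k ω).τ,
      D.H k ω))
    (hS.x.prodMk (hS.α.prodMk (hS.τ.prodMk (hD.H_measurable k))))
    ((hD.ξ1_measurable k).mono (ℱ.le _) le_rfl) (hD.ξ1_indep k) (hD.ξ1_law k)
    (Ψ := fun q => ENNReal.ofReal
      (1 - ind (Accurate P prm D εg κFO ⟨q.1.1, q.1.2.1, q.1.2.2.1⟩ q.1.2.2.2 q.2)))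
    (ENNReal.measurable_ofReal.comp (measurable_const.sub (measurable_ind hset))) hV ?_
  filter_upwards [hF.accurate k] with ω hω
  set A : Set Ω₁ := {ξ | Accurate P prm D εg κFO (run P prm εf D k ω) (D.H k ω) ξ} with hA
  have hAm : MeasurableSet A := by
    have h1 : Measurable fun ξ : Ω₁ => (((run P prm εf D k ω).x, (run P prm εf D k ω).α,
      (run P prm εf D k ω).τ, D.H k ω), ξ) := measurable_prodMk_left
    exact h1 hset
  calc ∫⁻ ξ, ENNReal.ofReal (1 - ind (ξ ∈ A)) ∂P₁ = P₁ Aᶜ := by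
        simp only [ofReal_one_sub_ind]
        rw [lintegral_indicator_one hAm.compl]
    _ = ENNReal.ofReal (P₁.real Aᶜ) := by simp
    _ ≤ ENNReal.ofReal δ := by
        apply ENNReal.ofReal_le_ofReal
        rw [probReal_compl_eq_one_sub hAm]
        linarith

/-- Every iteration is true with conditional probability at least `p`. -/
theorem Sampling.lintegral_not_true_le [IsProbabilityMeasure P₁] (hP : P.Regular X L Lc)
    (hD : Sampling D μ P₀ P₁ ℱ) (hX : StaysIn P prm εf D X)
    (hO : ZerothOracle P D P₀ X εf ν b) (hF : FirstOrderOracle P prm εf D μ P₁ εg κFO δ) {p : ℝ}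
    (hp : (BoundedNoise P prm εf D μ ∧ p = 1 - δ) ∨
      (IndependentNoise P prm εf D μ ∧ p = 1 - δ - subexpTail (noiseGap P D P₀ X εf) 1 ν b))
    (hV : Measurable[ℱ k] V) (hV1 : ∀ ω, V ω ≤ 1) :
    ∫⁻ ω, V ω * ENNReal.ofReal (1 - ind (ω ∈ trueSet P prm εf D εg κFO k)) ∂μ ≤
      ENNReal.ofReal (1 - p) * ∫⁻ ω, V ω ∂μ := by
  have hV' : Measurable V := hV.mono (ℱ.le k) le_rfl
  have h1 := hF.lintegral_inaccurate_le hP hD hV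
  have hacc : Measurable fun ω => V ω * ENNReal.ofReal
      (1 - ind (Accurate P prm D εg κFO (run P prm εf D k ω) (D.H k ω) (D.ξ1 k ω))) := by
    have h2 : MeasurableSet
        {ω | Accurate P prm D εg κFO (run P prm εf D k ω) (D.H k ω) (D.ξ1 k ω)} :=
      ℱ.le (k + 1) _ (hD.measurableSet_accurate hP k)
    exact hV'.mul (ENNReal.measurable_ofReal.comp (measurable_const.sub (measurable_ind h2)))
  have hpt : ∀ ω, V ω * ENNReal.ofReal (1 - ind (ω ∈ trueSet P prm εf D εg κFO k)) ≤
      V ω * ENNReal.ofReal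
        (1 - ind (Accurate P prm D εg κFO (run P prm εf D k ω) (D.H k ω) (D.ξ1 k ω))) +
      V ω * ENNReal.ofReal
        (1 - ind (errCur P prm εf D k ω + errTrial P prm εf D k ω ≤ 2 * εf)) := by
    intro ω
    rw [← mul_add]
    gcongr
    by_cases ha : Accurate P prm D εg κFO (run P prm εf D k ω) (D.H k ω) (D.ξ1 k ω)
    · by_cases he : errCur P prm εf D k ω + errTrial P prm εf D k ω ≤ 2 * εf
      · rw [ind_of_true (show ω ∈ trueSet P prm εf D εg κFO k from ⟨ha, he⟩)]; simp
      · rw [ind_of_false he]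
        refine le_add_left (ENNReal.ofReal_le_ofReal ?_)
        linarith [ind_nonneg (ω ∈ trueSet P prm εf D εg κFO k)]
    · rw [ind_of_false ha]
      refine le_add_right (ENNReal.ofReal_le_ofReal ?_)
      linarith [ind_nonneg (ω ∈ trueSet P prm εf D εg κFO k)]
  refine (lintegral_mono hpt).trans ?_
  rw [lintegral_add_left hacc]
  rcases hp with ⟨hB, rfl⟩ | ⟨-, rfl⟩
  · have h0 : ∫⁻ ω, V ω * ENNReal.ofReal
        (1 - ind (errCur P prm εf D k ω + errTrial P prm εf D k ω ≤ 2 * εf)) ∂μ = 0 := by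
      rw [← lintegral_zero (μ := μ)]
      refine lintegral_congr_ae ?_
      filter_upwards [hB k] with ω hω
      rw [ind_of_true (by linarith [hω.1, hω.2])]
      simp
    rw [h0, add_zero, sub_sub_cancel]
    exact h1
  · have h2 := hD.lintegral_noise_le (prm := prm) hP hX hO hV hV1
    have e : 1 - (1 - δ - subexpTail (noiseGap P D P₀ X εf) 1 ν b) =
        δ + subexpTail (noiseGap P D P₀ X εf) 1 ν b := by ring
    rw [e, ENNReal.ofReal_add hF.δ_nonneg (subexpTail_nonneg _ _ _ _), add_mul]
    exact add_le_add h1 h2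

/-- The tail bound for the total error of the function estimates, weighted by an upper bound `τ` of
the merit parameter. -/
theorem Sampling.measure_errSum_ge_le (hP : P.Regular X L Lc) (hD : Sampling D μ P₀ P₁ ℱ)
    (hX : StaysIn P prm εf D X) (hO : ZerothOracle P D P₀ X εf ν b) {τ s : ℝ} (hτ : 0 < τ)
    (hs : 0 ≤ s) (t : ℕ) :
    μ {ω | s * t ≤ ∑ k ∈ Finset.range t,
        τ * (errCur P prm εf D k ω + errTrial P prm εf D k ω - 2 * εf)} ≤
      ENNReal.ofReal (subexpTail s t (2 * τ * ν) (2 * τ * b)) := by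
  have hν := hO.ν_nonneg
  have hb := hO.b_nonneg
  refine measure_sum_ge_le_subexpTail (ℱ := ℱ) (fun k => ?_) (by positivity) (by positivity) hs
    (fun k V hV lam hlam hlamb => ?_) t
  · exact (((hD.measurable_errCur hP k).add (hD.measurable_errTrial hP k)).sub_const _).const_mul τ
  · have h1 := hD.lintegral_errSum_le (prm := prm) hP hX hO hO.mean_le (lam := lam * τ)
      (by positivity) (by linarith) hV
    have e : (lam * τ) ^ 2 * (2 * ν) ^ 2 / 2 = lam ^ 2 * (2 * τ * ν) ^ 2 / 2 := by ring
    rw [e] at h1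
    simpa only [mul_assoc] using h1

end Oracle

/-! ### Decrease of the measure of progress along a run -/

namespace Consts

variable {C : Consts}

theorem Valid.minRatio_mul_le_of_abs (hC : C.Valid) {η Δ Δ' : ℝ} (hΔ : 0 ≤ Δ)
    (h : (1 - η * C.ω5 η) * Δ ≤ (1 + C.ετ * C.ω2) * Δ' ∨ (1 - η * C.ω6 η) * Δ ≤ Δ') :
    C.minRatio η * Δ ≤ Δ' := by
  have := hC.ετ.1; have := hC.ω2_pos
  rcases h with h | h
  · have h1 : C.minRatio η ≤ (1 - η * C.ω5 η) / (1 + C.ετ * C.ω2) :=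
      (min_le_left _ _).trans (min_le_left _ _)
    refine (mul_le_mul_of_nonneg_right h1 hΔ).trans ?_
    rw [div_mul_eq_mul_div, div_le_iff₀ (by positivity)]
    linarith
  · have h1 : C.minRatio η ≤ 1 - η * C.ω6 η := (min_le_left _ _).trans (min_le_right _ _)
    exact (mul_le_mul_of_nonneg_right h1 hΔ).trans h

theorem Valid.sqrt_le_absRatio_mul (hC : C.Valid) {η Δ Δ' : ℝ} (hη : C.EtaAdmissible η)
    (h : (1 - η * C.ω5 η) * Δ ≤ (1 + C.ετ * C.ω2) * Δ' ∨ (1 - η * C.ω6 η) * Δ ≤ Δ') :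
    √Δ ≤ C.absRatio η * √Δ' := by
  have h5 := hC.one_sub_ω5_pos hη
  have h6 := hC.one_sub_ω6_pos hη
  have := hC.ετ.1; have := hC.ω2_pos
  rcases h with h | h
  · calc √Δ ≤ √((1 + C.ετ * C.ω2) / (1 - η * C.ω5 η) * Δ') := by
          apply Real.sqrt_le_sqrt
          rw [div_mul_eq_mul_div, le_div_iff₀ h5]
          linarith
      _ = √((1 + C.ετ * C.ω2) / (1 - η * C.ω5 η)) * √Δ' := Real.sqrt_mul (by positivity) _
      _ ≤ _ := by gcongr; exact le_max_left _ _
  · calc √Δ ≤ √(1 / (1 - η * C.ω6 η) * Δ') := by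
          apply Real.sqrt_le_sqrt
          rw [div_mul_eq_mul_div, le_div_iff₀ h6]
          linarith
      _ = 1 / √(1 - η * C.ω6 η) * √Δ' := by
          rw [Real.sqrt_mul (by positivity), Real.sqrt_div zero_le_one, Real.sqrt_one]
      _ ≤ _ := by gcongr; exact le_max_right _ _

theorem Valid.minRatio_mul_le_of_rel (hC : C.Valid) {η Δ Δ' : ℝ} (hΔ : 0 ≤ Δ)
    (h : Δ ≤ (1 + C.ω3 + C.ω4) * Δ') : C.minRatio η * Δ ≤ Δ' := by
  have := hC.ω3_nonneg; have := hC.ω4_nonneg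
  have h1 : C.minRatio η ≤ 1 / (1 + C.ω3 + C.ω4) := min_le_right _ _
  refine (mul_le_mul_of_nonneg_right h1 hΔ).trans ?_
  rw [div_mul_eq_mul_div, div_le_iff₀ (by positivity)]
  linarith

end Consts

section Run

variable {n m : ℕ} {Ω : Type u} {Ω₀ : Type v} {Ω₁ : Type w} {P : Problem n m} {X : Set (Vec n)}
  {L : ℝ} {Lc : Fin m → ℝ} {prm : Params n} {D : Inputs n Ω Ω₀ Ω₁}
  {εf κH ζ κ τbmin : ℝ}

/-- The iteration is successful. -/
def Successful (P : Problem n m) (prm : Params n) (εf : ℝ) (D : Inputs n Ω Ω₀ Ω₁) (k : ℕ)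
    (ω : Ω) : Prop :=
  SufficientDecrease P prm εf (run P prm εf D k ω) (D.H k ω) (gBar P prm εf D k ω)
    (D.fbar (run P prm εf D k ω).x (D.ξ0 k ω)) (D.fbar (xPlus P prm εf D k ω) (D.ξp k ω))

theorem run_succ_of_successful {k : ℕ} {ω : Ω} (h : Successful P prm εf D k ω) :
    run P prm εf D (k + 1) ω = ⟨xPlus P prm εf D k ω,
      min prm.αmax (prm.γ⁻¹ * (run P prm εf D k ω).α), tauBar P prm εf D k ω⟩ :=
  if_pos h

theorem run_succ_of_not_successful {k : ℕ} {ω : Ω} (h : ¬ Successful P prm εf D k ω) :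
    run P prm εf D (k + 1) ω = ⟨(run P prm εf D k ω).x,
      prm.γ * (run P prm εf D k ω).α, tauBar P prm εf D k ω⟩ :=
  if_neg h

theorem run_succ_τ (k : ℕ) (ω : Ω) : (run P prm εf D (k + 1) ω).τ = tauBar P prm εf D k ω := by
  by_cases h : Successful P prm εf D k ω
  · rw [run_succ_of_successful h]
  · rw [run_succ_of_not_successful h]

theorem run_α_mem (k : ℕ) (ω : Ω) : (run P prm εf D k ω).α ∈ Set.Ioc (0 : ℝ) prm.αmax := by
  have hγ := prm.γ_mem
  induction k with
  | zero => exact prm.α0_mem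
  | succ k ih =>
    by_cases h : Successful P prm εf D k ω
    · rw [run_succ_of_successful h]
      exact ⟨lt_min prm.αmax_mem.1 (mul_pos (inv_pos.2 hγ.1) ih.1), min_le_left _ _⟩
    · rw [run_succ_of_not_successful h]
      refine ⟨mul_pos hγ.1 ih.1, (mul_le_of_le_one_left ih.1.le hγ.2.le).trans ih.2⟩

theorem run_τ_pos (hτbmin : 0 < τbmin) (hτ : ∀ k ω, τbmin ≤ tauBar P prm εf D k ω) (k : ℕ)
    (ω : Ω) : 0 < (run P prm εf D k ω).τ := by
  cases k with
  | zero => exact prm.τinit_pos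
  | succ k => rw [run_succ_τ]; exact hτbmin.trans_le (hτ k ω)

theorem tauBar_le_run_τ (hτbmin : 0 < τbmin) (hτ : ∀ k ω, τbmin ≤ tauBar P prm εf D k ω) (k : ℕ)
    (ω : Ω) : tauBar P prm εf D k ω ≤ (run P prm εf D k ω).τ :=
  meritUpdate_le prm.ετ_mem (run_τ_pos hτbmin hτ k ω)

theorem tauBar_succ_le (hτbmin : 0 < τbmin) (hτ : ∀ k ω, τbmin ≤ tauBar P prm εf D k ω) (k : ℕ)
    (ω : Ω) : tauBar P prm εf D (k + 1) ω ≤ tauBar P prm εf D k ω :=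
  (tauBar_le_run_τ hτbmin hτ (k + 1) ω).trans_eq (run_succ_τ k ω)

theorem tauBar_le_τinit (hτbmin : 0 < τbmin) (hτ : ∀ k ω, τbmin ≤ tauBar P prm εf D k ω) (k : ℕ)
    (ω : Ω) : tauBar P prm εf D k ω ≤ prm.τinit := by
  induction k with
  | zero => exact tauBar_le_run_τ hτbmin hτ 0 ω
  | succ k ih => exact (tauBar_succ_le hτbmin hτ k ω).trans ih

theorem localBounds_run (hX : StaysIn P prm εf D X) (hH : HessianBounds P prm εf D κH ζ)
    (hκ : ∀ x ∈ X, ∀ y : Vec m, κ * ‖y‖ ≤ ‖ContinuousLinearMap.adjoint (P.jac x) y‖) (k : ℕ)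
    (ω : Ω) : LocalBounds (D.H k ω) (P.jac (run P prm εf D k ω).x) κH ζ κ :=
  ⟨(hH k ω).1, (hH k ω).2.1, (hH k ω).2.2, hκ _ (hX k ω).1⟩

/-- The constants that bound the multipliers, the deterministic merit parameters and the model
reductions, uniformly over all runs. -/
theorem exists_run_bounds (hP : P.Regular X L Lc) (hκH : 0 < κH) (hζ : 0 < ζ) (hτbmin : 0 < τbmin)
    (prm : Params n) :
    ∃ κy κs τmin : ℝ, 0 < κy ∧ 0 < κs ∧ 0 < τmin ∧ τmin ≤ prm.τinit ∧
      ∀ (Ω : Type u) (Ω₀ : Type v) (Ω₁ : Type w) (D : Inputs n Ω Ω₀ Ω₁) (εf : ℝ),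
        StaysIn P prm εf D X → HessianBounds P prm εf D κH ζ →
        (∀ k ω, τbmin ≤ tauBar P prm εf D k ω) →
        ∀ k ω, ‖(trueSolution P prm εf D k ω).2‖ ≤ κy ∧ τmin ≤ trueTau P prm εf D k ω ∧
          κs * tauBar P prm εf D k ω *
              (‖dBar P prm εf D k ω‖ ^ 2 + ‖P.c (run P prm εf D k ω).x‖) ≤
            deltaBar P prm εf D k ω ∧
          κs * trueTau P prm εf D k ω *
              (‖(trueSolution P prm εf D k ω).1‖ ^ 2 + ‖P.c (run P prm εf D k ω).x‖) ≤
            deltaTrue P prm εf D k ω := by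
  obtain ⟨κ, hκ0, hκ⟩ := hP.jac_singular_values
  obtain ⟨Kc, hKc⟩ := hP.c_bounded
  obtain ⟨Kg, hKg⟩ := hP.f_grad_bounded
  have hKc' : ∀ x ∈ X, ‖P.c x‖ ≤ |Kc| := fun x hx => (hKc x hx).trans (le_abs_self _)
  have hKg' : ∀ x ∈ X, ‖gradient P.f x‖ ≤ |Kg| := fun x hx => (hKg x hx).trans (le_abs_self _)
  obtain ⟨κy, Kq, hκy, hKq, hbd⟩ := LocalBounds.exists_bounds (n := n) (m := m) hκH hζ hκ0
    (abs_nonneg Kc) (abs_nonneg Kg)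
  obtain ⟨κs, hκs, hred⟩ := LocalBounds.exists_reduction_bound (n := n) (m := m) hκH hζ hκ0
    (abs_nonneg Kc) prm.τinit_pos prm.σ_mem
  have hετ' : 0 < 1 - prm.ετ := by linarith [prm.ετ_mem.2]
  have hσ' : 0 < 1 - prm.σ := by linarith [prm.σ_mem.2]
  refine ⟨κy, κs, min prm.τinit (min ((1 - prm.ετ) * τbmin) ((1 - prm.σ) / Kq)), hκy, hκs,
    lt_min prm.τinit_pos (lt_min (by positivity) (by positivity)), min_le_left _ _, ?_⟩
  intro Ω Ω₀ Ω₁ D εf hX hH hτ k ω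
  have hloc := localBounds_run hX hH hκ k ω
  have hx := (hX k ω).1
  have hstep : IsSQPStep (D.H k ω) (P.jac (run P prm εf D k ω).x)
      (gradient P.f (run P prm εf D k ω).x) (P.c (run P prm εf D k ω).x)
      (trueSolution P prm εf D k ω).1 (trueSolution P prm εf D k ω).2 :=
    hloc.isSQPStep hζ hκ0 _ _
  have hstep' : IsSQPStep (D.H k ω) (P.jac (run P prm εf D k ω).x)
      (gBar P prm εf D k ω) (P.c (run P prm εf D k ω).x) (dBar P prm εf D k ω) _ :=
    hloc.isSQPStep hζ hκ0 _ _
  obtain ⟨h1, h2⟩ := hbd _ _ _ _ _ _ hloc hstep (hKg' _ hx) (hKc' _ hx)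
  have hτ0 : 0 < tauBar P prm εf D k ω := hτbmin.trans_le (hτ k ω)
  have h3 : min ((1 - prm.ετ) * tauBar P prm εf D k ω) ((1 - prm.σ) / Kq) ≤
      trueTau P prm εf D k ω := le_meritUpdate prm.ετ_mem prm.σ_mem hτ0 hKq h2
  have h4 : min ((1 - prm.ετ) * τbmin) ((1 - prm.σ) / Kq) ≤ trueTau P prm εf D k ω := by
    refine le_trans ?_ h3
    gcongr
    exact hτ k ω
  have hT0 : 0 < trueTau P prm εf D k ω :=
    (lt_min (by positivity) (by positivity)).trans_le h4
  have hTle : trueTau P prm εf D k ω ≤ tauBar P prm εf D k ω := meritUpdate_le prm.ετ_mem hτ0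
  have hτi := tauBar_le_τinit hτbmin hτ k ω
  refine ⟨h1, (min_le_right _ _).trans h4, ?_, ?_⟩
  · rw [deltaBar, P.modelReduction_eq _ _ _ _ (by rw [hstep'.feas, add_neg_cancel])]
    exact hred _ _ _ _ _ _ hloc hstep'.feas (hKc' _ hx) hτ0 hτi
      (meritUpdate_mul_curvedSlope_le prm.σ_mem (run_τ_pos hτbmin hτ k ω))
  · rw [deltaTrue, P.modelReduction_eq _ _ _ _ (by rw [hstep.feas, add_neg_cancel])]
    exact hred _ _ _ _ _ _ hloc hstep.feas (hKc' _ hx) hT0 (hTle.trans hτi)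
      (meritUpdate_mul_curvedSlope_le prm.σ_mem hτ0)

/-- The hypotheses on a run under which the decrease in true iterations is shown. The bound of the
stochastic model reduction is stronger by the factor `γ⁴` than the one with the constant `κl`. -/
structure RunBounds (P : Problem n m) (prm : Params n) (εf : ℝ) (D : Inputs n Ω Ω₀ Ω₁)
    (X : Set (Vec n)) (Lc : Fin m → ℝ) (C : Consts) : Prop where
  regular : P.Regular X C.L Lc
  stays : StaysIn P prm εf D X
  hessian : HessianBounds P prm εf D C.κH C.ζ
  tau : ∀ k ω, C.τbm ≤ tauBar P prm εf D k ω
  valid : C.Valid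
  τi_eq : C.τi = prm.τinit
  αmax_eq : C.αmax = prm.αmax
  θ_eq : C.θ = prm.θ
  σ_eq : C.σ = prm.σ
  ετ_eq : C.ετ = prm.ετ
  Γ_eq : C.Γ = ∑ i, Lc i
  y_le : ∀ k ω, ‖(trueSolution P prm εf D k ω).2‖ ≤ C.κy
  τm_le : ∀ k ω, C.τm ≤ trueTau P prm εf D k ω
  le_deltaBar : ∀ k ω, C.κl * tauBar P prm εf D k ω *
      (‖dBar P prm εf D k ω‖ ^ 2 + ‖P.c (run P prm εf D k ω).x‖) ≤
        prm.γ ^ 4 * deltaBar P prm εf D k ω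
  le_deltaTrue : ∀ k ω, C.κl * trueTau P prm εf D k ω *
      (‖(trueSolution P prm εf D k ω).1‖ ^ 2 + ‖P.c (run P prm εf D k ω).x‖) ≤
        deltaTrue P prm εf D k ω

variable {C : Consts} {k : ℕ} {ω : Ω} {εg η ε : ℝ}

theorem RunBounds.tauBar_pos (h : RunBounds P prm εf D X Lc C) (k : ℕ) (ω : Ω) :
    0 < tauBar P prm εf D k ω := h.valid.τbm.trans_le (h.tau k ω)

theorem RunBounds.tauBar_le (h : RunBounds P prm εf D X Lc C) (k : ℕ) (ω : Ω) :
    tauBar P prm εf D k ω ≤ C.τi := by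
  rw [h.τi_eq]; exact tauBar_le_τinit h.valid.τbm h.tau k ω

theorem RunBounds.deltaBar_nonneg (h : RunBounds P prm εf D X Lc C) (k : ℕ) (ω : Ω) :
    0 ≤ deltaBar P prm εf D k ω := by
  have h1 := h.le_deltaBar k ω
  have h2 := h.tauBar_pos k ω
  have h3 := h.valid.κl
  have h4 : 0 < prm.γ ^ 4 := pow_pos prm.γ_mem.1 4
  have h5 : 0 ≤ C.κl * tauBar P prm εf D k ω *
      (‖dBar P prm εf D k ω‖ ^ 2 + ‖P.c (run P prm εf D k ω).x‖) := by positivity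
  exact nonneg_of_mul_nonneg_right (h5.trans h1) h4

/-- In an iteration with an accurate gradient estimate in which the target accuracy is not reached,
the stochastic model reduction is bounded below by a fixed multiple of the deterministic one, and
the gradient error is small relative to the stochastic model reduction. -/
theorem RunBounds.reduction_of_accurate (h : RunBounds P prm εf D X Lc C)
    (hη : C.EtaAdmissible η) (hε : εg / η ≤ ε) (hlt : ε < √(deltaTrue P prm εf D k ω))
    (hacc : Accurate P prm D εg C.κFO (run P prm εf D k ω) (D.H k ω) (D.ξ1 k ω)) :
    C.minRatio η * deltaTrue P prm εf D k ω ≤ deltaBar P prm εf D k ω ∧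
      (‖gBar P prm εf D k ω - gradient P.f (run P prm εf D k ω).x‖ ≤
          η * (C.absRatio η * √(deltaBar P prm εf D k ω)) ∨
        ‖gBar P prm εf D k ω - gradient P.f (run P prm εf D k ω).x‖ ≤
          C.κFO * (run P prm εf D k ω).α * √(deltaBar P prm εf D k ω)) := by
  obtain ⟨κ, hκ0, hκ⟩ := h.regular.jac_singular_values
  have hC := h.valid
  have hκH := hC.κH; have hζ := hC.ζ; have hκl := hC.κl; have hη0 := hη.1
  have hloc := localBounds_run h.stays h.hessian hκ k ω
  have hs : IsSQPStep (D.H k ω) (P.jac (run P prm εf D k ω).x)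
      (gradient P.f (run P prm εf D k ω).x) (P.c (run P prm εf D k ω).x)
      (trueSolution P prm εf D k ω).1 (trueSolution P prm εf D k ω).2 :=
    hloc.isSQPStep hζ hκ0 _ _
  have hs' : IsSQPStep (D.H k ω) (P.jac (run P prm εf D k ω).x)
      (gBar P prm εf D k ω) (P.c (run P prm εf D k ω).x) (dBar P prm εf D k ω) _ :=
    hloc.isSQPStep hζ hκ0 _ _
  have hT'0 := h.tauBar_pos k ω
  have hT' := h.tauBar_le k ω
  have hα := run_α_mem (P := P) (prm := prm) (εf := εf) (D := D) k ω
  have hΔ'0 := h.deltaBar_nonneg k ω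
  have hΔ0 : 0 ≤ deltaTrue P prm εf D k ω := by
    have := h.le_deltaTrue k ω
    have : 0 < trueTau P prm εf D k ω := hC.τm.trans_le (h.τm_le k ω)
    exact le_trans (by positivity) (h.le_deltaTrue k ω)
  have hD' : C.κl * tauBar P prm εf D k ω *
      (‖dBar P prm εf D k ω‖ ^ 2 + ‖P.c (run P prm εf D k ω).x‖) ≤ deltaBar P prm εf D k ω :=
    (h.le_deltaBar k ω).trans (mul_le_of_le_one_left hΔ'0
      (pow_le_one₀ prm.γ_mem.1.le prm.γ_mem.2.le))
  have hD : C.κl * C.τm * ‖(trueSolution P prm εf D k ω).1‖ ^ 2 ≤ deltaTrue P prm εf D k ω := by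
    refine le_trans ?_ (h.le_deltaTrue k ω)
    have := h.τm_le k ω
    have := hC.τm
    have : 0 < trueTau P prm εf D k ω := hC.τm.trans_le (h.τm_le k ω)
    gcongr
    exact le_add_of_nonneg_right (norm_nonneg _)
  have hNd := hloc.abs_inner_sub_le hκH hζ hs hs'
  have hNd' := hloc.abs_inner_sub_le hκH hζ hs' hs
  have hQd := hloc.abs_curvedSlope_sub_le hκH hζ hs hs'
  have hQd' := hloc.abs_curvedSlope_sub_le hκH hζ hs' hs
  rw [abs_sub_comm, norm_sub_rev (gradient P.f (run P prm εf D k ω).x)] at hNd' hQd'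
  have hY := hloc.inner_le hκH hζ hs hs' (h.y_le k ω)
  have hq' : tauBar P prm εf D k ω * curvedSlope (D.H k ω) (gBar P prm εf D k ω)
      (dBar P prm εf D k ω) ≤ (1 - prm.σ) * l1norm (P.c (run P prm εf D k ω).x) :=
    meritUpdate_mul_curvedSlope_le prm.σ_mem (run_τ_pos hC.τbm h.tau k ω)
  have eBar : deltaBar P prm εf D k ω = -tauBar P prm εf D k ω *
      ⟪gBar P prm εf D k ω, dBar P prm εf D k ω⟫_ℝ + l1norm (P.c (run P prm εf D k ω).x) :=
    P.modelReduction_eq _ _ _ _ (by rw [hs'.feas, add_neg_cancel])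
  have eTrue : deltaTrue P prm εf D k ω = -trueTau P prm εf D k ω *
      ⟪gradient P.f (run P prm εf D k ω).x, (trueSolution P prm εf D k ω).1⟫_ℝ +
        l1norm (P.c (run P prm εf D k ω).x) :=
    P.modelReduction_eq _ _ _ _ (by rw [hs.feas, add_neg_cancel])
  have hacc' : ‖gBar P prm εf D k ω - gradient P.f (run P prm εf D k ω).x‖ ≤
      max εg (C.κFO * (run P prm εf D k ω).α * √(deltaBar P prm εf D k ω)) := hacc
  rcases le_max_iff.1 hacc' with hw | hw
  · have hw1 : ‖gBar P prm εf D k ω - gradient P.f (run P prm εf D k ω).x‖ ≤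
        η * √(deltaTrue P prm εf D k ω) := by
      rw [div_le_iff₀ hη0] at hε
      calc _ ≤ εg := hw
        _ ≤ η * ε := by linarith
        _ ≤ _ := by gcongr
    have h3 := reduction_le_of_bounds prm.ετ_mem hT'0 hq' hNd (by positivity) hQd hY
    rw [← eBar] at h3
    change (-trueTau P prm εf D k ω * _ + _ ≤ _) ∨ (-trueTau P prm εf D k ω * _ + _ ≤ _) ∨
      (-trueTau P prm εf D k ω * _ + _ ≤ _) at h3
    rw [← eTrue, ← h.ετ_eq] at h3
    have h4 := hC.reduction_le_of_abs_error hη0 (norm_nonneg _) hΔ0 (norm_nonneg _) (norm_nonneg _)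
      hT'0 hT' hw1 hD hD' rfl rfl rfl h3
    refine ⟨hC.minRatio_mul_le_of_abs hΔ0 h4, Or.inl (hw1.trans ?_)⟩
    gcongr
    exact hC.sqrt_le_absRatio_mul hη h4
  · have h3 := reduction_le_of_bounds prm.ετ_mem hT'0 hq' hNd' (by positivity) hQd' hY
    rw [← eBar] at h3
    change (-trueTau P prm εf D k ω * _ + _ ≤ _) ∨ (-trueTau P prm εf D k ω * _ + _ ≤ _) ∨
      (-trueTau P prm εf D k ω * _ + _ ≤ _) at h3
    rw [← eTrue, ← h.ετ_eq] at h3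
    have h4 := hC.reduction_le_of_rel_error (hα.2.trans_eq h.αmax_eq.symm) (norm_nonneg _) hΔ'0
      (norm_nonneg _) (norm_nonneg _) hT'0 hT' hw hD' rfl rfl rfl h3
    exact ⟨hC.minRatio_mul_le_of_rel hΔ0 h4, Or.inr hw⟩

end Run

section Run

variable {n m : ℕ} {Ω : Type u} {Ω₀ : Type v} {Ω₁ : Type w} {P : Problem n m} {X : Set (Vec n)}
  {L : ℝ} {Lc : Fin m → ℝ} {prm : Params n} {D : Inputs n Ω Ω₀ Ω₁} {εf : ℝ}
  {C : Consts} {k : ℕ} {ω : Ω} {εg η ε finf φmin τbmin : ℝ}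

theorem errCur_nonneg (k : ℕ) (ω : Ω) : 0 ≤ errCur P prm εf D k ω := abs_nonneg _

theorem errTrial_nonneg (k : ℕ) (ω : Ω) : 0 ≤ errTrial P prm εf D k ω := abs_nonneg _

/-- A true iteration with a step size of at most `α̃ / γ²` is successful as long as the target
accuracy is not reached. -/
theorem RunBounds.successful (h : RunBounds P prm εf D X Lc C) (hη : C.EtaAdmissible η)
    (hε : εg / η ≤ ε) (hlt : ε < √(deltaTrue P prm εf D k ω))
    (htrue : ω ∈ trueSet P prm εf D εg C.κFO k)
    (hα : prm.γ ^ 2 * (run P prm εf D k ω).α ≤ C.αTilde η) : Successful P prm εf D k ω := by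
  obtain ⟨hacc, hnoise⟩ := htrue
  obtain ⟨-, hw⟩ := h.reduction_of_accurate hη hε hlt hacc
  obtain ⟨κ, hκ0, hκ⟩ := h.regular.jac_singular_values
  have hC := h.valid
  have hγ := prm.γ_mem
  have hloc := localBounds_run h.stays h.hessian hκ k ω
  have hs' : IsSQPStep (D.H k ω) (P.jac (run P prm εf D k ω).x)
      (gBar P prm εf D k ω) (P.c (run P prm εf D k ω).x) (dBar P prm εf D k ω) _ :=
    hloc.isSQPStep hC.ζ hκ0 _ _
  have hT0 := h.tauBar_pos k ω
  have hα' := run_α_mem (P := P) (prm := prm) (εf := εf) (D := D) k ω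
  have hD : C.κl * tauBar P prm εf D k ω * ‖dBar P prm εf D k ω‖ ^ 2 ≤
      (prm.γ ^ 2) ^ 2 * deltaBar P prm εf D k ω := by
    refine le_trans ?_ ((h.le_deltaBar k ω).trans_eq (by ring))
    have := hC.κl
    gcongr
    exact le_add_of_nonneg_right (norm_nonneg _)
  have h1 := hC.error_le_reduction hη (pow_pos hγ.1 2) (pow_le_one₀ hγ.1.le hγ.2.le) hα'.1.le hα
    (h.deltaBar_nonneg k ω) (norm_nonneg _) (h.tau k ω) (h.tauBar_le k ω) hD hw
  have h2 : P.merit (xPlus P prm εf D k ω) (tauBar P prm εf D k ω) ≤ _ :=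
    h.regular.merit_step_le (g := gBar P prm εf D k ω) hα'.1.le
      (hα'.2.trans prm.αmax_mem.2) hT0.le (h.stays k ω).1 (h.stays k ω).2 hs'.feas
  have eBar : deltaBar P prm εf D k ω = -tauBar P prm εf D k ω *
      ⟪gBar P prm εf D k ω, dBar P prm εf D k ω⟫_ℝ + l1norm (P.c (run P prm εf D k ω).x) :=
    P.modelReduction_eq _ _ _ _ (by rw [hs'.feas, add_neg_cancel])
  change _ ≤ _ - _ * (-tauBar P prm εf D k ω *
      ⟪gBar P prm εf D k ω, dBar P prm εf D k ω⟫_ℝ + l1norm (P.c (run P prm εf D k ω).x)) + _ *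
      (_ * (_ * ‖dBar P prm εf D k ω‖)) + _ * (_ * ‖dBar P prm εf D k ω‖ ^ 2) at h2
  rw [← eBar, ← h.Γ_eq] at h2
  have h3 : tauBar P prm εf D k ω * (D.fbar (xPlus P prm εf D k ω) (D.ξp k ω)
      - P.f (xPlus P prm εf D k ω)) ≤ tauBar P prm εf D k ω * errTrial P prm εf D k ω := by
    gcongr; exact le_abs_self _
  have h4 : tauBar P prm εf D k ω * (P.f (run P prm εf D k ω).x
      - D.fbar (run P prm εf D k ω).x (D.ξ0 k ω)) ≤
      tauBar P prm εf D k ω * errCur P prm εf D k ω := by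
    gcongr; rw [errCur, abs_sub_comm]; exact le_abs_self _
  have h5 : tauBar P prm εf D k ω * (errCur P prm εf D k ω + errTrial P prm εf D k ω) ≤
      tauBar P prm εf D k ω * (2 * εf) := by gcongr
  simp only [Problem.merit] at h2
  rw [h.θ_eq] at h1
  change tauBar P prm εf D k ω * D.fbar (xPlus P prm εf D k ω) (D.ξp k ω) +
    l1norm (P.c (xPlus P prm εf D k ω)) ≤ tauBar P prm εf D k ω *
      D.fbar (run P prm εf D k ω).x (D.ξ0 k ω) + l1norm (P.c (run P prm εf D k ω).x) -
      (run P prm εf D k ω).α * prm.θ * deltaBar P prm εf D k ω + 2 * tauBar P prm εf D k ω * εf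
  linarith

/-- The measure of progress increases at most by the noise, and decreases in successful
iterations. -/
theorem RunBounds.progress_succ_le (h : RunBounds P prm εf D X Lc C) (hf : ∀ x ∈ X, finf ≤ P.f x)
    (k : ℕ) (ω : Ω) :
    progress P prm εf D φmin finf τbmin (k + 1) ω ≤ progress P prm εf D φmin finf τbmin k ω +
      ind (Successful P prm εf D k ω) *
        (tauBar P prm εf D k ω * (2 * εf + errCur P prm εf D k ω + errTrial P prm εf D k ω) -
          (run P prm εf D k ω).α * prm.θ * deltaBar P prm εf D k ω) := by
  have hτle := tauBar_succ_le h.valid.τbm h.tau k ω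
  have hx := hf _ (h.stays (k + 1) ω).1
  -- a smaller merit parameter does not increase `τ (f(x) - finf)`
  have h1 : (tauBar P prm εf D (k + 1) ω) * (P.f (run P prm εf D (k + 1) ω).x - finf) ≤
      (tauBar P prm εf D k ω) * (P.f (run P prm εf D (k + 1) ω).x - finf) :=
    mul_le_mul_of_nonneg_right hτle (by linarith)
  have hT0 := h.tauBar_pos k ω
  simp only [progress, Problem.merit]
  by_cases hsucc : Successful P prm εf D k ω
  · rw [ind_of_true hsucc]
    have hsd : tauBar P prm εf D k ω * D.fbar (xPlus P prm εf D k ω) (D.ξp k ω) +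
      l1norm (P.c (xPlus P prm εf D k ω)) ≤ tauBar P prm εf D k ω *
        D.fbar (run P prm εf D k ω).x (D.ξ0 k ω) + l1norm (P.c (run P prm εf D k ω).x) -
        (run P prm εf D k ω).α * prm.θ * deltaBar P prm εf D k ω +
        2 * tauBar P prm εf D k ω * εf := hsucc
    have hxs : (run P prm εf D (k + 1) ω).x = xPlus P prm εf D k ω := by
      rw [run_succ_of_successful hsucc]
    rw [hxs] at h1 ⊢
    have h3 : tauBar P prm εf D k ω * (P.f (xPlus P prm εf D k ω) -
        D.fbar (xPlus P prm εf D k ω) (D.ξp k ω)) ≤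
        tauBar P prm εf D k ω * errTrial P prm εf D k ω := by
      gcongr; rw [errTrial, abs_sub_comm]; exact le_abs_self _
    have h4 : tauBar P prm εf D k ω * (D.fbar (run P prm εf D k ω).x (D.ξ0 k ω) -
        P.f (run P prm εf D k ω).x) ≤ tauBar P prm εf D k ω * errCur P prm εf D k ω := by
      gcongr; exact le_abs_self _
    linarith
  · rw [ind_of_false hsucc]
    have hxs : (run P prm εf D (k + 1) ω).x = (run P prm εf D k ω).x := by
      rw [run_succ_of_not_successful hsucc]
    rw [hxs] at h1 ⊢
    linarith

theorem RunBounds.progress_nonneg (h : RunBounds P prm εf D X Lc C) (hf : ∀ x ∈ X, finf ≤ P.f x)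
    (hφ : ∀ x ∈ X, φmin ≤ P.merit x C.τbm) (k : ℕ) (ω : Ω) :
    0 ≤ progress P prm εf D φmin finf C.τbm k ω := by
  have hx := (h.stays k ω).1
  have h1 := hφ _ hx
  have h2 := hf _ hx
  have h3 : C.τbm * (P.f (run P prm εf D k ω).x - finf) ≤
      tauBar P prm εf D k ω * (P.f (run P prm εf D k ω).x - finf) :=
    mul_le_mul_of_nonneg_right (h.tau k ω) (by linarith)
  simp only [progress, Problem.merit] at h1 ⊢
  linarith

/-- The progress made in the true, successful iterations with large steps is bounded by the initial
measure of progress and the accumulated noise. -/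
theorem RunBounds.sum_progress_le (h : RunBounds P prm εf D X Lc C) (hεf : 0 ≤ εf)
    (hf : ∀ x ∈ X, finf ≤ P.f x) (hφ : ∀ x ∈ X, φmin ≤ P.merit x C.τbm) (hη : C.EtaAdmissible η)
    (hε0 : 0 ≤ ε) (hε : εg / η ≤ ε) {t : ℕ} (hlt : ∀ k < t, ε < √(deltaTrue P prm εf D k ω)) :
    C.h η ε (C.αTilde η) * ∑ k ∈ Finset.range t, ind (ω ∈ trueSet P prm εf D εg C.κFO k ∧
        Successful P prm εf D k ω ∧ C.αTilde η ≤ (run P prm εf D k ω).α) ≤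
      progress P prm εf D φmin finf C.τbm 0 ω + 4 * prm.τinit * εf * t +
        ∑ k ∈ Finset.range t, prm.τinit *
          (errCur P prm εf D k ω + errTrial P prm εf D k ω - 2 * εf) := by
  have hC := h.valid
  have hθ := prm.θ_mem
  have hr := hC.minRatio_pos hη
  have hstep : ∀ k < t, progress P prm εf D φmin finf C.τbm (k + 1) ω +
      C.h η ε (C.αTilde η) * ind (ω ∈ trueSet P prm εf D εg C.κFO k ∧
        Successful P prm εf D k ω ∧ C.αTilde η ≤ (run P prm εf D k ω).α) ≤
      progress P prm εf D φmin finf C.τbm k ω + prm.τinit *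
        (2 * εf + errCur P prm εf D k ω + errTrial P prm εf D k ω) := by
    intro k hk
    have h1 := h.progress_succ_le (φmin := φmin) (τbmin := C.τbm) hf k ω
    have hE : 0 ≤ 2 * εf + errCur P prm εf D k ω + errTrial P prm εf D k ω := by
      have := errCur_nonneg (P := P) (prm := prm) (εf := εf) (D := D) k ω
      have := errTrial_nonneg (P := P) (prm := prm) (εf := εf) (D := D) k ω
      positivity
    have hτ : tauBar P prm εf D k ω * (2 * εf + errCur P prm εf D k ω + errTrial P prm εf D k ω) ≤
        prm.τinit * (2 * εf + errCur P prm εf D k ω + errTrial P prm εf D k ω) := by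
      gcongr
      exact tauBar_le_τinit hC.τbm h.tau k ω
    have hτ0 : 0 ≤ prm.τinit * (2 * εf + errCur P prm εf D k ω + errTrial P prm εf D k ω) :=
      mul_nonneg prm.τinit_pos.le hE
    have hα := (run_α_mem (P := P) (prm := prm) (εf := εf) (D := D) k ω).1
    have hΔ0 := h.deltaBar_nonneg k ω
    have hdec : 0 ≤ (run P prm εf D k ω).α * prm.θ * deltaBar P prm εf D k ω :=
      mul_nonneg (mul_nonneg hα.le hθ.1.le) hΔ0
    by_cases hs : Successful P prm εf D k ω
    · rw [ind_of_true hs] at h1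
      by_cases hgood : ω ∈ trueSet P prm εf D εg C.κFO k ∧
          Successful P prm εf D k ω ∧ C.αTilde η ≤ (run P prm εf D k ω).α
      · rw [ind_of_true hgood]
        have hred := (h.reduction_of_accurate hη hε (hlt k hk) hgood.1.1).1
        have hε2 : ε ^ 2 ≤ deltaTrue P prm εf D k ω := (Real.lt_sqrt hε0).1 (hlt k hk) |>.le
        have h2 : C.h η ε (C.αTilde η) ≤
            (run P prm εf D k ω).α * prm.θ * deltaBar P prm εf D k ω := by
          rw [Consts.h_eq, h.θ_eq]
          calc C.αTilde η * prm.θ * ε ^ 2 * C.minRatio η =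
                C.αTilde η * prm.θ * (C.minRatio η * ε ^ 2) := by ring
            _ ≤ (run P prm εf D k ω).α * prm.θ * deltaBar P prm εf D k ω := by
                have := hθ.1
                refine mul_le_mul (mul_le_mul_of_nonneg_right hgood.2.2 this.le) ?_
                  (by positivity) (by positivity)
                exact (mul_le_mul_of_nonneg_left hε2 hr.le).trans hred
        linarith
      · rw [ind_of_false hgood]
        linarith
    · rw [ind_of_false hs] at h1
      rw [ind_of_false (fun h' => hs h'.2.1)]
      linarith
  have hsum : ∀ j ≤ t, progress P prm εf D φmin finf C.τbm j ω +
      C.h η ε (C.αTilde η) * ∑ k ∈ Finset.range j, ind (ω ∈ trueSet P prm εf D εg C.κFO k ∧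
        Successful P prm εf D k ω ∧ C.αTilde η ≤ (run P prm εf D k ω).α) ≤
      progress P prm εf D φmin finf C.τbm 0 ω + 4 * prm.τinit * εf * j +
        ∑ k ∈ Finset.range j, prm.τinit *
          (errCur P prm εf D k ω + errTrial P prm εf D k ω - 2 * εf) := by
    intro j
    induction j with
    | zero => intro _; simp
    | succ j ih =>
      intro hj
      have h1 := ih (by omega)
      have h2 := hstep j (by omega)
      rw [Finset.sum_range_succ, Finset.sum_range_succ]
      push_cast
      linarith
  have h1 := hsum t le_rfl
  have h2 := h.progress_nonneg hf hφ t ω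
  linarith

theorem lt_of_lt_stoppingTime {t k : ℕ} (h : (t : ℕ∞) < stoppingTime P prm εf D ε ω)
    (hk : k ≤ t) : ε < √(deltaTrue P prm εf D k ω) := by
  by_contra hle
  have h1 : stoppingTime P prm εf D ε ω ≤ k :=
    iInf₂_le (f := fun (j : ℕ) (_ : √(deltaTrue P prm εf D j ω) ≤ ε) => (j : ℕ∞)) k (not_lt.1 hle)
  have h2 : (k : ℕ∞) ≤ t := by exact_mod_cast hk
  exact absurd (h1.trans h2) (not_le.2 h)

/-- If sufficiently many of the first `t` iterations are true and the accumulated noise is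
sufficiently small, then the target accuracy is reached within `t` iterations. -/
theorem RunBounds.stoppingTime_le (h : RunBounds P prm εf D X Lc C) (hεf : 0 ≤ εf)
    (hf : ∀ x ∈ X, finf ≤ P.f x) (hφ : ∀ x ∈ X, φmin ≤ P.merit x C.τbm) (hη : C.EtaAdmissible η)
    (hε0 : 0 < ε) (hε : εg / η ≤ ε) (hα0 : C.αTilde η ≤ prm.γ * prm.α0) {s phat : ℝ} {t : ℕ}
    (hphat : 1 / 2 + (4 * prm.τinit * εf + s) / C.h η ε (C.αTilde η) < phat)
    (ht : C.R η ε prm.α0 prm.γ (progress P prm εf D φmin finf C.τbm 0 ω) /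
      (phat - 1 / 2 - (4 * prm.τinit * εf + s) / C.h η ε (C.αTilde η)) ≤ t)
    (htrue : phat * t < ∑ k ∈ Finset.range t, ind (ω ∈ trueSet P prm εf D εg C.κFO k))
    (hnoise : ∑ k ∈ Finset.range t, prm.τinit *
      (errCur P prm εf D k ω + errTrial P prm εf D k ω - 2 * εf) < s * t) :
    stoppingTime P prm εf D ε ω ≤ t := by
  by_contra hT
  push Not at hT
  have hlt : ∀ k < t, ε < √(deltaTrue P prm εf D k ω) := fun k hk =>
    lt_of_lt_stoppingTime hT hk.le
  have hC := h.valid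
  have ha0 := hC.αTilde_pos hη
  have hh0 : 0 < C.h η ε (C.αTilde η) := by
    have := hC.minRatio_pos hη
    have := hC.θ.1
    rw [Consts.h_eq]
    positivity
  have h1 := h.sum_progress_le hεf hf hφ hη hε0.le hε hlt
  have hmem := fun k => run_α_mem (P := P) (prm := prm) (εf := εf) (D := D) k ω
  have h2 := sum_ind_true_le (α := fun k => (run P prm εf D k ω).α)
    (succ := fun k => Successful P prm εf D k ω)
    (tr := fun k => ω ∈ trueSet P prm εf D εg C.κFO k) (t := t) prm.γ_mem ha0 hα0
    (fun k => (hmem k).1) (fun k => (hmem k).2)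
    (fun k hk => by rw [run_succ_of_successful hk])
    (fun k hk => by rw [run_succ_of_not_successful hk])
    (fun k hk htr hle => h.successful hη hε (hlt k hk) htr hle)
  simp only [show (run P prm εf D 0 ω).α = prm.α0 from rfl] at h2
  rw [div_le_iff₀ (by linarith), Consts.R] at ht
  set N := ∑ k ∈ Finset.range t, ind (ω ∈ trueSet P prm εf D εg C.κFO k ∧
        Successful P prm εf D k ω ∧ C.αTilde η ≤ (run P prm εf D k ω).α) with hN
  set hh := C.h η ε (C.αTilde η) with hhdef
  set Z := progress P prm εf D φmin finf C.τbm 0 ω with hZ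
  have h3 : N ≤ Z / hh + (4 * prm.τinit * εf + s) / hh * t := by
    have e : Z / hh + (4 * prm.τinit * εf + s) / hh * t =
        (Z + 4 * prm.τinit * εf * t + s * t) / hh := by ring
    rw [e, le_div_iff₀ hh0]
    linarith
  linarith

end Run

/-- A lower bound of a probability from upper bounds of the probabilities of two events outside of
which the event in question occurs. -/
theorem one_sub_le_measureReal {Ω : Type*} [MeasurableSpace Ω] {μ : Measure Ω}
    [IsProbabilityMeasure μ] {S B₁ B₂ : Set Ω} {a b : ℝ} (ha : 0 ≤ a) (hb : 0 ≤ b)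
    (h1 : μ B₁ ≤ ENNReal.ofReal a) (h2 : μ B₂ ≤ ENNReal.ofReal b)
    (h : ∀ᵐ ω ∂μ, ω ∉ B₁ → ω ∉ B₂ → ω ∈ S) : 1 - a - b ≤ μ.real S := by
  have h3 : μ Set.univ ≤ μ (S ∪ (B₁ ∪ B₂)) := by
    refine measure_mono_ae ?_
    filter_upwards [h] with ω hω _
    by_cases hb1 : ω ∈ B₁
    · exact Or.inr (Or.inl hb1)
    · by_cases hb2 : ω ∈ B₂
      · exact Or.inr (Or.inr hb2)
      · exact Or.inl (hω hb1 hb2)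
  have h4 : (1 : ℝ≥0∞) ≤ ENNReal.ofReal (μ.real S + (a + b)) := by
    rw [ENNReal.ofReal_add measureReal_nonneg (by positivity), ENNReal.ofReal_add ha hb,
      ofReal_measureReal]
    calc (1 : ℝ≥0∞) = μ Set.univ := measure_univ.symm
      _ ≤ μ S + (μ B₁ + μ B₂) := h3.trans ((measure_union_le _ _).trans
          (by gcongr; exact measure_union_le _ _))
      _ ≤ _ := by gcongr
  have h5 := ENNReal.one_le_ofReal.1 h4
  linarith

end SSSQP

theorem mainTheorem1 {n m : ℕ} (hmn : m ≤ n) (P : SSSQP.Problem n m)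
    (X : Set (SSSQP.Vec n)) (L : ℝ) (Lc : Fin m → ℝ) (hP : P.Regular X L Lc)
    (κH ζ τbmin : ℝ) (hκH : 0 < κH) (hζ : 0 < ζ) (hτbmin : 0 < τbmin)
    (prm : SSSQP.Params n) :
    ∃ κy κl τmin : ℝ, 0 < κy ∧ 0 < κl ∧ 0 < τmin ∧
      ∀ (Ω : Type u) (Ω₀ : Type v) (Ω₁ : Type w)
        [mΩ : MeasurableSpace Ω] [MeasurableSpace Ω₀] [MeasurableSpace Ω₁]
        (μ : Measure Ω) (P₀ : Measure Ω₀) (P₁ : Measure Ω₁)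
        [IsProbabilityMeasure μ] [IsProbabilityMeasure P₀] [IsProbabilityMeasure P₁]
        (D : SSSQP.Inputs n Ω Ω₀ Ω₁) (ℱ : Filtration ℕ mΩ) (εf ν b εg κFO δ : ℝ),
        SSSQP.Sampling D μ P₀ P₁ ℱ →
        SSSQP.StaysIn P prm εf D X →
        SSSQP.HessianBounds P prm εf D κH ζ →
        (∀ k ω, τbmin ≤ SSSQP.tauBar P prm εf D k ω) →
        SSSQP.ZerothOracle P D P₀ X εf ν b →
        SSSQP.FirstOrderOracle P prm εf D μ P₁ εg κFO δ →
        (∀ k ω,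
          ‖(SSSQP.trueSolution P prm εf D k ω).2‖ ≤ κy ∧
          τmin ≤ SSSQP.trueTau P prm εf D k ω ∧
          κl * SSSQP.tauBar P prm εf D k ω *
              (‖SSSQP.dBar P prm εf D k ω‖ ^ 2 + ‖P.c (SSSQP.run P prm εf D k ω).x‖) ≤
            SSSQP.deltaBar P prm εf D k ω ∧
          κl * SSSQP.trueTau P prm εf D k ω *
              (‖(SSSQP.trueSolution P prm εf D k ω).1‖ ^ 2
                + ‖P.c (SSSQP.run P prm εf D k ω).x‖) ≤
            SSSQP.deltaTrue P prm εf D k ω) ∧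
        ∀ (finf φmin : ℝ), (∀ x ∈ X, finf ≤ P.f x) → (∀ x ∈ X, φmin ≤ P.merit x τbmin) →
        ∀ C : SSSQP.Consts,
          C = { κH := κH, ζ := ζ, κy := κy, κl := κl, τm := τmin, τbm := τbmin,
                τi := prm.τinit, αmax := prm.αmax, θ := prm.θ, σ := prm.σ, ετ := prm.ετ,
                L := L, Γ := ∑ i, Lc i, κFO := κFO } →
        ∀ p : ℝ,
          (SSSQP.BoundedNoise P prm εf D μ ∧ p = 1 - δ) ∨
            (SSSQP.IndependentNoise P prm εf D μ ∧
              p = 1 - δ - SSSQP.subexpTail (SSSQP.noiseGap P D P₀ X εf) 1 ν b) →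
          1 / 2 < p →
        ∀ η ε : ℝ, C.EtaAdmissible η → max (εg / η) (√εf * C.ω7 η p * C.ω8 η) < ε →
        ∀ (s phat : ℝ) (t : ℕ), 0 ≤ s →
          1 / 2 + (4 * prm.τinit * εf + s) / C.h η ε (C.αTilde η) < phat → phat < p →
          (∀ᵐ ω ∂μ,
            C.R η ε prm.α0 prm.γ (SSSQP.progress P prm εf D φmin finf τbmin 0 ω) /
              (phat - 1 / 2 - (4 * prm.τinit * εf + s) / C.h η ε (C.αTilde η)) ≤ t) →
          1 - Real.exp (-((p - phat) ^ 2 / (2 * p ^ 2) * t))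
              - SSSQP.subexpTail s t (2 * prm.τinit * ν) (2 * prm.τinit * b) ≤
            μ.real {ω | SSSQP.stoppingTime P prm εf D ε ω ≤ t} := by
  obtain ⟨κy, κs, τmin, hκy, hκs, hτmin, hτmin_le, hbounds⟩ :=
    SSSQP.exists_run_bounds.{u, v, w} hP hκH hζ hτbmin prm
  have hγ := prm.γ_mem
  have hα0 := prm.α0_mem.1
  have hθ' : 0 < 1 - prm.θ := by linarith [prm.θ_mem.2]
  have hΓ : 0 ≤ ∑ i, Lc i := Finset.sum_nonneg fun i _ => hP.Lc_nonneg i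
  have hLip : 0 < L / 2 + (∑ i, Lc i) / (2 * τbmin) := by
    rcases hP.L_nonneg.lt_or_eq with h | h
    · positivity
    · have : 0 < ∑ i, Lc i := by linarith [hP.lipschitz_pos]
      positivity
  -- The factor `γ⁴` provides the slack needed because `α̃` need not be a value of the step size;
  -- the second bound makes `α̃` at most `γ α₀`.
  set κl : ℝ := min (prm.γ ^ 4 * κs)
    (prm.γ * prm.α0 * (L / 2 + (∑ i, Lc i) / (2 * τbmin)) / (1 - prm.θ)) with hκldef
  have hγ4 : 0 < prm.γ ^ 4 := pow_pos hγ.1 4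
  have hκl : 0 < κl := by
    have := hγ.1
    exact lt_min (by positivity) (by positivity)
  have hκlγ : κl ≤ prm.γ ^ 4 * κs := min_le_left _ _
  have hκls : κl ≤ κs :=
    hκlγ.trans (mul_le_of_le_one_left hκs.le (pow_le_one₀ hγ.1.le hγ.2.le))
  refine ⟨κy, κl, τmin, hκy, hκl, hτmin, ?_⟩
  intro Ω Ω₀ Ω₁ mΩ _ _ μ P₀ P₁ _ _ _ D ℱ εf ν b εg κFO δ hD hX hH hτ hO hF
  have hb := hbounds Ω Ω₀ Ω₁ D εf hX hH hτ
  have hτ0 : ∀ k ω, 0 < SSSQP.tauBar P prm εf D k ω := fun k ω => hτbmin.trans_le (hτ k ω)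
  have hT0 : ∀ k ω, 0 < SSSQP.trueTau P prm εf D k ω := fun k ω => hτmin.trans_le (hb k ω).2.1
  have hbar : ∀ k ω, κl * SSSQP.tauBar P prm εf D k ω *
      (‖SSSQP.dBar P prm εf D k ω‖ ^ 2 + ‖P.c (SSSQP.run P prm εf D k ω).x‖) ≤
      prm.γ ^ 4 * SSSQP.deltaBar P prm εf D k ω := by
    intro k ω
    have h1 := (hb k ω).2.2.1
    have h2 := hτ0 k ω
    calc _ ≤ prm.γ ^ 4 * κs * SSSQP.tauBar P prm εf D k ω *
          (‖SSSQP.dBar P prm εf D k ω‖ ^ 2 + ‖P.c (SSSQP.run P prm εf D k ω).x‖) := by gcongr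
      _ = prm.γ ^ 4 * (κs * SSSQP.tauBar P prm εf D k ω *
          (‖SSSQP.dBar P prm εf D k ω‖ ^ 2 + ‖P.c (SSSQP.run P prm εf D k ω).x‖)) := by ring
      _ ≤ _ := by gcongr
  have htrue : ∀ k ω, κl * SSSQP.trueTau P prm εf D k ω *
      (‖(SSSQP.trueSolution P prm εf D k ω).1‖ ^ 2 + ‖P.c (SSSQP.run P prm εf D k ω).x‖) ≤
      SSSQP.deltaTrue P prm εf D k ω := by
    intro k ω
    refine le_trans ?_ (hb k ω).2.2.2
    have h2 := hT0 k ω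
    gcongr
  refine ⟨fun k ω => ⟨(hb k ω).1, (hb k ω).2.1, ?_, htrue k ω⟩, ?_⟩
  · refine le_trans ?_ (hb k ω).2.2.1
    have h2 := hτ0 k ω
    gcongr
  intro finf φmin hfinf hφmin C hCdef p hp hp2 η ε hη hε s phat t hs hphat hphatp ht
  have hrun : SSSQP.RunBounds P prm εf D X Lc C := by
    subst hCdef
    exact
      { regular := hP, stays := hX, hessian := hH, tau := hτ
        valid := ⟨hκH, hζ, hκy, hκl, hτmin, hτbmin, prm.τinit_pos, hτmin_le, prm.αmax_mem.1,
          prm.θ_mem, prm.σ_mem, prm.ετ_mem, hP.L_nonneg, hΓ, hP.lipschitz_pos, hF.κFO_nonneg⟩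
        τi_eq := rfl, αmax_eq := rfl, θ_eq := rfl, σ_eq := rfl, ετ_eq := rfl, Γ_eq := rfl
        y_le := fun k ω => (hb k ω).1, τm_le := fun k ω => (hb k ω).2.1
        le_deltaBar := hbar, le_deltaTrue := htrue }
  have hC := hrun.valid
  have hαT : C.αTilde η ≤ prm.γ * prm.α0 := by
    refine (min_le_left _ _).trans ?_
    rw [div_le_iff₀ hC.denom_pos]
    subst hCdef
    simp only
    have h1 : κl * (1 - prm.θ) ≤ prm.γ * prm.α0 * (L / 2 + (∑ i, Lc i) / (2 * τbmin)) :=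
      (le_div_iff₀ hθ').1 (min_le_right _ _)
    have h2 : prm.γ * prm.α0 * (L / (2 * κl) + (∑ i, Lc i) / (2 * τbmin * κl)) =
        prm.γ * prm.α0 * (L / 2 + (∑ i, Lc i) / (2 * τbmin)) / κl := by field_simp
    have h3 : 1 - prm.θ ≤ prm.γ * prm.α0 * (L / (2 * κl) + (∑ i, Lc i) / (2 * τbmin * κl)) := by
      rw [h2, le_div_iff₀ hκl]; linarith
    have h4 : 0 ≤ prm.γ * prm.α0 * (√(prm.τinit / κl) * κFO) :=
      mul_nonneg (mul_nonneg hγ.1.le hα0.le) (mul_nonneg (Real.sqrt_nonneg _) hF.κFO_nonneg)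
    linarith
  have hεg : εg / η < ε := (le_max_left _ _).trans_lt hε
  have hε0 : 0 < ε := by
    refine lt_of_le_of_lt ?_ hεg
    exact div_nonneg hF.εg_nonneg hη.1.le
  have hp1 : p ≤ 1 := by
    have h1 := hF.δ_nonneg
    have h2 := SSSQP.subexpTail_nonneg (SSSQP.noiseGap P D P₀ X εf) 1 ν b
    rcases hp with ⟨-, rfl⟩ | ⟨-, rfl⟩ <;> linarith
  have hτC : C.τbm = τbmin := by rw [hCdef]
  have hκC : C.κFO = κFO := by rw [hCdef]
  refine SSSQP.one_sub_le_measureReal (Real.exp_pos _).le (SSSQP.subexpTail_nonneg _ _ _ _)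
    (SSSQP.measure_count_lt_le (ℱ := ℱ)
      (fun k => hD.measurableSet_trueSet (prm := prm) (εf := εf) (εg := εg) (κFO := κFO) hP k)
      hp2.le hp1 hphatp.le
      (fun k V hV hV1 => hD.lintegral_not_true_le hP hX hO hF hp hV hV1) t)
    (hD.measure_errSum_ge_le (prm := prm) hP hX hO prm.τinit_pos hs t) ?_
  filter_upwards [ht] with ω hω h1 h2
  rw [← hτC] at hω hφmin
  rw [← hκC] at h1
  exact hrun.stoppingTime_le hO.εf_nonneg hfinf hφmin hη hε0 hεg.le hαT hphat hω (not_le.1 h1)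
    (not_le.1 h2)
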